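/- Let $\Omega,\tilde\Omega\subset\mathbb{R}^n$ be bounded, uniformly convex domains with smooth boundary (all principal curvatures of the boundary are bounded below by a positive constant), and suppose $\overline{\tilde\Omega}\subset B_1(0)$. Then there is a constant $C>0$, depending only on $\Omega$ and $\tilde\Omega$, with the following property. If $c\in\mathbb{R}$ and $u\in C^\infty(\overline\Omega)$ is a strictly convex function with $|Du|<1$ in $\Omega$ that satisfies $$\mathrm{div}\left(\frac{Du}{\sqrt{1-|Du|^2}}\right)=c\quad\text{in }\Omega,\qquad Du(\Omega)=\tilde\Omega,$$ then $$\frac1C\,I_n\le D^2u(x)\le C\,I_n\qquad\text{for all }x\in\overline\Omega,$$ where $I_n$ is the $n\times n$ identity matrix and the inequalities are between symmetric matrices. -/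

import Mathlib

open scoped ContDiff MatrixOrder Gradient

noncomputable section

/-- Bounded, uniformly convex domain of `ℝⁿ` with smooth boundary: near each boundary point `p` the
set is `{h > 0}` for a smooth `h` with `Dh(p) ≠ 0`, and the second fundamental form of the boundary
with respect to the inner unit normal, `-D²h(ξ,ξ) / |Dh|` on tangent vectors `ξ`, is bounded below
by a constant `κ > 0` that does not depend on `p`. -/
structure IsSmoothUniformlyConvexDomain {n : ℕ} (Ω : Set (EuclideanSpace ℝ (Fin n))) : Prop where
  isOpen : IsOpen Ω
  nonempty : Ω.Nonempty
  isBounded : Bornology.IsBounded Ω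
  convex : Convex ℝ Ω
  boundary : ∃ κ : ℝ, 0 < κ ∧ ∀ p ∈ frontier Ω,
    ∃ (U : Set (EuclideanSpace ℝ (Fin n))) (h : EuclideanSpace ℝ (Fin n) → ℝ),
      IsOpen U ∧ p ∈ U ∧ ContDiffOn ℝ ∞ h U ∧ (∀ x ∈ U, x ∈ Ω ↔ 0 < h x) ∧
      fderiv ℝ h p ≠ 0 ∧
      ∀ ξ : EuclideanSpace ℝ (Fin n), fderiv ℝ h p ξ = 0 →
        fderiv ℝ (fderiv ℝ h) p ξ ξ ≤ -(κ * ‖fderiv ℝ h p‖ * ‖ξ‖ ^ 2)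

/-- Divergence `∑ᵢ ∂Xᵢ/∂xᵢ` of a vector field on `ℝⁿ`. -/
def euclideanDiv {n : ℕ} (X : EuclideanSpace ℝ (Fin n) → EuclideanSpace ℝ (Fin n))
    (x : EuclideanSpace ℝ (Fin n)) : ℝ :=
  ∑ i, fderiv ℝ X x (EuclideanSpace.single i 1) i

/-- The Lorentzian mean curvature operator `div (Du / √(1 - |Du|²))`. -/
def lorentzMeanCurvature {n : ℕ} (u : EuclideanSpace ℝ (Fin n) → ℝ)
    (x : EuclideanSpace ℝ (Fin n)) : ℝ :=
  euclideanDiv (fun y => (Real.sqrt (1 - ‖∇ u y‖ ^ 2))⁻¹ • ∇ u y) x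

/-- `u ∈ C^∞(closure Ω)` is a strictly convex solution, with constant `c`, of
`div (Du / √(1 - |Du|²)) = c` in `Ω`, `|Du| < 1`, `Du(Ω) = Ω'`. -/
structure IsStrictlyConvexCMCSolution {n : ℕ} (Ω Ω' : Set (EuclideanSpace ℝ (Fin n)))
    (u : EuclideanSpace ℝ (Fin n) → ℝ) (c : ℝ) : Prop where
  smooth : ContDiffOn ℝ ∞ u (closure Ω)
  strictConvex : StrictConvexOn ℝ Ω u
  spacelike : ∀ x ∈ Ω, ‖∇ u x‖ < 1
  equation : ∀ x ∈ Ω, lorentzMeanCurvature u x = c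
  gradient_image : (∇ u) '' Ω = Ω'

/-- The Hessian matrix `(Dᵢⱼu(x))` of a function on `closure Ω`; at boundary points the derivatives
are taken within `closure Ω`, that is, they are the continuous extensions of those in `Ω`. -/
def hessianMatrix {n : ℕ} (Ω : Set (EuclideanSpace ℝ (Fin n)))
    (u : EuclideanSpace ℝ (Fin n) → ℝ) (x : EuclideanSpace ℝ (Fin n)) :
    Matrix (Fin n) (Fin n) ℝ :=
  Matrix.of fun i j => iteratedFDerivWithin ℝ 2 u (closure Ω) x
    ![EuclideanSpace.single i 1, EuclideanSpace.single j 1]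

end

/-! Write `P = Du`, `W = D²u`, `T = D³u`. The equation reads `∑ ⟪W vᵢ, vᵢ⟫ = c` for a frame `vᵢ`
that depends on `P` and dominates an orthonormal basis. As `W ≥ 0`, this gives `W ≤ tr W ≤ c`, so
the upper bound only needs a bound for `c`. That bound comes from touching `u` by a paraboloid,
using `|Du| < 1`. Conversely `P` is `c`-Lipschitz and covers `Ω'`, so `c` is bounded away from zero.

The lower bound starts at the boundary. Let `f`, `f'` be defining functions of the two domains, `x₀
∈ ∂Ω`, `N = ∇ f x₀` and `b = ∇ f' (P x₀)`. The function `⟪b, P - P x₀⟫` is nonnegative because `Ω'`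
is convex. A Hopf lemma for it (`exists_hopf`) gives `W b = k N` with `k ≥ δ > 0`, and `|W b|² ≤ C
⟪W b, b⟫` turns this into uniform obliqueness `⟪N, b⟫ ≥ δ` (`exists_oblique`). Expanding `P(∂Ω) ⊆
∂Ω'` to second order along tangential `τ` bounds `⟪b, T τ τ⟫ / 2` by `K |W τ|² - k ε |τ|²`
(`inner_third_le`), where `ε` measures the uniform convexity of `Ω`.

Finally `W` is compared with `l (exp (A ⟪a, x⟫) - s) q(x, Du)`, where `q` is a metric making `b`
orthogonal to the tangent space of `∂Ω`, and `s` is the least number for which the comparison holds.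
It suffices that `s ≤ 0`; otherwise there is a contact point. If it is interior, the equation
differentiated twice is violated for large `A`: the gain is of order `A²` and the errors at most
linear in `A`, all with the common factor `l exp (A ⟪a, x⟫)`. The one exception, a mixed term in `W
ξ` and `T ξ`, is absorbed by the square of the first derivative that `second_deriv_ge_of_nonneg`
supplies (`not_interior_contact`). If it is on the boundary and `l` is small, the contact direction
is tangential, and `inner_third_le` contradicts the sign of the inward derivative
(`not_boundary_contact`). -/

open scoped ContDiff MatrixOrder Gradient

set_option maxSynthPendingDepth 3
set_option linter.unusedSectionVars false

open Set Filter Topology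

open scoped RealInnerProductSpace

/-! ### Taylor inequality and quadratic forms -/

section Calculus

lemma le_add_of_second_deriv_le {φ φ' φ'' : ℝ → ℝ} {c : ℝ}
    (h1 : ∀ t ∈ Icc (0 : ℝ) 1, HasDerivAt φ (φ' t) t)
    (h2 : ∀ t ∈ Icc (0 : ℝ) 1, HasDerivAt φ' (φ'' t) t)
    (hc : ∀ t ∈ Icc (0 : ℝ) 1, φ'' t ≤ c) : φ 1 ≤ φ 0 + φ' 0 + c / 2 := by
  have key : ∀ t ∈ Icc (0 : ℝ) 1, φ' t ≤ φ' 0 + c * t := by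
    intro t ht
    have hd : ∀ s ∈ Icc (0 : ℝ) 1, HasDerivAt (fun s => φ' s - c * s) (φ'' s - c) s := by
      intro s hs
      exact ((h2 s hs).sub ((hasDerivAt_id s).const_mul c)).congr_deriv (by simp)
    have hanti : AntitoneOn (fun s => φ' s - c * s) (Icc 0 1) :=
      antitoneOn_of_hasDerivWithinAt_nonpos (convex_Icc 0 1)
        (fun s hs => (hd s hs).continuousAt.continuousWithinAt)
        (fun s hs => (hd s (interior_subset hs)).hasDerivWithinAt)
        (fun s hs => by linarith [hc s (interior_subset hs)])
    have := hanti (left_mem_Icc.2 zero_le_one) ht ht.1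
    simp only [mul_zero, sub_zero] at this
    linarith
  have hd : ∀ s ∈ Icc (0 : ℝ) 1,
      HasDerivAt (fun s => φ s - φ' 0 * s - c / 2 * s ^ 2) (φ' s - φ' 0 - c * s) s := by
    intro s hs
    have := ((h1 s hs).sub ((hasDerivAt_id s).const_mul (φ' 0))).sub
      ((hasDerivAt_pow 2 s).const_mul (c / 2))
    refine this.congr_deriv ?_
    norm_num
    ring
  have hanti : AntitoneOn (fun s => φ s - φ' 0 * s - c / 2 * s ^ 2) (Icc 0 1) :=
    antitoneOn_of_hasDerivWithinAt_nonpos (convex_Icc 0 1)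
      (fun s hs => (hd s hs).continuousAt.continuousWithinAt)
      (fun s hs => (hd s (interior_subset hs)).hasDerivWithinAt)
      (fun s hs => by linarith [key s (interior_subset hs)])
  have := hanti (left_mem_Icc.2 zero_le_one) (right_mem_Icc.2 zero_le_one) zero_le_one
  norm_num at this
  linarith

variable {E : Type*} [NormedAddCommGroup E] [NormedSpace ℝ E]

lemma hasDerivAt_line (x v : E) (t : ℝ) : HasDerivAt (fun t : ℝ => x + t • v) v t := by
  simpa using ((hasDerivAt_id t).smul_const v).const_add x

lemma le_add_of_fderiv_fderiv_le {k : E → ℝ} {x₀ x : E} {c : ℝ}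
    (hd : ∀ z ∈ segment ℝ x₀ x, ContDiffAt ℝ 2 k z)
    (hc : ∀ z ∈ segment ℝ x₀ x, fderiv ℝ (fderiv ℝ k) z (x - x₀) (x - x₀) ≤ c) :
    k x ≤ k x₀ + fderiv ℝ k x₀ (x - x₀) + c / 2 := by
  have hseg : ∀ t ∈ Icc (0 : ℝ) 1, x₀ + t • (x - x₀) ∈ segment ℝ x₀ x := by
    intro t ht
    rw [segment_eq_image']
    exact ⟨t, ht, rfl⟩
  have h1 : ∀ t ∈ Icc (0 : ℝ) 1, HasDerivAt (fun t : ℝ => k (x₀ + t • (x - x₀)))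
      (fderiv ℝ k (x₀ + t • (x - x₀)) (x - x₀)) t := by
    intro t ht
    exact ((hd _ (hseg t ht)).differentiableAt (by norm_num)).hasFDerivAt.comp_hasDerivAt t
      (hasDerivAt_line x₀ (x - x₀) t)
  have h2 : ∀ t ∈ Icc (0 : ℝ) 1,
      HasDerivAt (fun t : ℝ => fderiv ℝ k (x₀ + t • (x - x₀)) (x - x₀))
      (fderiv ℝ (fderiv ℝ k) (x₀ + t • (x - x₀)) (x - x₀) (x - x₀)) t := by
    intro t ht
    have hcd : ContDiffAt ℝ 1 (fderiv ℝ k) (x₀ + t • (x - x₀)) :=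
      (hd _ (hseg t ht)).fderiv_right (by norm_num)
    have := (hcd.differentiableAt (by norm_num)).hasFDerivAt.comp_hasDerivAt t
      (hasDerivAt_line x₀ (x - x₀) t)
    exact this.clm_apply (hasDerivAt_const t (x - x₀)) |>.congr_deriv (by simp)
  have := le_add_of_second_deriv_le h1 h2 (fun t ht => hc _ (hseg t ht))
  simpa using this

/-- A form that is negative on the kernel of a functional becomes negative definite after
subtracting a large multiple of the square of the functional. -/
lemma exists_neg_of_neg_on_ker {B : E →L[ℝ] E →L[ℝ] ℝ} {l : E →L[ℝ] ℝ} (hl : l ≠ 0) {κ : ℝ}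
    (hκ : 0 < κ) (h : ∀ ξ, l ξ = 0 → B ξ ξ ≤ -(κ * ‖ξ‖ ^ 2)) :
    ∃ K : ℝ, 0 < K ∧ ∀ ξ, B ξ ξ - K * (l ξ) ^ 2 ≤ -(κ / 4 * ‖ξ‖ ^ 2) := by
  obtain ⟨N₀, hN₀⟩ : ∃ N, l N ≠ 0 := by
    by_contra! hcon
    exact hl (ContinuousLinearMap.ext hcon)
  set N : E := (l N₀)⁻¹ • N₀ with hN
  have hlN : l N = 1 := by simp [hN, hN₀]
  obtain ⟨b, hb, bd⟩ : ∃ b : ℝ, 0 ≤ b ∧ ∀ x y, |B x y| ≤ b * ‖x‖ * ‖y‖ :=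
    ⟨‖B‖, norm_nonneg B, fun x y => B.le_opNorm₂ x y⟩
  set m := ‖N‖
  have hm : 0 ≤ m := norm_nonneg _
  -- With `ξ = τ + s N`, the summands of `K` pay for the cross terms (Young), for `B N N`, and for
  -- the part of `κ / 4 * ‖ξ‖²` carried by `s N`; the final `1` only ensures `K > 0`.
  refine ⟨2 * b ^ 2 * m ^ 2 / κ + b * m ^ 2 + κ / 2 * m ^ 2 + 1, by positivity, fun ξ => ?_⟩
  set s := l ξ with hs
  set τ := ξ - s • N with hτ
  have hlτ : l τ = 0 := by simp [hτ, hlN, hs]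
  have hξ : ξ = τ + s • N := by simp [hτ]
  have e1 : B ξ ξ = B τ τ + s * (B τ N + B N τ) + s ^ 2 * B N N := by
    conv_lhs => rw [hξ]
    simp only [map_add, map_smul, add_apply, smul_apply,
      smul_eq_mul]
    ring
  have e2 : ‖ξ‖ ≤ ‖τ‖ + |s| * m := by
    conv_lhs => rw [hξ]
    refine (norm_add_le _ _).trans ?_
    rw [norm_smul, Real.norm_eq_abs]
  have e3 := h τ hlτ
  have e4 : s * (B τ N + B N τ) ≤ |s| * (2 * b * ‖τ‖ * m) := by
    calc s * (B τ N + B N τ) ≤ |s * (B τ N + B N τ)| := le_abs_self _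
      _ = |s| * |B τ N + B N τ| := abs_mul _ _
      _ ≤ _ := by
        gcongr
        refine (abs_add_le _ _).trans ?_
        have := bd τ N
        have := bd N τ
        nlinarith
  have e5 : s ^ 2 * B N N ≤ s ^ 2 * (b * m * m) := by
    gcongr
    exact (le_abs_self _).trans (bd N N)
  have hs2 : s ^ 2 = |s| ^ 2 := (sq_abs s).symm
  set t := ‖τ‖
  set a := |s|
  have ha : 0 ≤ a := abs_nonneg s
  have ht : 0 ≤ t := norm_nonneg τ
  have e6 : a * (2 * b * t * m) ≤ κ / 2 * t ^ 2 + 2 * b ^ 2 * m ^ 2 / κ * a ^ 2 := by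
    have : κ / 2 * t ^ 2 + 2 * b ^ 2 * m ^ 2 / κ * a ^ 2 - a * (2 * b * t * m)
        = (κ * t - 2 * b * m * a) ^ 2 / (2 * κ) := by field_simp; ring
    have h0 : 0 ≤ (κ * t - 2 * b * m * a) ^ 2 / (2 * κ) := by positivity
    linarith
  have e7 : ‖ξ‖ ^ 2 ≤ 2 * t ^ 2 + 2 * m ^ 2 * a ^ 2 := by
    have : ‖ξ‖ ^ 2 ≤ (t + a * m) ^ 2 := by gcongr
    nlinarith [sq_nonneg (t - a * m)]
  have e8 : κ / 4 * ‖ξ‖ ^ 2 ≤ κ / 4 * (2 * t ^ 2 + 2 * m ^ 2 * a ^ 2) := by gcongr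
  rw [hs2] at e1 e5 ⊢
  nlinarith [sq_nonneg a]

end Calculus

/-! ### Global defining functions of uniformly convex domains -/

section Geometry

variable {E : Type*} [NormedAddCommGroup E] [InnerProductSpace ℝ E] [FiniteDimensional ℝ E]

lemma eq_zero_of_mem_frontier {E : Type*} [TopologicalSpace E] {Ω U : Set E} {h : E → ℝ}
    {p : E} (hΩ : IsOpen Ω) (hU : IsOpen U)
    (hp : p ∈ U) (hpΩ : p ∈ frontier Ω) (hc : ContinuousOn h U)
    (hiff : ∀ x ∈ U, x ∈ Ω ↔ 0 < h x) : h p = 0 := by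
  have hnot : p ∉ Ω := by
    rw [hΩ.frontier_eq] at hpΩ
    exact hpΩ.2
  refine le_antisymm (not_lt.1 fun hlt => hnot ((hiff p hp).2 hlt)) ?_
  by_contra! hneg
  have hev : ∀ᶠ x in 𝓝 p, h x < 0 :=
    (hc.continuousAt (hU.mem_nhds hp)).eventually_lt_const hneg
  have hcl : p ∈ closure Ω := frontier_subset_closure hpΩ
  obtain ⟨x, ⟨hx1, hx2⟩, hx3⟩ :=
    mem_closure_iff_nhds.1 hcl _ (hev.and (hU.mem_nhds hp))
  exact absurd ((hiff x hx2).1 hx3) (not_lt.2 hx1.le)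

/-- Passing from `h` to `h - (K / 2) h²` subtracts `K Dh ⊗ Dh` from the second derivative at `p`,
where `h` vanishes. The curvature bound on tangent vectors thus becomes strict concavity in all
directions, and continuity carries it to a ball. The sign is unchanged while `K h / 2 < 1`. -/
lemma exists_local_concave {Ω U : Set E} {h : E → ℝ} {p : E} {κ : ℝ} (hΩ : IsOpen Ω)
    (hU : IsOpen U) (hp : p ∈ U) (hpΩ : p ∈ frontier Ω) (hh : ContDiffOn ℝ ∞ h U)
    (hiff : ∀ x ∈ U, x ∈ Ω ↔ 0 < h x) (hne : fderiv ℝ h p ≠ 0) (hκ : 0 < κ)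
    (hcurv : ∀ ξ, fderiv ℝ h p ξ = 0 → fderiv ℝ (fderiv ℝ h) p ξ ξ ≤ -(κ * ‖ξ‖ ^ 2)) :
    ∃ r > 0, ∃ c > 0, ∃ k : E → ℝ, ContDiffOn ℝ ∞ k (Metric.ball p r) ∧
      (∀ x ∈ Metric.ball p r, x ∈ Ω ↔ 0 < k x) ∧
      ∀ z ∈ Metric.ball p r, ∀ ξ, fderiv ℝ (fderiv ℝ k) z ξ ξ ≤ -(c * ‖ξ‖ ^ 2) := by
  obtain ⟨K, hK, hneg⟩ := exists_neg_of_neg_on_ker hne hκ hcurv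
  have hp0 : h p = 0 := eq_zero_of_mem_frontier hΩ hU hp hpΩ hh.continuousOn hiff
  set k : E → ℝ := fun x => h x - K / 2 * h x ^ 2 with hk
  have hkU : ContDiffOn ℝ ∞ k U := hh.sub (contDiffOn_const.mul (hh.pow 2))
  have hdh : ∀ x ∈ U, DifferentiableAt ℝ h x := fun x hx =>
    (hh.contDiffAt (hU.mem_nhds hx)).differentiableAt (by simp)
  have hdk : ∀ x ∈ U, fderiv ℝ k x = (1 - K * h x) • fderiv ℝ h x := by
    intro x hx
    have h1 := (hdh x hx).hasFDerivAt
    have h2 := h1.sub ((h1.pow 2).const_mul (K / 2))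
    refine h2.fderiv.trans ?_
    ext y
    simp
    ring
  have hddk : fderiv ℝ (fderiv ℝ k) p
      = fderiv ℝ (fderiv ℝ h) p - K • (fderiv ℝ h p).smulRight (fderiv ℝ h p) := by
    have heq : fderiv ℝ k =ᶠ[𝓝 p] fun x => (1 - K * h x) • fderiv ℝ h x :=
      Filter.eventually_of_mem (hU.mem_nhds hp) hdk
    rw [heq.fderiv_eq]
    have hcd : ContDiffAt ℝ 1 (fderiv ℝ h) p :=
      (hh.contDiffAt (hU.mem_nhds hp)).fderiv_right (m := 1) (by norm_cast)
    have h1 := (hcd.differentiableAt (by norm_num)).hasFDerivAt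
    have h0 := (((hdh p hp).hasFDerivAt.const_mul K).const_sub 1)
    refine (h0.smul h1).fderiv.trans ?_
    ext y z
    simp [hp0]
    ring
  have hneg' : ∀ ξ, fderiv ℝ (fderiv ℝ k) p ξ ξ ≤ -(κ / 4 * ‖ξ‖ ^ 2) := by
    intro ξ
    have := hneg ξ
    rw [hddk]
    simp
    nlinarith
  have hcont : ContinuousAt (fderiv ℝ (fderiv ℝ k)) p := by
    have hcd : ContDiffAt ℝ 1 (fderiv ℝ k) p :=
      (hkU.contDiffAt (hU.mem_nhds hp)).fderiv_right (m := 1) (by norm_cast)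
    have hcd' : ContDiffAt ℝ 0 (fderiv ℝ (fderiv ℝ k)) p := hcd.fderiv_right (by norm_num)
    exact hcd'.continuousAt
  have ev1 : ∀ᶠ z in 𝓝 p, ‖fderiv ℝ (fderiv ℝ k) z - fderiv ℝ (fderiv ℝ k) p‖ < κ / 8 := by
    have hc : ContinuousAt
        (fun z => ‖fderiv ℝ (fderiv ℝ k) z - fderiv ℝ (fderiv ℝ k) p‖) p :=
      (hcont.sub continuousAt_const).norm
    exact hc.eventually_lt_const (by simp; positivity)
  have ev2 : ∀ᶠ z in 𝓝 p, K / 2 * h z < 1 := by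
    have hc : ContinuousAt (fun z => K / 2 * h z) p :=
      continuousAt_const.mul (hdh p hp).continuousAt
    exact hc.eventually_lt_const (by simp [hp0])
  obtain ⟨r, hr, hball⟩ := Metric.eventually_nhds_iff_ball.1
    ((ev1.and ev2).and (hU.mem_nhds hp))
  refine ⟨r, hr, κ / 8, by positivity, k, hkU.mono fun x hx => (hball x hx).2, ?_, ?_⟩
  · intro x hx
    have hx' := hball x hx
    rw [hiff x hx'.2]
    have hfac : k x = h x * (1 - K / 2 * h x) := by simp only [hk]; ring
    rw [hfac]
    have : 0 < 1 - K / 2 * h x := by linarith [hx'.1.2]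
    exact (mul_pos_iff_of_pos_right this).symm
  · intro z hz ξ
    have h1 := (hball z hz).1.1
    have h2 := (fderiv ℝ (fderiv ℝ k) z - fderiv ℝ (fderiv ℝ k) p).le_opNorm₂ ξ ξ
    have h3 := le_abs_self ((fderiv ℝ (fderiv ℝ k) z - fderiv ℝ (fderiv ℝ k) p) ξ ξ)
    have h4 := hneg' ξ
    rw [Real.norm_eq_abs] at h2
    simp only [sub_apply] at h2 h3
    have h5 : ‖fderiv ℝ (fderiv ℝ k) z - fderiv ℝ (fderiv ℝ k) p‖ * ‖ξ‖ * ‖ξ‖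
        ≤ κ / 8 * ‖ξ‖ * ‖ξ‖ := by gcongr
    nlinarith

/-- A smooth function vanishing on the boundary of `Ω`, positive only inside `Ω`, whose gradient
at a boundary point is a quantitatively strict inner support direction. -/
structure IsDefiningFunction (Ω : Set E) (f : E → ℝ) (ε : ℝ) : Prop where
  contDiff : ContDiff ℝ ∞ f
  pos : 0 < ε
  eq_zero : ∀ x ∈ frontier Ω, f x = 0
  mem_of_pos : ∀ x, 0 < f x → x ∈ Ω
  support : ∀ x₀ ∈ frontier Ω, ∀ x ∈ closure Ω, ε * ‖x - x₀‖ ^ 2 ≤ fderiv ℝ f x₀ (x - x₀)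

/-- A strictly concave `k` that vanishes at `x₀` and is nonnegative on `closure Ω` satisfies the
support inequality by Taylor expansion. A cutoff `χ` makes it global: on `∂Ω` the derivative of `χ
k` is `χ Dk`, because `k = 0` there. -/
lemma exists_local_definingFunction {Ω : Set E} {p : E} {r c : ℝ} {k : E → ℝ} (hΩ : IsOpen Ω)
    (hconv : Convex ℝ Ω) (hbdd : Bornology.IsBounded Ω) (hr : 0 < r) (hc : 0 < c)
    (hk : ContDiffOn ℝ ∞ k (Metric.ball p r)) (hiff : ∀ x ∈ Metric.ball p r, x ∈ Ω ↔ 0 < k x)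
    (hneg : ∀ z ∈ Metric.ball p r, ∀ ξ, fderiv ℝ (fderiv ℝ k) z ξ ξ ≤ -(c * ‖ξ‖ ^ 2)) :
    ∃ f : E → ℝ, ∃ ε > 0, ContDiff ℝ ∞ f ∧ (∀ x ∈ frontier Ω, f x = 0) ∧
      (∀ x, 0 < f x → x ∈ Ω) ∧
      (∀ x₀ ∈ frontier Ω, ∀ x ∈ closure Ω, 0 ≤ fderiv ℝ f x₀ (x - x₀)) ∧
      ∀ x₀ ∈ frontier Ω ∩ Metric.ball p (r / 4), ∀ x ∈ closure Ω,
        ε * ‖x - x₀‖ ^ 2 ≤ fderiv ℝ f x₀ (x - x₀) := by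
  obtain ⟨D, hD0, hD⟩ : ∃ D : ℝ, 0 ≤ D ∧ ∀ x ∈ closure Ω, ∀ y ∈ closure Ω, ‖x - y‖ ≤ D :=
    ⟨Metric.diam (closure Ω), Metric.diam_nonneg, fun x hx y hy => by
      rw [← dist_eq_norm]
      exact Metric.dist_le_diam_of_mem hbdd.closure hx hy⟩
  have hkat : ∀ x ∈ Metric.ball p r, ContDiffAt ℝ ∞ k x := fun x hx =>
    hk.contDiffAt (Metric.isOpen_ball.mem_nhds hx)
  have hk0 : ∀ x ∈ frontier Ω, x ∈ Metric.ball p r → k x = 0 := fun x hx hxb =>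
    eq_zero_of_mem_frontier hΩ Metric.isOpen_ball hxb hx hk.continuousOn hiff
  have hknn : ∀ x ∈ closure Ω, x ∈ Metric.ball p r → 0 ≤ k x := by
    intro x hx hxb
    rcases (closure_eq_self_union_frontier Ω ▸ hx : x ∈ Ω ∪ frontier Ω) with h | h
    · exact ((hiff x hxb).1 h).le
    · exact (hk0 x h hxb).ge
  -- Concavity is known only in the ball, so `x` is pulled back to `x₀ + t (x - x₀)`; after division
  -- by `t` the support constant is `c / 2 * t`.
  set t : ℝ := r / (2 * (D + 1) + r) with ht
  have ht0 : 0 < t := by positivity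
  have ht1 : t ≤ 1 := by
    rw [ht, div_le_one (by positivity)]
    linarith
  have htD : t * D < r / 2 := by
    rw [ht, div_mul_eq_mul_div, div_lt_iff₀ (by positivity)]
    nlinarith
  have hsupp : ∀ x₀ ∈ frontier Ω, x₀ ∈ Metric.closedBall p (r / 2) → ∀ x ∈ closure Ω,
      c / 2 * t * ‖x - x₀‖ ^ 2 ≤ fderiv ℝ k x₀ (x - x₀) := by
    intro x₀ hx₀ hx₀b x hx
    have hx₀r : x₀ ∈ Metric.ball p r := Metric.closedBall_subset_ball (by linarith) hx₀b
    set x' := x₀ + t • (x - x₀) with hx'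
    have hx'Ω : x' ∈ closure Ω :=
      hconv.closure.add_smul_sub_mem (frontier_subset_closure hx₀) hx ⟨ht0.le, ht1⟩
    have hsub : x' - x₀ = t • (x - x₀) := by simp [hx']
    have hx'b : x' ∈ Metric.ball p r := by
      rw [Metric.mem_ball, dist_eq_norm]
      rw [Metric.mem_closedBall, dist_eq_norm] at hx₀b
      have e1 : x' - p = (x₀ - p) + t • (x - x₀) := by rw [hx']; abel
      have e2 : ‖t • (x - x₀)‖ ≤ t * D := by
        rw [norm_smul, Real.norm_eq_abs, abs_of_pos ht0]
        gcongr
        exact hD x hx x₀ (frontier_subset_closure hx₀)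
      rw [e1]
      have := norm_add_le (x₀ - p) (t • (x - x₀))
      linarith
    have hseg : segment ℝ x₀ x' ⊆ Metric.ball p r :=
      (convex_ball p r).segment_subset hx₀r hx'b
    have := le_add_of_fderiv_fderiv_le (k := k) (x₀ := x₀) (x := x')
      (fun z hz => (hkat z (hseg hz)).of_le (by norm_cast)) (fun z hz => hneg z (hseg hz) _)
    rw [hk0 x₀ hx₀ hx₀r, hsub, map_smul, norm_smul, Real.norm_eq_abs, abs_of_pos ht0,
      smul_eq_mul] at this
    have h0 := hknn x' hx'Ω hx'b
    have : t * (c / 2 * t * ‖x - x₀‖ ^ 2) ≤ t * fderiv ℝ k x₀ (x - x₀) := by nlinarith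
    exact le_of_mul_le_mul_left this ht0
  let χ : ContDiffBump p := ⟨r / 4, r / 2, by positivity, by linarith⟩
  have hχout : ∀ x, x ∉ Metric.closedBall p (r / 2) →
      (fun x => χ x * k x) =ᶠ[𝓝 x] fun _ => 0 := by
    intro x hx
    have : x ∉ tsupport χ := by rwa [χ.tsupport_eq]
    filter_upwards [notMem_tsupport_iff_eventuallyEq.1 this] with y hy
    simp [hy]
  have hfd : ∀ x₀ ∈ frontier Ω, x₀ ∈ Metric.closedBall p (r / 2) →
      fderiv ℝ (fun x => χ x * k x) x₀ = χ x₀ • fderiv ℝ k x₀ := by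
    intro x₀ hx₀ hx₀b
    have hx₀r : x₀ ∈ Metric.ball p r := Metric.closedBall_subset_ball (by linarith) hx₀b
    have h1 : HasFDerivAt χ (fderiv ℝ χ x₀) x₀ :=
      ((χ.contDiff (n := 1)).differentiable (by norm_num) x₀).hasFDerivAt
    have h2 := ((hkat x₀ hx₀r).differentiableAt (by simp)).hasFDerivAt
    refine (h1.mul h2).fderiv.trans ?_
    simp [hk0 x₀ hx₀ hx₀r]
  refine ⟨fun x => χ x * k x, c / 2 * t, by positivity, ?_, ?_, ?_, ?_, ?_⟩
  · rw [contDiff_iff_contDiffAt]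
    intro x
    by_cases hx : x ∈ Metric.closedBall p (r / 2)
    · exact χ.contDiff.contDiffAt.mul
        (hkat x (Metric.closedBall_subset_ball (by linarith) hx))
    · exact contDiffAt_const.congr_of_eventuallyEq (hχout x hx)
  · intro x hx
    by_cases hxb : x ∈ Metric.closedBall p (r / 2)
    · simp [hk0 x hx (Metric.closedBall_subset_ball (by linarith) hxb)]
    · exact (hχout x hxb).eq_of_nhds
  · intro x hx
    by_cases hxb : x ∈ Metric.closedBall p (r / 2)
    · exact (hiff x (Metric.closedBall_subset_ball (by linarith) hxb)).2
        (pos_of_mul_pos_right hx χ.nonneg)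
    · exact absurd (hχout x hxb).eq_of_nhds hx.ne'
  · intro x₀ hx₀ x hx
    by_cases hxb : x₀ ∈ Metric.closedBall p (r / 2)
    · rw [hfd x₀ hx₀ hxb, smul_apply, smul_eq_mul]
      exact mul_nonneg χ.nonneg ((by positivity : (0 : ℝ) ≤ c / 2 * t * ‖x - x₀‖ ^ 2).trans
        (hsupp x₀ hx₀ hxb x hx))
    · rw [(hχout x₀ hxb).fderiv_eq]
      simp
  · rintro x₀ ⟨hx₀, hxb⟩ x hx
    have hxb' : x₀ ∈ Metric.closedBall p (r / 2) :=
      Metric.ball_subset_closedBall (Metric.ball_subset_ball (by linarith) hxb)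
    have h1 : χ x₀ = 1 := χ.one_of_mem_closedBall (Metric.ball_subset_closedBall hxb)
    rw [hfd x₀ hx₀ hxb', h1, one_smul]
    exact hsupp x₀ hx₀ hxb' x hx

end Geometry

/-- Local functions for a finite cover of the compact boundary can simply be added: at each boundary
point all support derivatives are nonnegative and at least one is quantitatively positive. -/
theorem IsSmoothUniformlyConvexDomain.exists_isDefiningFunction {n : ℕ}
    {Ω : Set (EuclideanSpace ℝ (Fin n))} (hΩ : IsSmoothUniformlyConvexDomain Ω) :
    ∃ f ε, IsDefiningFunction Ω f ε := by
  obtain ⟨κ, hκ, hloc⟩ := hΩ.boundary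
  have hlocal : ∀ p : frontier Ω, ∃ r > 0, ∃ f : EuclideanSpace ℝ (Fin n) → ℝ, ∃ ε > 0,
      ContDiff ℝ ∞ f ∧ (∀ x ∈ frontier Ω, f x = 0) ∧ (∀ x, 0 < f x → x ∈ Ω) ∧
      (∀ x₀ ∈ frontier Ω, ∀ x ∈ closure Ω, 0 ≤ fderiv ℝ f x₀ (x - x₀)) ∧
      ∀ x₀ ∈ frontier Ω ∩ Metric.ball p.1 r, ∀ x ∈ closure Ω,
        ε * ‖x - x₀‖ ^ 2 ≤ fderiv ℝ f x₀ (x - x₀) := by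
    rintro ⟨p, hp⟩
    obtain ⟨U, h, hU, hpU, hh, hiff, hne, hcurv⟩ := hloc p hp
    obtain ⟨r, hr, c, hc, k, hk, hkiff, hneg⟩ := exists_local_concave hΩ.isOpen hU hpU hp hh hiff
      hne (mul_pos hκ (norm_pos_iff.2 hne)) hcurv
    obtain ⟨f, ε, hε, hf⟩ := exists_local_definingFunction hΩ.isOpen hΩ.convex hΩ.isBounded hr hc
      hk hkiff hneg
    exact ⟨r / 4, by positivity, f, ε, hε, hf⟩
  choose r hr f ε hε hf h0 hpos hnn hsupp using hlocal
  have hcomp : IsCompact (frontier Ω) :=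
    Metric.isCompact_of_isClosed_isBounded isClosed_frontier
      (hΩ.isBounded.closure.subset frontier_subset_closure)
  obtain ⟨s, hs⟩ := hcomp.elim_finite_subcover (fun p : frontier Ω => Metric.ball p.1 (r p))
    (fun p => Metric.isOpen_ball)
    (fun x hx => mem_iUnion.2 ⟨⟨x, hx⟩, Metric.mem_ball_self (hr _)⟩)
  obtain ⟨δ, hδ, hδε⟩ : ∃ δ > 0, ∀ p ∈ s, δ ≤ ε p := by
    rcases s.eq_empty_or_nonempty with rfl | hne
    · exact ⟨1, one_pos, by simp⟩
    · exact ⟨s.inf' hne ε, (Finset.lt_inf'_iff hne).2 fun p _ => hε p,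
        fun p hp => Finset.inf'_le _ hp⟩
  have hfd : ∀ x y, fderiv ℝ (fun x => ∑ p ∈ s, f p x) x y = ∑ p ∈ s, fderiv ℝ (f p) x y := by
    intro x y
    rw [fderiv_fun_sum fun p _ => ((hf p).differentiable (by simp)).differentiableAt]
    simp
  refine ⟨fun x => ∑ p ∈ s, f p x, δ, ContDiff.sum fun p _ => hf p, hδ, ?_, ?_, ?_⟩
  · intro x hx
    exact Finset.sum_eq_zero fun p _ => h0 p x hx
  · intro x hx
    obtain ⟨p, -, hp⟩ : ∃ p ∈ s, 0 < f p x := by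
      by_contra! hcon
      exact absurd (Finset.sum_nonpos hcon) (not_le.2 hx)
    exact hpos p x hp
  · intro x₀ hx₀ x hx
    rw [hfd]
    obtain ⟨p, hp, hpx⟩ := mem_iUnion₂.1 (hs hx₀)
    calc δ * ‖x - x₀‖ ^ 2 ≤ ε p * ‖x - x₀‖ ^ 2 := by gcongr; exact hδε p hp
      _ ≤ fderiv ℝ (f p) x₀ (x - x₀) := hsupp p x₀ ⟨hx₀, hpx⟩ x hx
      _ ≤ _ := Finset.single_le_sum (f := fun p => fderiv ℝ (f p) x₀ (x - x₀))
        (fun q _ => hnn q x₀ hx₀ x hx) hp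

/-! ### Second derivative test and nonnegative operators -/

section SecondDerivativeTest

/-- Otherwise `f'` is negative just to the right of `0`, and `f` strictly decreases there. -/
lemma nonneg_of_hasDerivAt_of_isLocalMin {f f' : ℝ → ℝ} {f'' : ℝ}
    (h1 : ∀ᶠ t in 𝓝 (0 : ℝ), HasDerivAt f (f' t) t) (h2 : HasDerivAt f' f'' 0)
    (hmin : IsLocalMin f 0) : 0 ≤ f'' := by
  by_contra! hneg
  have h0 : f' 0 = 0 := hmin.hasDerivAt_eq_zero h1.self_of_nhds
  have hslope := hasDerivAt_iff_tendsto_slope.1 h2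
  have ev1 : ∀ᶠ t in 𝓝[≠] (0 : ℝ), slope f' 0 t < 0 := hslope.eventually_lt_const hneg
  rw [eventually_nhdsWithin_iff] at ev1
  obtain ⟨δ, hδ, hball⟩ := Metric.eventually_nhds_iff_ball.1 ((ev1.and h1).and hmin)
  have hmem : ∀ t ∈ Icc 0 (δ / 2), t ∈ Metric.ball (0 : ℝ) δ := by
    intro t ht
    rw [Metric.mem_ball, dist_zero_right, Real.norm_eq_abs, abs_of_nonneg ht.1]
    linarith [ht.2]
  have hanti : StrictAntiOn f (Icc 0 (δ / 2)) := by
    refine strictAntiOn_of_hasDerivWithinAt_neg (convex_Icc _ _) (f' := f')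
      (fun t ht => (hball t (hmem t ht)).1.2.continuousAt.continuousWithinAt)
      (fun t ht => (hball t (hmem t (interior_subset ht))).1.2.hasDerivWithinAt) ?_
    intro t ht
    have ht0 : 0 < t := by
      rw [interior_Icc] at ht
      exact ht.1
    have := (hball t (hmem t (interior_subset ht))).1.1 ht0.ne'
    rw [slope_def_field, h0, sub_zero, sub_zero] at this
    by_contra! hcon
    exact absurd this (not_lt.2 (div_nonneg hcon ht0.le))
  have hlt := hanti (left_mem_Icc.2 (by positivity)) (right_mem_Icc.2 (by positivity))
    (by positivity : (0 : ℝ) < δ / 2)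
  exact absurd (hball _ (hmem (δ / 2) (right_mem_Icc.2 (by positivity)))).2 (not_le.2 hlt)

end SecondDerivativeTest

section PositiveSemidefinite

variable {E : Type*} [NormedAddCommGroup E] [InnerProductSpace ℝ E]

/-- Symmetric positive semidefinite operators. -/
structure IsSymmNonneg (M : E →L[ℝ] E) : Prop where
  symm : ∀ a b, ⟪M a, b⟫ = ⟪a, M b⟫
  nonneg : ∀ a, 0 ≤ ⟪M a, a⟫

namespace IsSymmNonneg

variable {M : E →L[ℝ] E}

/-- Cauchy–Schwarz for the form of `M`: the quadratic polynomial `t ↦ ⟪M (t x + y), t x + y⟫` is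
nonnegative, so its discriminant is not positive. -/
lemma inner_sq_le (h : IsSymmNonneg M) (x y : E) : ⟪M x, y⟫ ^ 2 ≤ ⟪M x, x⟫ * ⟪M y, y⟫ := by
  have hq : ∀ t : ℝ, 0 ≤ ⟪M x, x⟫ * (t * t) + 2 * ⟪M x, y⟫ * t + ⟪M y, y⟫ := by
    intro t
    have := h.nonneg (t • x + y)
    have hs : ⟪M y, x⟫ = ⟪M x, y⟫ := by rw [h.symm, real_inner_comm]
    simp only [map_add, map_smul, inner_add_left, inner_add_right, inner_smul_left,
      inner_smul_right, hs] at this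
    simp at this
    nlinarith
  have := discrim_le_zero hq
  rw [discrim] at this
  nlinarith

lemma apply_eq_zero (h : IsSymmNonneg M) {x : E} (hx : ⟪M x, x⟫ = 0) : M x = 0 := by
  have := h.inner_sq_le x (M x)
  rw [hx, zero_mul] at this
  have h0 : ⟪M x, M x⟫ = 0 := by nlinarith [sq_nonneg ⟪M x, M x⟫]
  exact inner_self_eq_zero.1 h0

/-- Cauchy–Schwarz with `y = M x`. It is the source of both the obliqueness bound and the smallness
of `W ξ` in nearly degenerate directions. -/
lemma norm_sq_le (h : IsSymmNonneg M) {R : ℝ} (hR : ∀ z, ‖M z‖ ≤ R * ‖z‖) (x : E) :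
    ‖M x‖ ^ 2 ≤ R * ⟪M x, x⟫ := by
  have h1 := h.inner_sq_le x (M x)
  have h2 : ⟪M (M x), M x⟫ ≤ R * ‖M x‖ ^ 2 := by
    have := real_inner_le_norm (M (M x)) (M x)
    have := hR (M x)
    nlinarith [norm_nonneg (M x)]
  rw [real_inner_self_eq_norm_sq] at h1
  rcases (norm_nonneg (M x)).eq_or_lt with h0 | h0
  · have hz : M x = 0 := norm_eq_zero.1 h0.symm
    simp [hz]
  · have h3 : ⟪M x, x⟫ * ⟪M (M x), M x⟫ ≤ ⟪M x, x⟫ * (R * ‖M x‖ ^ 2) :=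
      mul_le_mul_of_nonneg_left h2 (h.nonneg x)
    have h4 : ‖M x‖ ^ 2 * ‖M x‖ ^ 2 ≤ (R * ⟪M x, x⟫) * ‖M x‖ ^ 2 := by nlinarith
    exact le_of_mul_le_mul_right h4 (by positivity)

lemma norm_apply_le {ι : Type*} [Fintype ι] (e : OrthonormalBasis ι ℝ E) (h : IsSymmNonneg M)
    (x : E) : ‖M x‖ ≤ (∑ j, ⟪M (e j), e j⟫) * ‖x‖ := by
  have h1 : ‖M x‖ ^ 2 ≤ (∑ j, ⟪M (e j), e j⟫) * ⟪M x, x⟫ := by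
    rw [← e.sum_sq_norm_inner_left (M x), Finset.sum_mul]
    refine Finset.sum_le_sum fun j _ => ?_
    rw [Real.norm_eq_abs, sq_abs]
    exact (h.inner_sq_le x (e j)).trans_eq (mul_comm _ _)
  have h2 := real_inner_le_norm (M x) x
  have h3 : 0 ≤ ∑ j, ⟪M (e j), e j⟫ := Finset.sum_nonneg fun j _ => h.nonneg _
  rcases (norm_nonneg (M x)).eq_or_lt with h0 | h0
  · rw [← h0]
    positivity
  · have h4 : ‖M x‖ * ‖M x‖ ≤ ((∑ j, ⟪M (e j), e j⟫) * ‖x‖) * ‖M x‖ := by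
      have := mul_le_mul_of_nonneg_left h2 h3
      nlinarith
    exact le_of_mul_le_mul_right h4 h0

end IsSymmNonneg

end PositiveSemidefinite

/-! ### The coefficients of the mean curvature operator -/

section Operator

variable {E : Type*} [NormedAddCommGroup E] [InnerProductSpace ℝ E]
variable {ι : Type*} [Fintype ι]

/-- The factor `1 / √(1 - |p|²)`. -/
noncomputable def lorentzFactor (p : E) : ℝ := (Real.sqrt (1 - ‖p‖ ^ 2))⁻¹

/-- The quadratic form `Q ↦ ⟪Q p, p⟫`. -/
noncomputable def quadForm (p : E) : (E →L[ℝ] E) →L[ℝ] ℝ :=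
  (innerSL ℝ p).comp (ContinuousLinearMap.apply ℝ E p)

/-- The coefficients `aᵢⱼ(p)` of the mean curvature operator, as a functional on Hessians. -/
noncomputable def lorentzTrace (e : OrthonormalBasis ι ℝ E) (p : E) : (E →L[ℝ] E) →L[ℝ] ℝ :=
  lorentzFactor p • ∑ i, quadForm (e i) + lorentzFactor p ^ 3 • quadForm p

/-- Vectors that diagonalize the coefficients `aᵢⱼ(p)`. -/
noncomputable def lorentzFrame (e : OrthonormalBasis ι ℝ E) (p : E) : Option ι → E
  | none => Real.sqrt (lorentzFactor p ^ 3) • p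
  | some i => Real.sqrt (lorentzFactor p) • e i

lemma quadForm_apply (p : E) (Q : E →L[ℝ] E) : quadForm p Q = ⟪Q p, p⟫ := by
  simp [quadForm, real_inner_comm]

lemma quadForm_smul (a : ℝ) (p : E) (Q : E →L[ℝ] E) :
    quadForm (a • p) Q = a ^ 2 * quadForm p Q := by
  simp [quadForm_apply, inner_smul_left, inner_smul_right]
  ring

lemma lorentzFactor_nonneg (p : E) : 0 ≤ lorentzFactor p := by
  unfold lorentzFactor
  positivity

lemma one_le_lorentzFactor {p : E} (hp : ‖p‖ < 1) : 1 ≤ lorentzFactor p := by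
  unfold lorentzFactor
  have h : 0 < 1 - ‖p‖ ^ 2 := by nlinarith [norm_nonneg p]
  refine (one_le_inv₀ (Real.sqrt_pos.2 h)).2 ?_
  exact Real.sqrt_le_iff.2 ⟨zero_le_one, by nlinarith [sq_nonneg ‖p‖]⟩

/-- Extremum conditions hold one direction at a time; in this form they can be summed over the frame
and compared with the equation. -/
lemma lorentzTrace_apply (e : OrthonormalBasis ι ℝ E) (p : E) (Q : E →L[ℝ] E) :
    lorentzTrace e p Q = ∑ i, ⟪Q (lorentzFrame e p i), lorentzFrame e p i⟫ := by
  simp only [← quadForm_apply]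
  rw [Fintype.sum_option]
  simp only [lorentzFrame, quadForm_smul, Real.sq_sqrt (lorentzFactor_nonneg p),
    Real.sq_sqrt (pow_nonneg (lorentzFactor_nonneg p) 3), lorentzTrace]
  simp [Finset.mul_sum]
  ring

lemma contDiffOn_lorentzFactor : ContDiffOn ℝ ∞ (lorentzFactor (E := E)) (Metric.ball 0 1) := by
  have hne : ∀ p ∈ Metric.ball (0 : E) 1, 0 < 1 - ‖p‖ ^ 2 := by
    intro p hp
    rw [mem_ball_zero_iff] at hp
    nlinarith [norm_nonneg p]
  have h1 : ContDiff ℝ ∞ fun p : E => 1 - ‖p‖ ^ 2 := contDiff_const.sub (contDiff_norm_sq ℝ)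
  exact (h1.contDiffOn.sqrt fun p hp => (hne p hp).ne').inv
    fun p hp => (Real.sqrt_pos.2 (hne p hp)).ne'

lemma contDiff_quadForm : ContDiff ℝ ∞ (quadForm (E := E)) := by
  unfold quadForm
  exact (innerSL ℝ (E := E)).contDiff.clm_comp
    (ContinuousLinearMap.apply ℝ E (E := E)).contDiff

lemma contDiffOn_lorentzTrace (e : OrthonormalBasis ι ℝ E) :
    ContDiffOn ℝ ∞ (lorentzTrace e) (Metric.ball 0 1) := by
  unfold lorentzTrace
  exact (contDiffOn_lorentzFactor.smul contDiffOn_const).add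
    ((contDiffOn_lorentzFactor.pow 3).smul contDiff_quadForm.contDiffOn)

lemma hasFDerivAt_lorentzFactor {p : E} (hp : ‖p‖ < 1) :
    HasFDerivAt (lorentzFactor (E := E)) (lorentzFactor p ^ 3 • innerSL ℝ p) p := by
  have h : 0 < 1 - ‖p‖ ^ 2 := by nlinarith [norm_nonneg p]
  have h1 : HasFDerivAt (fun p : E => 1 - ‖p‖ ^ 2) (-(2 • innerSL ℝ p)) p :=
    ((hasStrictFDerivAt_norm_sq p).hasFDerivAt).const_sub 1
  have h2 := (hasDerivAt_inv (Real.sqrt_pos.2 h).ne').comp_hasFDerivAt p (h1.sqrt h.ne')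
  refine h2.congr_fderiv ?_
  have hs : Real.sqrt (1 - ‖p‖ ^ 2) ≠ 0 := (Real.sqrt_pos.2 h).ne'
  ext y
  simp [lorentzFactor]
  field_simp

end Operator

/-! ### Differentiated equation, upper Hessian bound, upper bound for `c` -/

section Jets

variable {E : Type*} [NormedAddCommGroup E] [InnerProductSpace ℝ E] [FiniteDimensional ℝ E]
variable {ι : Type*} [Fintype ι]

/-- Bounds for the coefficients of the mean curvature operator and their derivatives on `K`. -/
structure EllipticBounds (e : OrthonormalBasis ι ℝ E) (K : Set E) (R : ℝ) : Prop where
  one_le : 1 ≤ R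
  norm_lt : ∀ p ∈ K, ‖p‖ < 1
  bound' : ∀ p ∈ K, ‖fderiv ℝ (lorentzTrace e) p‖ ≤ R
  bound'' : ∀ p ∈ K, ‖fderiv ℝ (fderiv ℝ (lorentzTrace e)) p‖ ≤ R
  frame : ∀ p ∈ K, ∀ i, ‖lorentzFrame e p i‖ ≤ R

lemma IsCompact.exists_norm_le {F X : Type*} [TopologicalSpace X] [NormedAddCommGroup F]
    {K : Set X} (hK : IsCompact K) {f : X → F} (hf : ContinuousOn f K) (R₀ : ℝ) :
    ∃ R, R₀ ≤ R ∧ ∀ p ∈ K, ‖f p‖ ≤ R := by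
  obtain ⟨C, hC⟩ := hK.exists_bound_of_continuousOn hf
  exact ⟨max R₀ C, le_max_left _ _, fun p hp => (hC p hp).trans (le_max_right _ _)⟩

lemma contDiffAt_lorentzTrace (e : OrthonormalBasis ι ℝ E) {p : E} (hp : ‖p‖ < 1) :
    ContDiffAt ℝ ∞ (lorentzTrace e) p :=
  (contDiffOn_lorentzTrace e).contDiffAt (Metric.isOpen_ball.mem_nhds (by simpa using hp))

lemma contDiffAt_fderiv_lorentzTrace (e : OrthonormalBasis ι ℝ E) {p : E} (hp : ‖p‖ < 1) :
    ContDiffAt ℝ ∞ (fderiv ℝ (lorentzTrace e)) p :=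
  (contDiffAt_lorentzTrace e hp).fderiv_right (by norm_cast)

lemma hasFDerivAt_lorentzTrace (e : OrthonormalBasis ι ℝ E) {p : E} (hp : ‖p‖ < 1) :
    HasFDerivAt (lorentzTrace e) (fderiv ℝ (lorentzTrace e) p) p :=
  ((contDiffAt_lorentzTrace e hp).differentiableAt (by simp)).hasFDerivAt

lemma hasFDerivAt_fderiv_lorentzTrace (e : OrthonormalBasis ι ℝ E) {p : E} (hp : ‖p‖ < 1) :
    HasFDerivAt (fderiv ℝ (lorentzTrace e)) (fderiv ℝ (fderiv ℝ (lorentzTrace e)) p) p :=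
  ((contDiffAt_fderiv_lorentzTrace e hp).differentiableAt (by simp)).hasFDerivAt

/-- The coefficients are smooth on the open unit ball, so compactness of `K` inside it is enough.
This is where `closure Ω' ⊆ B₁(0)` enters. -/
lemma exists_ellipticBounds (e : OrthonormalBasis ι ℝ E) {K : Set E} (hK : IsCompact K)
    (hKb : K ⊆ Metric.ball 0 1) : ∃ R, EllipticBounds e K R := by
  have hlt : ∀ p ∈ K, ‖p‖ < 1 := fun p hp => by simpa using hKb hp
  obtain ⟨R₂, h2, hR₂⟩ := hK.exists_norm_le (f := fderiv ℝ (lorentzTrace e))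
    (fun p hp => (contDiffAt_fderiv_lorentzTrace e (hlt p hp)).continuousAt.continuousWithinAt) 1
  obtain ⟨R₃, h3, hR₃⟩ := hK.exists_norm_le (f := fderiv ℝ (fderiv ℝ (lorentzTrace e)))
    (fun p hp => ((contDiffAt_fderiv_lorentzTrace e (hlt p hp)).fderiv_right (m := 0)
      (by norm_cast)).continuousAt.continuousWithinAt) R₂
  have hw : ContinuousOn (lorentzFactor (E := E)) K :=
    contDiffOn_lorentzFactor.continuousOn.mono hKb
  have hframe : ContinuousOn (fun p i => lorentzFrame e p i) K := by
    refine continuousOn_pi.2 fun i => ?_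
    cases i with
    | none => exact (hw.pow 3).sqrt.smul continuousOn_id
    | some i => exact hw.sqrt.smul continuousOn_const
  obtain ⟨R₄, h4, hR₄⟩ := hK.exists_norm_le hframe R₃
  exact ⟨R₄, by linarith, hlt,
    fun p hp => (hR₂ p hp).trans (by linarith), fun p hp => (hR₃ p hp).trans (by linarith),
    fun p hp i => (norm_le_pi_norm _ i).trans (hR₄ p hp)⟩

namespace EllipticBounds

variable {e : OrthonormalBasis ι ℝ E} {K : Set E} {R : ℝ} {p : E}

lemma pos (h : EllipticBounds e K R) : 0 < R := one_pos.trans_le h.one_le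

lemma abs_le' (h : EllipticBounds e K R) (hp : p ∈ K) (y : E) (Q : E →L[ℝ] E) :
    |fderiv ℝ (lorentzTrace e) p y Q| ≤ R * ‖y‖ * ‖Q‖ :=
  (fderiv ℝ (lorentzTrace e) p y).le_of_opNorm_le
    ((fderiv ℝ (lorentzTrace e) p).le_of_opNorm_le (h.bound' p hp) y) Q

lemma abs_le'' (h : EllipticBounds e K R) (hp : p ∈ K) (y z : E) (Q : E →L[ℝ] E) :
    |fderiv ℝ (fderiv ℝ (lorentzTrace e)) p y z Q| ≤ R * ‖y‖ * ‖z‖ * ‖Q‖ :=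
  (fderiv ℝ (fderiv ℝ (lorentzTrace e)) p y z).le_of_opNorm_le
    ((fderiv ℝ (fderiv ℝ (lorentzTrace e)) p y).le_of_opNorm_le
      ((fderiv ℝ (fderiv ℝ (lorentzTrace e)) p).le_of_opNorm_le (h.bound'' p hp) y) z) Q

lemma sum_frame_le (h : EllipticBounds e K R) (hp : p ∈ K) :
    ∑ i, ‖lorentzFrame e p i‖ ^ 2 ≤ Fintype.card (Option ι) * R ^ 2 := by
  calc ∑ i, ‖lorentzFrame e p i‖ ^ 2 ≤ ∑ _i : Option ι, R ^ 2 :=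
        Finset.sum_le_sum fun i _ => pow_le_pow_left₀ (norm_nonneg _) (h.frame p hp i) 2
    _ = _ := by simp

end EllipticBounds

/-- For a family of quantities quadratic along the frame, the sum over the frame dominates the sum
over the orthonormal basis. -/
lemma sum_basis_le_sum_frame (e : OrthonormalBasis ι ℝ E) {p : E} (hp : ‖p‖ < 1) {q : E → ℝ}
    (hq : ∀ v, 0 ≤ q v) (hsmul : ∀ (a : ℝ) v, q (a • v) = a ^ 2 * q v) :
    ∑ i, q (e i) ≤ ∑ i, q (lorentzFrame e p i) := by
  rw [Fintype.sum_option]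
  have h1 : ∀ i, q (e i) ≤ q (lorentzFrame e p (some i)) := by
    intro i
    rw [lorentzFrame, hsmul, Real.sq_sqrt (lorentzFactor_nonneg p)]
    nlinarith [hq (e i), one_le_lorentzFactor hp]
  linarith [hq (lorentzFrame e p none), Finset.sum_le_sum fun i (_ : i ∈ Finset.univ) => h1 i]

/-- `P = Du`, `W = D²u`, `T = D³u`, `S = D⁴u` for a convex solution `u` of the mean curvature
equation with gradient image `Ω'`; `P`, `W` and `T` are given up to the boundary. -/
structure IsSolutionJet (e : OrthonormalBasis ι ℝ E) (Ω Ω' : Set E) (u : E → ℝ) (P : E → E)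
    (W : E → E →L[ℝ] E) (T : E → E →L[ℝ] E →L[ℝ] E) (S : E → E →L[ℝ] E →L[ℝ] E →L[ℝ] E)
    (c : ℝ) : Prop where
  hasFDerivAt_u : ∀ x ∈ Ω, HasFDerivAt u (innerSL ℝ (P x)) x
  hasFDerivWithinAt_P : ∀ x ∈ closure Ω, HasFDerivWithinAt P (W x) (closure Ω) x
  hasFDerivWithinAt_W : ∀ x ∈ closure Ω, HasFDerivWithinAt W (T x) (closure Ω) x
  hasFDerivAt_T : ∀ x ∈ Ω, HasFDerivAt T (S x) x
  isSymmNonneg : ∀ x ∈ closure Ω, IsSymmNonneg (W x)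
  T_comm : ∀ x ∈ closure Ω, ∀ a b, T x a b = T x b a
  T_symm : ∀ x ∈ closure Ω, ∀ a b c, ⟪T x a b, c⟫ = ⟪T x a c, b⟫
  S_swap : ∀ x ∈ Ω, ∀ a b, ⟪S x a a b, b⟫ = ⟪S x b b a, a⟫
  mapsTo : ∀ x ∈ Ω, P x ∈ Ω'
  surj : ∀ p ∈ Ω', ∃ x ∈ Ω, P x = p
  mapsTo_frontier : ∀ x ∈ frontier Ω, P x ∈ frontier Ω'
  equation : ∀ x ∈ Ω, lorentzTrace e (P x) (W x) = c

namespace IsSolutionJet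

variable {e : OrthonormalBasis ι ℝ E} {Ω Ω' : Set E} {u : E → ℝ} {P : E → E}
  {W : E → E →L[ℝ] E} {T : E → E →L[ℝ] E →L[ℝ] E} {S : E → E →L[ℝ] E →L[ℝ] E →L[ℝ] E}
  {c R : ℝ} {x : E}

lemma mapsTo_closure (J : IsSolutionJet e Ω Ω' u P W T S c) (hx : x ∈ closure Ω) :
    P x ∈ closure Ω' := by
  rcases (closure_eq_self_union_frontier Ω ▸ hx : x ∈ Ω ∪ frontier Ω) with h | h
  · exact subset_closure (J.mapsTo x h)
  · exact frontier_subset_closure (J.mapsTo_frontier x h)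

lemma closure_mem_nhds (hΩ : IsOpen Ω) (hx : x ∈ Ω) : closure Ω ∈ 𝓝 x :=
  mem_of_superset (hΩ.mem_nhds hx) subset_closure

lemma hasFDerivAt_P (J : IsSolutionJet e Ω Ω' u P W T S c) (hΩ : IsOpen Ω) (hx : x ∈ Ω) :
    HasFDerivAt P (W x) x :=
  (J.hasFDerivWithinAt_P x (subset_closure hx)).hasFDerivAt (closure_mem_nhds hΩ hx)

lemma hasFDerivAt_W (J : IsSolutionJet e Ω Ω' u P W T S c) (hΩ : IsOpen Ω) (hx : x ∈ Ω) :
    HasFDerivAt W (T x) x :=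
  (J.hasFDerivWithinAt_W x (subset_closure hx)).hasFDerivAt (closure_mem_nhds hΩ hx)

lemma line_mem (hΩ : IsOpen Ω) (hx : x ∈ Ω) (v : E) : ∀ᶠ t : ℝ in 𝓝 0, x + t • v ∈ Ω := by
  have hc : Continuous fun t : ℝ => x + t • v := by fun_prop
  exact hc.continuousAt.eventually_mem (hΩ.mem_nhds (by simpa using hx))

lemma hasDerivAt_P (J : IsSolutionJet e Ω Ω' u P W T S c) (hΩ : IsOpen Ω) {v : E} {t : ℝ}
    (hx : x + t • v ∈ Ω) : HasDerivAt (fun t : ℝ => P (x + t • v)) (W (x + t • v) v) t :=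
  (J.hasFDerivAt_P hΩ hx).comp_hasDerivAt t (hasDerivAt_line x v t)

lemma hasDerivAt_W (J : IsSolutionJet e Ω Ω' u P W T S c) (hΩ : IsOpen Ω) {v : E} {t : ℝ}
    (hx : x + t • v ∈ Ω) : HasDerivAt (fun t : ℝ => W (x + t • v)) (T (x + t • v) v) t :=
  (J.hasFDerivAt_W hΩ hx).comp_hasDerivAt t (hasDerivAt_line x v t)

lemma hasDerivAt_T (J : IsSolutionJet e Ω Ω' u P W T S c) {v : E} {t : ℝ}
    (hx : x + t • v ∈ Ω) : HasDerivAt (fun t : ℝ => T (x + t • v)) (S (x + t • v) v) t :=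
  (J.hasFDerivAt_T _ hx).comp_hasDerivAt t (hasDerivAt_line x v t)

/-- The equation differentiated once. -/
lemma equation_deriv (J : IsSolutionJet e Ω Ω' u P W T S c) (hE : EllipticBounds e (closure Ω') R)
    (hΩ : IsOpen Ω) (hx : x ∈ Ω) (v : E) :
    fderiv ℝ (lorentzTrace e) (P x) (W x v) (W x) + lorentzTrace e (P x) (T x v) = 0 := by
  have hx0 : x + (0 : ℝ) • v ∈ Ω := by simpa using hx
  have hlt := hE.norm_lt _ (subset_closure (J.mapsTo _ hx0))
  have hA := (hasFDerivAt_lorentzTrace e hlt).comp_hasDerivAt (0 : ℝ) (J.hasDerivAt_P hΩ hx0)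
  have h2 := hA.clm_apply (J.hasDerivAt_W hΩ hx0)
  have h3 : (fun t : ℝ => lorentzTrace e (P (x + t • v)) (W (x + t • v))) =ᶠ[𝓝 0] fun _ => c := by
    filter_upwards [line_mem hΩ hx v] with t ht
    exact J.equation _ ht
  have := h2.unique ((hasDerivAt_const (0 : ℝ) c).congr_of_eventuallyEq h3)
  simpa using this

/-- The equation differentiated twice in the same direction. -/
lemma equation_deriv_deriv (J : IsSolutionJet e Ω Ω' u P W T S c)
    (hE : EllipticBounds e (closure Ω') R) (hΩ : IsOpen Ω) (hx : x ∈ Ω) (v : E) :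
    fderiv ℝ (fderiv ℝ (lorentzTrace e)) (P x) (W x v) (W x v) (W x)
      + fderiv ℝ (lorentzTrace e) (P x) (T x v v) (W x)
      + 2 * fderiv ℝ (lorentzTrace e) (P x) (W x v) (T x v)
      + lorentzTrace e (P x) (S x v v) = 0 := by
  have hx0 : x + (0 : ℝ) • v ∈ Ω := by simpa using hx
  have hlt := hE.norm_lt _ (subset_closure (J.mapsTo _ hx0))
  have hP := J.hasDerivAt_P hΩ hx0
  have hW := J.hasDerivAt_W hΩ hx0
  have hT := J.hasDerivAt_T hx0
  have hA := (hasFDerivAt_lorentzTrace e hlt).comp_hasDerivAt (0 : ℝ) hP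
  have hA' := (hasFDerivAt_fderiv_lorentzTrace e hlt).comp_hasDerivAt (0 : ℝ) hP
  have hWv := hW.clm_apply (hasDerivAt_const (0 : ℝ) v)
  have hTv := hT.clm_apply (hasDerivAt_const (0 : ℝ) v)
  have h2 := ((hA'.clm_apply hWv).clm_apply hW).add (hA.clm_apply hTv)
  have h3 : (fun t : ℝ => fderiv ℝ (lorentzTrace e) (P (x + t • v)) (W (x + t • v) v) (W (x + t • v))
      + lorentzTrace e (P (x + t • v)) (T (x + t • v) v)) =ᶠ[𝓝 0] fun _ => 0 := by
    filter_upwards [line_mem hΩ hx v] with t ht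
    exact J.equation_deriv hE hΩ ht v
  have := h2.unique ((hasDerivAt_const (0 : ℝ) (0 : ℝ)).congr_of_eventuallyEq h3)
  simp at this
  linarith

lemma trace_le (J : IsSolutionJet e Ω Ω' u P W T S c) (hE : EllipticBounds e (closure Ω') R)
    (hx : x ∈ Ω) : ∑ j, ⟪W x (e j), e j⟫ ≤ c := by
  rw [← J.equation x hx, lorentzTrace_apply]
  refine sum_basis_le_sum_frame e (hE.norm_lt _ (subset_closure (J.mapsTo x hx)))
    (q := fun v => ⟪W x v, v⟫) (J.isSymmNonneg x (subset_closure hx)).nonneg fun a v => ?_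
  simp [inner_smul_left, inner_smul_right]
  ring

lemma continuousOn_W (J : IsSolutionJet e Ω Ω' u P W T S c) : ContinuousOn W (closure Ω) :=
  fun x hx => (J.hasFDerivWithinAt_W x hx).continuousWithinAt

lemma continuousOn_P (J : IsSolutionJet e Ω Ω' u P W T S c) : ContinuousOn P (closure Ω) :=
  fun x hx => (J.hasFDerivWithinAt_P x hx).continuousWithinAt

/-- A nonnegative operator is bounded by its trace, hence by `c` in `Ω`; continuity gives the same
bound on the boundary. -/
lemma norm_W_le (J : IsSolutionJet e Ω Ω' u P W T S c) (hE : EllipticBounds e (closure Ω') R)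
    (hx : x ∈ closure Ω) (v : E) : ‖W x v‖ ≤ c * ‖v‖ := by
  have hmem : ∀ y ∈ Ω, ‖W y v‖ ≤ c * ‖v‖ := fun y hy =>
    ((J.isSymmNonneg y (subset_closure hy)).norm_apply_le e v).trans
      (mul_le_mul_of_nonneg_right (J.trace_le hE hy) (norm_nonneg v))
  have hc : ContinuousOn (fun y => ‖W y v‖) (closure Ω) :=
    (J.continuousOn_W.clm_apply continuousOn_const).norm
  have : ContinuousWithinAt (fun y => ‖W y v‖) Ω x := (hc x hx).mono subset_closure
  exact this.closure_le hx continuousWithinAt_const hmem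

lemma hasDerivAt_u (J : IsSolutionJet e Ω Ω' u P W T S c) {v : E} {t : ℝ}
    (hx : x + t • v ∈ Ω) : HasDerivAt (fun t : ℝ => u (x + t • v)) ⟪P (x + t • v), v⟫ t :=
  ((J.hasFDerivAt_u _ hx).comp_hasDerivAt t (hasDerivAt_line x v t)).congr_deriv
    (innerSL_apply_apply ℝ _ _)

/-- At an interior maximum of `u - (2 / r) ‖x - x₀‖²` over the ball, `W ≤ 4 / r`, and the equation
at that point bounds `c`. The maximum is not on the sphere: from the centre to the sphere `u` grows
by at most `r`, the paraboloid by `2 r`. -/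
lemma le_of_closedBall_subset (J : IsSolutionJet e Ω Ω' u P W T S c)
    (hE : EllipticBounds e (closure Ω') R) (hΩ : IsOpen Ω) {x₀ : E} {r : ℝ} (hr : 0 < r)
    (hball : Metric.closedBall x₀ r ⊆ Ω) :
    c ≤ 4 / r * (Fintype.card (Option ι) * R ^ 2) := by
  have hx₀ : x₀ ∈ Metric.closedBall x₀ r := Metric.mem_closedBall_self hr.le
  set g : E → ℝ := fun x => u x - 2 / r * ‖x - x₀‖ ^ 2 with hg
  have hucont : ContinuousOn u (Metric.closedBall x₀ r) := fun x hx =>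
    (J.hasFDerivAt_u x (hball hx)).continuousAt.continuousWithinAt
  have hgc : ContinuousOn g (Metric.closedBall x₀ r) :=
    hucont.sub (by fun_prop)
  obtain ⟨x₁, hx₁, hmax⟩ := (isCompact_closedBall x₀ r).exists_isMaxOn ⟨x₀, hx₀⟩ hgc
  have hlip : ‖u x₁ - u x₀‖ ≤ 1 * ‖x₁ - x₀‖ := by
    refine (convex_closedBall x₀ r).norm_image_sub_le_of_norm_hasFDerivWithin_le
      (fun x hx => (J.hasFDerivAt_u x (hball hx)).hasFDerivWithinAt) (fun x hx => ?_) hx₀ hx₁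
    rw [innerSL_apply_norm]
    exact (hE.norm_lt _ (subset_closure (J.mapsTo x (hball hx)))).le
  have hlt : ‖x₁ - x₀‖ < r := by
    have h1 : g x₀ ≤ g x₁ := hmax hx₀
    simp only [hg, sub_self, norm_zero] at h1
    rw [Real.norm_eq_abs, one_mul] at hlip
    have h2 := (le_abs_self _).trans hlip
    have h3 : ‖x₁ - x₀‖ ≤ r := by rwa [← dist_eq_norm]
    refine lt_of_le_of_ne h3 fun heq => ?_
    rw [heq] at h1 h2
    have : 2 / r * r ^ 2 = 2 * r := by field_simp
    linarith
  have hx₁Ω := hball hx₁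
  have hloc : IsLocalMax g x₁ := hmax.isLocalMax
    (mem_of_superset (Metric.isOpen_ball.mem_nhds (by rwa [Metric.mem_ball, dist_eq_norm]))
      Metric.ball_subset_closedBall)
  have hW : ∀ v, ⟪W x₁ v, v⟫ ≤ 4 / r * ‖v‖ ^ 2 := by
    intro v
    have hx10 : x₁ + (0 : ℝ) • v ∈ Ω := by simpa using hx₁Ω
    have hnorm : ∀ t : ℝ, HasDerivAt (fun t : ℝ => ‖x₁ + t • v - x₀‖ ^ 2)
        (2 * ⟪x₁ + t • v - x₀, v⟫) t := fun t => ((hasDerivAt_line x₁ v t).sub_const x₀).norm_sq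
    have h1 : ∀ᶠ t : ℝ in 𝓝 0, HasDerivAt (fun t : ℝ => -g (x₁ + t • v))
        (-(⟪P (x₁ + t • v), v⟫ - 2 / r * (2 * ⟪x₁ + t • v - x₀, v⟫))) t := by
      filter_upwards [line_mem hΩ hx₁Ω v] with t ht
      exact ((J.hasDerivAt_u ht).sub ((hnorm t).const_mul (2 / r))).neg
    have h2 : HasDerivAt (fun t : ℝ =>
        -(⟪P (x₁ + t • v), v⟫ - 2 / r * (2 * ⟪x₁ + t • v - x₀, v⟫)))
        (-(⟪W x₁ v, v⟫ - 2 / r * (2 * ⟪v, v⟫))) 0 := by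
      have ha := (J.hasDerivAt_P hΩ hx10).inner ℝ (hasDerivAt_const (0 : ℝ) v)
      have hb := ((hasDerivAt_line x₁ v 0).sub_const x₀).inner ℝ (hasDerivAt_const (0 : ℝ) v)
      refine (ha.sub ((hb.const_mul 2).const_mul (2 / r))).neg.congr_deriv ?_
      simp
    have h3 : IsLocalMin (fun t : ℝ => -g (x₁ + t • v)) 0 := by
      have hc : ContinuousAt (fun t : ℝ => x₁ + t • v) 0 := (hasDerivAt_line x₁ v 0).continuousAt
      have hloc' : IsLocalMin (fun x => -g x) (x₁ + (0 : ℝ) • v) := by simpa using hloc.neg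
      exact hc.tendsto.eventually hloc'
    have := nonneg_of_hasDerivAt_of_isLocalMin h1 h2 h3
    rw [real_inner_self_eq_norm_sq] at this
    have h4 : 2 / r * (2 * ‖v‖ ^ 2) = 4 / r * ‖v‖ ^ 2 := by ring
    linarith
  rw [← J.equation x₁ hx₁Ω, lorentzTrace_apply]
  calc _ ≤ ∑ i, 4 / r * ‖lorentzFrame e (P x₁) i‖ ^ 2 := Finset.sum_le_sum fun i _ => hW _
    _ ≤ _ := by
      rw [← Finset.mul_sum]
      exact mul_le_mul_of_nonneg_left (hE.sum_frame_le (subset_closure (J.mapsTo _ hx₁Ω)))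
        (by positivity)

lemma norm_sub_le (J : IsSolutionJet e Ω Ω' u P W T S c) (hE : EllipticBounds e (closure Ω') R)
    (hconv : Convex ℝ Ω) {y : E} (hx : x ∈ closure Ω) (hy : y ∈ closure Ω) (hc : 0 ≤ c) :
    ‖P y - P x‖ ≤ c * ‖y - x‖ :=
  hconv.closure.norm_image_sub_le_of_norm_hasFDerivWithin_le
    J.hasFDerivWithinAt_P
    (fun _ hz => ContinuousLinearMap.opNorm_le_bound _ hc (J.norm_W_le hE hz)) hx hy

end IsSolutionJet

end Jets

/-! ### Bounds for `c`, Hopf lemma and uniform obliqueness -/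

section Boundary

variable {E : Type*} [NormedAddCommGroup E] [InnerProductSpace ℝ E] [FiniteDimensional ℝ E]

lemma inner_gradient_eq (f : E → ℝ) (x v : E) : ⟪∇ f x, v⟫ = fderiv ℝ f x v := by
  rw [gradient, InnerProductSpace.toDual_symm_apply]

/-- A vector in the dual cone of a half space is a nonnegative multiple of the normal. -/
lemma exists_eq_smul_of_inner_nonneg {y N : E} (hN : N ≠ 0)
    (h : ∀ v, 0 < ⟪N, v⟫ → 0 ≤ ⟪y, v⟫) : ∃ t : ℝ, 0 ≤ t ∧ y = t • N := by
  have hN2 : 0 < ⟪N, N⟫ := real_inner_self_pos.2 hN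
  -- The closed half space is reached by adding a suitable positive multiple of `N` to `v`.
  have h' : ∀ v, 0 ≤ ⟪N, v⟫ → 0 ≤ ⟪y, v⟫ := by
    intro v hv
    by_contra! hneg
    by_cases hyN : ⟪y, N⟫ ≤ 0
    · have := h (v + N) (by rw [inner_add_right]; linarith)
      rw [inner_add_right] at this
      linarith
    · rw [not_le] at hyN
      set s := -⟪y, v⟫ / (2 * ⟪y, N⟫) with hs
      have hs0 : 0 < s := div_pos (by linarith) (by linarith)
      have := h (v + s • N) (by rw [inner_add_right, inner_smul_right]; nlinarith)
      rw [inner_add_right, inner_smul_right, hs] at this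
      have e : -⟪y, v⟫ / (2 * ⟪y, N⟫) * ⟪y, N⟫ = -⟪y, v⟫ / 2 := by field_simp
      linarith
  set t := ⟪y, N⟫ / ⟪N, N⟫ with ht
  have h0 : ⟪N, y - t • N⟫ = 0 := by
    rw [inner_sub_right, inner_smul_right, ht, real_inner_comm]
    field_simp
    ring
  refine ⟨t, div_nonneg (h N hN2) hN2.le, ?_⟩
  have h1 := h' (-(y - t • N)) (by rw [inner_neg_right, h0, neg_zero])
  have h2 : ⟪y, y - t • N⟫ = ⟪y - t • N, y - t • N⟫ := by
    rw [inner_sub_left (y) (t • N), inner_smul_left, h0]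
    simp
  rw [inner_neg_right, h2] at h1
  have h3 : ⟪y - t • N, y - t • N⟫ = 0 := le_antisymm (by linarith) real_inner_self_nonneg
  exact sub_eq_zero.1 (inner_self_eq_zero.1 h3)

namespace IsDefiningFunction

variable {Ω : Set E} {f : E → ℝ} {ε : ℝ}

lemma hasFDerivAt (hf : IsDefiningFunction Ω f ε) (x : E) : HasFDerivAt f (fderiv ℝ f x) x :=
  (hf.contDiff.differentiable (by simp) x).hasFDerivAt

lemma contDiff_fderiv (hf : IsDefiningFunction Ω f ε) : ContDiff ℝ ∞ (fderiv ℝ f) :=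
  hf.contDiff.fderiv_right (by norm_cast)

lemma contDiff_gradient (hf : IsDefiningFunction Ω f ε) : ContDiff ℝ ∞ (∇ f) :=
  (InnerProductSpace.toDual ℝ E).symm.contDiff.comp hf.contDiff_fderiv

lemma hasFDerivAt_fderiv (hf : IsDefiningFunction Ω f ε) (x : E) :
    HasFDerivAt (fderiv ℝ f) (fderiv ℝ (fderiv ℝ f) x) x :=
  (hf.contDiff_fderiv.differentiable (by simp) x).hasFDerivAt

lemma hasDerivAt_line (hf : IsDefiningFunction Ω f ε) (x v : E) (t : ℝ) :
    HasDerivAt (fun t : ℝ => f (x + t • v)) (fderiv ℝ f (x + t • v) v) t :=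
  (hf.hasFDerivAt (x + t • v)).comp_hasDerivAt t (_root_.hasDerivAt_line x v t)

lemma hasDerivAt_fderiv_line (hf : IsDefiningFunction Ω f ε) (x v : E) (t : ℝ) :
    HasDerivAt (fun t : ℝ => fderiv ℝ f (x + t • v) v)
      (fderiv ℝ (fderiv ℝ f) (x + t • v) v v) t := by
  have := (hf.hasFDerivAt_fderiv (x + t • v)).comp_hasDerivAt t (_root_.hasDerivAt_line x v t)
  exact (this.clm_apply (hasDerivAt_const t v)).congr_deriv (by simp)

lemma support_inner (hf : IsDefiningFunction Ω f ε) {x₀ x : E} (hx₀ : x₀ ∈ frontier Ω)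
    (hx : x ∈ closure Ω) : ε * ‖x - x₀‖ ^ 2 ≤ ⟪∇ f x₀, x - x₀⟫ := by
  rw [inner_gradient_eq]
  exact hf.support x₀ hx₀ x hx

lemma eventually_mem (hf : IsDefiningFunction Ω f ε) {x₀ v : E} (hx₀ : x₀ ∈ frontier Ω)
    (hv : 0 < ⟪∇ f x₀, v⟫) : ∀ᶠ t : ℝ in 𝓝[>] 0, x₀ + t • v ∈ Ω := by
  rw [inner_gradient_eq] at hv
  have hd : HasDerivAt (fun t : ℝ => f (x₀ + t • v)) (fderiv ℝ f x₀ v) 0 := by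
    simpa using hf.hasDerivAt_line x₀ v 0
  have hs := (hasDerivAt_iff_tendsto_slope.1 hd).mono_left (nhdsGT_le_nhdsNE 0)
  filter_upwards [hs.eventually_const_lt hv, self_mem_nhdsWithin] with t ht ht0
  rw [slope_def_field] at ht
  simp only [zero_smul, add_zero, sub_zero, hf.eq_zero x₀ hx₀] at ht
  exact hf.mem_of_pos _ ((div_pos_iff_of_pos_right ht0).1 ht)

lemma mem_posTangentConeAt (hf : IsDefiningFunction Ω f ε) {x₀ v : E} (hx₀ : x₀ ∈ frontier Ω)
    (hv : 0 < ⟪∇ f x₀, v⟫) : v ∈ posTangentConeAt (closure Ω) x₀ :=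
  mem_posTangentConeAt_of_frequently_mem
    ((hf.eventually_mem hx₀ hv).mono fun _ h => subset_closure h).frequently

/-- The support inequality is tested at the centre of a ball of radius `ρ` in `Ω`, which is at
distance at least `ρ` from every boundary point. -/
lemma exists_le_norm_gradient (hf : IsDefiningFunction Ω f ε) (hΩ : IsOpen Ω)
    (hne : Ω.Nonempty) : ∃ m > 0, ∀ x ∈ frontier Ω, m ≤ ‖∇ f x‖ := by
  obtain ⟨z, hz⟩ := hne
  obtain ⟨ρ, hρ, hball⟩ := Metric.isOpen_iff.1 hΩ z hz
  refine ⟨ε * ρ, mul_pos hf.pos hρ, fun x hx => ?_⟩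
  have hd : ρ ≤ ‖z - x‖ := by
    by_contra! hlt
    have : x ∈ Ω := hball (by rwa [Metric.mem_ball, dist_comm, dist_eq_norm])
    rw [hΩ.frontier_eq] at hx
    exact hx.2 this
  have h1 := hf.support_inner hx (subset_closure hz)
  have h2 := real_inner_le_norm (∇ f x) (z - x)
  have h3 : (ε * ‖z - x‖) * ‖z - x‖ ≤ ‖∇ f x‖ * ‖z - x‖ := by nlinarith
  have h4 := le_of_mul_le_mul_right h3 (hρ.trans_le hd)
  exact (mul_le_mul_of_nonneg_left hd hf.pos.le).trans h4

end IsDefiningFunction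

variable {ι : Type*} [Fintype ι]

namespace IsSolutionJet

variable {e : OrthonormalBasis ι ℝ E} {Ω Ω' : Set E}

/-- The constant mean curvature is bounded above and away from zero. -/
lemma exists_bounds_const [Nontrivial E] {R : ℝ} (hE : EllipticBounds e (closure Ω') R)
    (hΩ : IsOpen Ω) (hconv : Convex ℝ Ω) (hbdd : Bornology.IsBounded Ω) (hne : Ω.Nonempty)
    (hΩ' : IsOpen Ω') (hne' : Ω'.Nonempty) :
    ∃ C, 1 ≤ C ∧ ∀ {u P W T S c}, IsSolutionJet e Ω Ω' u P W T S c → 1 / C ≤ c ∧ c ≤ C := by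
  obtain ⟨x₀, hx₀⟩ := hne
  obtain ⟨r, hr, hball⟩ := Metric.isOpen_iff.1 hΩ x₀ hx₀
  have hball' : Metric.closedBall x₀ (r / 2) ⊆ Ω :=
    (Metric.closedBall_subset_ball (by linarith)).trans hball
  obtain ⟨p, hp, q, hq, hpq⟩ : Ω'.Nontrivial := by
    obtain ⟨p, hp⟩ := hne'
    exact infinite_of_mem_nhds p (hΩ'.mem_nhds hp) |>.nontrivial
  have hpq' : 0 < ‖p - q‖ := norm_pos_iff.2 (sub_ne_zero.2 hpq)
  set D := Metric.diam (closure Ω) + 1 with hD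
  have hD0 : 0 < D := by
    have := Metric.diam_nonneg (s := closure Ω)
    linarith
  set C₁ := 4 / (r / 2) * (Fintype.card (Option ι) * R ^ 2)
  refine ⟨max 1 (max C₁ (D / ‖p - q‖)), le_max_left _ _, fun {u P W T S c} J => ⟨?_, ?_⟩⟩
  · have hc : 0 ≤ c := (Finset.sum_nonneg fun j _ =>
      (J.isSymmNonneg x₀ (subset_closure hx₀)).nonneg (e j)).trans (J.trace_le hE hx₀)
    obtain ⟨x, hx, rfl⟩ := J.surj p hp
    obtain ⟨y, hy, rfl⟩ := J.surj q hq
    -- The gradient map is `c`-Lipschitz and attains two fixed values of `Ω'` at points at most `D`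
    -- apart.
    have h1 := J.norm_sub_le hE hconv (subset_closure hy) (subset_closure hx) hc
    have h2 : ‖x - y‖ ≤ D := by
      rw [← dist_eq_norm]
      exact (Metric.dist_le_diam_of_mem hbdd.closure (subset_closure hx)
        (subset_closure hy)).trans (by linarith)
    have h3 : ‖P x - P y‖ / D ≤ c := by
      rw [div_le_iff₀ hD0]
      exact h1.trans (mul_le_mul_of_nonneg_left h2 hc)
    refine le_trans ?_ h3
    rw [← one_div_div D]
    exact one_div_le_one_div_of_le (by positivity)
      ((le_max_right _ _).trans (le_max_right _ _))
  · exact (J.le_of_closedBall_subset hE hΩ (by positivity) hball').trans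
      ((le_max_left _ _).trans (le_max_right _ _))

/-- By the equation `c` is a sum of terms `⟪W vᵢ, vᵢ⟫` with `‖vᵢ‖ ≤ R`, and Cauchy–Schwarz applies.
This is the strictly signed term in the Hopf lemma. -/
lemma sum_norm_sq_ge {u P W T S c R} (J : IsSolutionJet e Ω Ω' u P W T S c)
    (hE : EllipticBounds e (closure Ω') R) {x : E} (hx : x ∈ Ω) (hc : 0 ≤ c) :
    c ^ 2 / (R ^ 2 * Fintype.card (Option ι)) ≤ ∑ i, ‖W x (lorentzFrame e (P x) i)‖ ^ 2 := by
  have hR := hE.pos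
  have h1 : c ≤ R * ∑ i, ‖W x (lorentzFrame e (P x) i)‖ := by
    rw [← J.equation x hx, lorentzTrace_apply, Finset.mul_sum]
    refine Finset.sum_le_sum fun i _ => (real_inner_le_norm _ _).trans ?_
    rw [mul_comm R]
    exact mul_le_mul_of_nonneg_left (hE.frame _ (subset_closure (J.mapsTo x hx)) i) (norm_nonneg _)
  have h2 : (∑ i, ‖W x (lorentzFrame e (P x) i)‖) ^ 2
      ≤ Fintype.card (Option ι) * ∑ i, ‖W x (lorentzFrame e (P x) i)‖ ^ 2 :=
    sq_sum_le_card_mul_sum_sq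
  rw [div_le_iff₀ (by positivity)]
  calc c ^ 2 ≤ (R * ∑ i, ‖W x (lorentzFrame e (P x) i)‖) ^ 2 := by gcongr
    _ = R ^ 2 * (∑ i, ‖W x (lorentzFrame e (P x) i)‖) ^ 2 := mul_pow _ _ _
    _ ≤ R ^ 2 * (Fintype.card (Option ι) * ∑ i, ‖W x (lorentzFrame e (P x) i)‖ ^ 2) := by gcongr
    _ = _ := by ring

/-- First and second order conditions at an interior minimum of a function
`⟪b, Du - p⟫ - ε' |Du - p|² - δ f`. -/
lemma support_derivatives {u P W T S c} (J : IsSolutionJet e Ω Ω' u P W T S c) (hΩ : IsOpen Ω)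
    {f : E → ℝ} {ε ε' δ : ℝ} (hf : IsDefiningFunction Ω f ε) {b p x : E} (hx : x ∈ Ω)
    (hloc : IsLocalMin (fun x => ⟪b, P x - p⟫ - ε' * ‖P x - p‖ ^ 2 - δ * f x) x) :
    W x (b - (2 * ε') • (P x - p)) = δ • ∇ f x ∧
    ∀ v, 0 ≤ ⟪T x (b - (2 * ε') • (P x - p)) v, v⟫ - 2 * ε' * ‖W x v‖ ^ 2
      - δ * fderiv ℝ (fderiv ℝ f) x v v := by
  have hxc := subset_closure hx
  have hderiv : ∀ (v : E) (t : ℝ), x + t • v ∈ Ω →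
      HasDerivAt (fun t : ℝ =>
        ⟪b, P (x + t • v) - p⟫ - ε' * ‖P (x + t • v) - p‖ ^ 2 - δ * f (x + t • v))
      (⟪b, W (x + t • v) v⟫ - ε' * (2 * ⟪P (x + t • v) - p, W (x + t • v) v⟫)
        - δ * fderiv ℝ f (x + t • v) v) t := by
    intro v t ht
    have h1 := (J.hasDerivAt_P hΩ ht).sub_const p
    have h2 := hf.hasDerivAt_line x v t
    have h3 := (((hasDerivAt_const t b).inner ℝ h1).sub (h1.norm_sq.const_mul ε')).sub
      (h2.const_mul δ)
    refine h3.congr_deriv ?_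
    rw [inner_zero_left, add_zero]
  have hmem0 : ∀ v : E, x + (0 : ℝ) • v ∈ Ω := fun v => by simpa using hx
  have hloc' : ∀ v : E, IsLocalMin (fun t : ℝ =>
      ⟪b, P (x + t • v) - p⟫ - ε' * ‖P (x + t • v) - p‖ ^ 2 - δ * f (x + t • v)) 0 := by
    intro v
    have h0 : x + (0 : ℝ) • v = x := by simp
    rw [← h0] at hloc
    exact (hasDerivAt_line x v 0).continuousAt.tendsto.eventually hloc
  constructor
  · refine ext_inner_right ℝ fun v => ?_
    have h0 := (hloc' v).hasDerivAt_eq_zero (hderiv v 0 (hmem0 v))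
    rw [(J.isSymmNonneg x hxc).symm, inner_sub_left, inner_smul_left, inner_smul_left,
      inner_gradient_eq]
    rw [zero_smul, add_zero] at h0
    simp only [conj_trivial]
    linarith
  · intro v
    have h1 := (J.hasDerivAt_P hΩ (hmem0 v)).sub_const p
    have hWv := (J.hasDerivAt_W hΩ (hmem0 v)).clm_apply (hasDerivAt_const (0 : ℝ) v)
    have h2 := hf.hasDerivAt_fderiv_line x v 0
    have h3 : HasDerivAt (fun t : ℝ => ⟪b, W (x + t • v) v⟫
        - ε' * (2 * ⟪P (x + t • v) - p, W (x + t • v) v⟫) - δ * fderiv ℝ f (x + t • v) v) _ 0 :=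
      (((hasDerivAt_const (0 : ℝ) b).inner ℝ hWv).sub
        (((h1.inner ℝ hWv).const_mul 2).const_mul ε')).sub (h2.const_mul δ)
    have hev : ∀ᶠ t : ℝ in 𝓝 0, HasDerivAt (fun t : ℝ =>
        ⟪b, P (x + t • v) - p⟫ - ε' * ‖P (x + t • v) - p‖ ^ 2 - δ * f (x + t • v))
        (⟪b, W (x + t • v) v⟫ - ε' * (2 * ⟪P (x + t • v) - p, W (x + t • v) v⟫)
          - δ * fderiv ℝ f (x + t • v) v) t := (line_mem hΩ hx v).mono fun t ht => hderiv v t ht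
    have h4 := nonneg_of_hasDerivAt_of_isLocalMin hev h3 (hloc' v)
    have hsym : ∀ ζ, ⟪T x ζ v, v⟫ = ⟪ζ, T x v v⟫ := by
      intro ζ
      rw [J.T_comm x hxc, J.T_symm x hxc, real_inner_comm]
    rw [hsym, inner_sub_left, inner_smul_left]
    simp only [zero_smul, add_zero, map_zero, inner_zero_left, real_inner_self_eq_norm_sq] at h4
    simp only [conj_trivial]
    linarith

/-- The Hopf lemma for the support functions of the gradient image, with a uniform constant. -/
lemma exists_hopf {f : E → ℝ} {ε : ℝ} {f' : E → ℝ} {ε' : ℝ} {R C : ℝ}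
    (hE : EllipticBounds e (closure Ω') R) (hf : IsDefiningFunction Ω f ε)
    (hf' : IsDefiningFunction Ω' f' ε') (hΩ : IsOpen Ω) (hbdd : Bornology.IsBounded Ω)
    (hne : Ω.Nonempty) (hC : 1 ≤ C) :
    ∃ δ : ℝ, 0 < δ ∧ ∀ {u P W T S c}, IsSolutionJet e Ω Ω' u P W T S c → 1 / C ≤ c → c ≤ C →
      ∀ x₀ ∈ frontier Ω, ∃ k : ℝ, δ ≤ k ∧ W x₀ (∇ f' (P x₀)) = k • ∇ f x₀ := by
  have hcomp : IsCompact (closure Ω) :=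
    Metric.isCompact_of_isClosed_isBounded isClosed_closure hbdd.closure
  obtain ⟨F₁, hF₁, hF₁'⟩ := hcomp.exists_norm_le hf.contDiff_gradient.continuous.continuousOn 0
  obtain ⟨F₂, hF₂, hF₂'⟩ := hcomp.exists_norm_le
    (hf.contDiff_fderiv.fderiv_right (m := 0) (by norm_cast)).continuous.continuousOn F₁
  have hR := hE.pos
  set d : ℝ := ((Fintype.card (Option ι) : ℕ) : ℝ) with hd
  have hd0 : 0 < d := by simp only [hd]; positivity
  set c₀ := 2 * ε' * ((1 / C) ^ 2 / (R ^ 2 * d)) with hc₀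
  have hε' := hf'.pos
  have hc₀pos : 0 < c₀ := by positivity
  have hF₂0 : 0 ≤ F₂ := hF₁.trans hF₂
  set B := R * F₁ * C + F₂ * (d * R ^ 2) with hB
  have hB0 : 0 ≤ B := by positivity
  obtain ⟨m, hm, hmN⟩ := hf.exists_le_norm_gradient hΩ hne
  -- `c₀` bounds the strictly signed term from below, and `δ B` bounds all other terms at an
  -- interior minimum of the barrier; `δ B < c₀` rules such a minimum out.
  set δ := c₀ / (B + 1) / 2 with hδ
  have hδ0 : 0 < δ := by positivity
  have hδB : δ * B < c₀ := by
    rw [hδ, div_div, div_mul_eq_mul_div, div_lt_iff₀ (by positivity)]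
    nlinarith
  refine ⟨δ, hδ0, fun {u P W T S c} J hc₁ hc₂ x₀ hx₀ => ?_⟩
  have hcpos : 0 < c := lt_of_lt_of_le (by positivity) hc₁
  set b := ∇ f' (P x₀) with hb
  -- Barrier: on `∂Ω` the term `δ f` vanishes, and `H ≥ 0` is the support inequality of `Ω'` at `P
  -- x₀`.
  set H : E → ℝ := fun x => ⟪b, P x - P x₀⟫ - ε' * ‖P x - P x₀‖ ^ 2 - δ * f x with hH
  have hp₀ := J.mapsTo_frontier x₀ hx₀
  have hHcont : ContinuousOn H (closure Ω) := by
    have := J.continuousOn_P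
    have := hf.contDiff.continuous
    fun_prop
  have hx₀c : x₀ ∈ closure Ω := frontier_subset_closure hx₀
  have hHnn : ∀ x ∈ closure Ω, 0 ≤ H x := by
    obtain ⟨x₁, hx₁, hmin⟩ := hcomp.exists_isMinOn ⟨x₀, hx₀c⟩ hHcont
    suffices 0 ≤ H x₁ from fun x hx => this.trans (hmin hx)
    rcases (closure_eq_self_union_frontier Ω ▸ hx₁ : x₁ ∈ Ω ∪ frontier Ω) with hxΩ | hxf
    swap
    · have := hf'.support_inner hp₀ (J.mapsTo_closure hx₁)
      simp only [hH, hf.eq_zero x₁ hxf]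
      linarith
    exfalso
    have hPx := subset_closure (J.mapsTo x₁ hxΩ)
    have hloc : IsLocalMin H x₁ := hmin.isLocalMin (closure_mem_nhds hΩ hxΩ)
    obtain ⟨hgrad, hsecond⟩ := J.support_derivatives hΩ hf hxΩ hloc
    set ζ := b - (2 * ε') • (P x₁ - P x₀) with hζ
    -- Over the frame, the third order terms sum to the trace of `T ζ`, which the differentiated
    -- equation expresses through `W ζ`. Since `W ζ = δ ∇ f x₁`, that contribution is of order `δ`.
    have hsum : 0 ≤ ∑ i, (⟪T x₁ ζ (lorentzFrame e (P x₁) i), lorentzFrame e (P x₁) i⟫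
        - 2 * ε' * ‖W x₁ (lorentzFrame e (P x₁) i)‖ ^ 2
        - δ * fderiv ℝ (fderiv ℝ f) x₁ (lorentzFrame e (P x₁) i) (lorentzFrame e (P x₁) i)) :=
      Finset.sum_nonneg fun i _ => hsecond _
    rw [Finset.sum_sub_distrib, Finset.sum_sub_distrib, ← Finset.mul_sum, ← Finset.mul_sum,
      ← lorentzTrace_apply] at hsum
    have h1 := J.equation_deriv hE hΩ hxΩ ζ
    have h2 := J.sum_norm_sq_ge hE hxΩ hcpos.le
    have h3 : |fderiv ℝ (lorentzTrace e) (P x₁) (W x₁ ζ) (W x₁)| ≤ δ * (R * F₁ * C) := by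
      refine (hE.abs_le' hPx _ _).trans ?_
      rw [hgrad, norm_smul, Real.norm_eq_abs, abs_of_pos hδ0]
      have hWn : ‖W x₁‖ ≤ C := (ContinuousLinearMap.opNorm_le_bound _ hcpos.le
        (J.norm_W_le hE hx₁)).trans hc₂
      calc R * (δ * ‖∇ f x₁‖) * ‖W x₁‖ ≤ R * (δ * F₁) * C := by
            gcongr
            exact hF₁' x₁ hx₁
        _ = _ := by ring
    have h4 : |∑ i, fderiv ℝ (fderiv ℝ f) x₁ (lorentzFrame e (P x₁) i)
        (lorentzFrame e (P x₁) i)| ≤ F₂ * (d * R ^ 2) := by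
      refine (Finset.abs_sum_le_sum_abs _ _).trans ?_
      calc _ ≤ ∑ i, F₂ * ‖lorentzFrame e (P x₁) i‖ ^ 2 := by
            refine Finset.sum_le_sum fun i _ => ?_
            have := (fderiv ℝ (fderiv ℝ f) x₁).le_opNorm₂ (lorentzFrame e (P x₁) i)
              (lorentzFrame e (P x₁) i)
            rw [Real.norm_eq_abs, mul_assoc, ← sq] at this
            exact this.trans (mul_le_mul_of_nonneg_right (hF₂' x₁ hx₁) (by positivity))
        _ ≤ _ := by
            rw [← Finset.mul_sum]
            exact mul_le_mul_of_nonneg_left (hE.sum_frame_le hPx) hF₂0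
    have h5 : c₀ ≤ 2 * ε' * ∑ i, ‖W x₁ (lorentzFrame e (P x₁) i)‖ ^ 2 := by
      refine mul_le_mul_of_nonneg_left (le_trans ?_ h2) (by positivity)
      gcongr
    have h6 := neg_abs_le (∑ i, fderiv ℝ (fderiv ℝ f) x₁ (lorentzFrame e (P x₁) i)
        (lorentzFrame e (P x₁) i))
    have h7 := neg_abs_le (fderiv ℝ (lorentzTrace e) (P x₁) (W x₁ ζ) (W x₁))
    nlinarith
  have hHd : HasFDerivWithinAt H
      (innerSL ℝ (W x₀ b) - δ • fderiv ℝ f x₀) (closure Ω) x₀ := by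
    have h1 := (J.hasFDerivWithinAt_P x₀ hx₀c).sub_const (P x₀)
    have h2 := (((hasFDerivWithinAt_const b x₀ (closure Ω)).inner ℝ h1).sub
      ((h1.norm_sq).const_mul ε')).sub ((hf.hasFDerivAt x₀).hasFDerivWithinAt.const_mul δ)
    refine h2.congr_fderiv ?_
    ext v
    simp [(J.isSymmNonneg x₀ hx₀c).symm]
  have hmin : IsLocalMinOn H (closure Ω) x₀ := by
    have h0 : H x₀ = 0 := by simp [hH, hf.eq_zero x₀ hx₀]
    filter_upwards [self_mem_nhdsWithin] with x hx
    rw [h0]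
    exact hHnn x hx
  -- The minimum at `x₀` gives a nonnegative derivative in every inward direction, so `W b - δ ∇ f
  -- x₀` lies in the dual cone of a half space and is a nonnegative multiple of the normal.
  have hcone : ∀ v, 0 < ⟪∇ f x₀, v⟫ → 0 ≤ ⟪W x₀ b - δ • ∇ f x₀, v⟫ := by
    intro v hv
    have := hmin.hasFDerivWithinAt_nonneg hHd (hf.mem_posTangentConeAt hx₀ hv)
    rw [inner_sub_left, inner_smul_left, inner_gradient_eq]
    simpa using this
  obtain ⟨t, ht, hty⟩ := exists_eq_smul_of_inner_nonneg
    (norm_pos_iff.1 (hm.trans_le (hmN x₀ hx₀))) hcone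
  exact ⟨δ + t, by linarith, by rw [add_smul, ← hty]; abel⟩

/-- Uniform obliqueness. -/
lemma exists_oblique {f : E → ℝ} {ε : ℝ} {f' : E → ℝ} {ε' : ℝ} {R C : ℝ}
    (hE : EllipticBounds e (closure Ω') R) (hf : IsDefiningFunction Ω f ε)
    (hf' : IsDefiningFunction Ω' f' ε') (hΩ : IsOpen Ω) (hbdd : Bornology.IsBounded Ω)
    (hne : Ω.Nonempty) (hC : 1 ≤ C) :
    ∃ δ : ℝ, 0 < δ ∧ ∀ {u P W T S c}, IsSolutionJet e Ω Ω' u P W T S c → 1 / C ≤ c → c ≤ C →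
      ∀ x₀ ∈ frontier Ω, δ ≤ ⟪∇ f x₀, ∇ f' (P x₀)⟫ ∧
        ∃ k : ℝ, δ ≤ k ∧ W x₀ (∇ f' (P x₀)) = k • ∇ f x₀ := by
  obtain ⟨δ, hδ, hopf⟩ := exists_hopf hE hf hf' hΩ hbdd hne hC
  obtain ⟨m, hm, hmN⟩ := hf.exists_le_norm_gradient hΩ hne
  have hC0 : 0 < C := one_pos.trans_le hC
  refine ⟨min δ (δ * m ^ 2 / C), lt_min hδ (by positivity),
    fun {u P W T S c} J hc₁ hc₂ x₀ hx₀ => ?_⟩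
  obtain ⟨k, hk, hWk⟩ := hopf J hc₁ hc₂ x₀ hx₀
  have hx₀c := frontier_subset_closure hx₀
  refine ⟨(min_le_right _ _).trans ?_, k, (min_le_left _ _).trans hk, hWk⟩
  -- Inserting `W b = k ∇ f x₀` into `‖W b‖² ≤ C ⟪W b, b⟫` and dividing by `k` gives `k ‖∇ f x₀‖² ≤
  -- C ⟪∇ f x₀, b⟫`.
  have h1 := (J.isSymmNonneg x₀ hx₀c).norm_sq_le (R := C) (fun z =>
    (J.norm_W_le hE hx₀c z).trans (mul_le_mul_of_nonneg_right hc₂ (norm_nonneg z)))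
    (∇ f' (P x₀))
  have hk0 : 0 < k := hδ.trans_le hk
  rw [hWk, norm_smul, inner_smul_left, Real.norm_eq_abs, abs_of_pos hk0] at h1
  simp only [conj_trivial] at h1
  have h2 : m ^ 2 ≤ ‖∇ f x₀‖ ^ 2 := by
    have := hmN x₀ hx₀
    gcongr
  have h3 : k * (k * m ^ 2) ≤ k * (C * ⟪∇ f x₀, ∇ f' (P x₀)⟫) := by
    have := mul_le_mul_of_nonneg_left h2 (sq_nonneg k)
    linarith
  have h4 := le_of_mul_le_mul_left h3 hk0
  rw [div_le_iff₀ hC0]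
  nlinarith [sq_nonneg m]

end IsSolutionJet

end Boundary

/-! ### Second order expansion of the boundary condition -/

section ThirdDerivative

/-- Second order Taylor expansion within a convex set. -/
lemma Convex.isLittleO_taylor_two {E F : Type*} [NormedAddCommGroup E] [NormedSpace ℝ E]
    [NormedAddCommGroup F] [NormedSpace ℝ F] {s : Set E} (hs : Convex ℝ s) {P : E → F}
    {W : E → E →L[ℝ] F} {T : E →L[ℝ] E →L[ℝ] F} {x₀ : E} (hx₀ : x₀ ∈ s)
    (hP : ∀ x ∈ s, HasFDerivWithinAt P (W x) s x) (hW : HasFDerivWithinAt W T s x₀) :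
    (fun x => P x - P x₀ - W x₀ (x - x₀) - (1 / 2 : ℝ) • T (x - x₀) (x - x₀))
      =o[𝓝[s] x₀] fun x => ‖x - x₀‖ ^ 2 := by
  refine Asymptotics.isLittleO_iff.2 fun η hη => ?_
  have h1 := Asymptotics.isLittleO_iff.1 hW.isLittleO hη
  obtain ⟨r, hr, hball⟩ := Metric.mem_nhdsWithin_iff.1 h1
  have hmem : Metric.ball x₀ r ∩ s ∈ 𝓝[s] x₀ :=
    inter_mem (mem_nhdsWithin_of_mem_nhds (Metric.ball_mem_nhds x₀ hr)) self_mem_nhdsWithin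
  filter_upwards [hmem] with x hx
  set y := x - x₀ with hy
  have hseg : ∀ t ∈ Icc (0 : ℝ) 1, x₀ + t • y ∈ Metric.ball x₀ r ∩ s := by
    intro t ht
    refine ⟨?_, hs.add_smul_sub_mem hx₀ hx.2 ht⟩
    have h2 := hx.1
    rw [Metric.mem_ball, dist_eq_norm] at h2 ⊢
    rw [add_sub_cancel_left, norm_smul, Real.norm_eq_abs, abs_of_nonneg ht.1]
    calc t * ‖y‖ ≤ 1 * ‖y‖ := by gcongr; exact ht.2
      _ < r := by rwa [one_mul]
  have hd : ∀ t ∈ Icc (0 : ℝ) 1, HasDerivWithinAt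
      (fun t : ℝ => P (x₀ + t • y) - t • W x₀ y - (t ^ 2 / 2) • T y y)
      (W (x₀ + t • y) y - W x₀ y - t • T y y) (Icc 0 1) t := by
    intro t ht
    have e1 : HasDerivWithinAt (fun t : ℝ => P (x₀ + t • y)) (W (x₀ + t • y) y) (Icc 0 1) t :=
      (hP _ (hseg t ht).2).comp_hasDerivWithinAt t (hasDerivAt_line x₀ y t).hasDerivWithinAt
        fun t ht => (hseg t ht).2
    have e2 : HasDerivAt (fun t : ℝ => t • W x₀ y) (W x₀ y) t := by
      simpa using (hasDerivAt_id t).smul_const (W x₀ y)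
    have e3 : HasDerivAt (fun t : ℝ => (t ^ 2 / 2) • T y y) (t • T y y) t := by
      have := ((hasDerivAt_pow 2 t).div_const 2).smul_const (T y y)
      refine this.congr_deriv ?_
      congr 1
      norm_num
    exact (e1.sub e2.hasDerivWithinAt).sub e3.hasDerivWithinAt
  have hb : ∀ t ∈ Ico (0 : ℝ) 1, ‖W (x₀ + t • y) y - W x₀ y - t • T y y‖ ≤ η * ‖y‖ ^ 2 := by
    intro t ht
    have h2 := hball (hseg t (Ico_subset_Icc_self ht))
    simp only [mem_ofPred_eq, add_sub_cancel_left] at h2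
    have h3 : W (x₀ + t • y) y - W x₀ y - t • T y y
        = (W (x₀ + t • y) - W x₀ - T (t • y)) y := by simp
    rw [h3]
    refine (ContinuousLinearMap.le_of_opNorm_le _ h2 y).trans ?_
    rw [norm_smul, Real.norm_eq_abs, abs_of_nonneg ht.1]
    have : t * ‖y‖ ≤ 1 * ‖y‖ := by gcongr; exact ht.2.le
    calc η * (t * ‖y‖) * ‖y‖ ≤ η * (1 * ‖y‖) * ‖y‖ := by gcongr
      _ = _ := by ring
  have := norm_image_sub_le_of_norm_deriv_le_segment_01' hd hb
  have e4 : x₀ + y = x := by simp [hy]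
  simp only [zero_smul, add_zero, one_smul, sub_zero, one_pow, e4] at this
  rw [Real.norm_of_nonneg (by positivity)]
  convert this using 2
  simp
  abel

variable {E : Type*} [NormedAddCommGroup E] [InnerProductSpace ℝ E] [FiniteDimensional ℝ E]

namespace IsDefiningFunction

variable {Ω : Set E} {f : E → ℝ} {ε : ℝ}

/-- Tangential directions are limits of secants through boundary points. -/
lemma exists_secant (hf : IsDefiningFunction Ω f ε) (hΩ : IsOpen Ω) {x₀ τ : E}
    (hx₀ : x₀ ∈ frontier Ω) (hN : ∇ f x₀ ≠ 0) (hτ : ⟪∇ f x₀, τ⟫ = 0) {δ : ℝ} (hδ : 0 < δ) :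
    ∃ t ∈ Ioo 0 δ, ∃ θ ∈ Icc (-δ) δ, x₀ + t • (τ + θ • ∇ f x₀) ∈ frontier Ω := by
  have hN2 : 0 < ⟪∇ f x₀, ∇ f x₀⟫ := real_inner_self_pos.2 hN
  have h1 : 0 < ⟪∇ f x₀, τ + δ • ∇ f x₀⟫ := by
    rw [inner_add_right, hτ, inner_smul_right]
    positivity
  obtain ⟨t, hmem, ht⟩ := ((hf.eventually_mem hx₀ h1).and (Ioo_mem_nhdsGT hδ)).exists
  -- For `θ = δ` the point is in `Ω`, and for `θ = -δ` the support inequality keeps it outside; by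
  -- connectedness some `θ` in between gives a boundary point.
  have hnot : x₀ + t • (τ + (-δ) • ∇ f x₀) ∉ Ω := by
    intro hcon
    have h2 := hf.support_inner hx₀ (subset_closure hcon)
    rw [add_sub_cancel_left, inner_smul_right, inner_add_right, hτ, inner_smul_right] at h2
    have h3 : 0 ≤ ε * ‖t • (τ + (-δ) • ∇ f x₀)‖ ^ 2 := by
      have := hf.pos
      positivity
    have h4 : 0 < t * (δ * ⟪∇ f x₀, ∇ f x₀⟫) := mul_pos ht.1 (by positivity)
    nlinarith
  have hc : Continuous fun θ : ℝ => x₀ + t • (τ + θ • ∇ f x₀) := by fun_prop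
  have hpre : IsPreconnected ((fun θ : ℝ => x₀ + t • (τ + θ • ∇ f x₀)) '' Icc (-δ) δ) :=
    isPreconnected_Icc.image _ hc.continuousOn
  obtain ⟨z, ⟨θ, hθ, rfl⟩, hz⟩ : ((fun θ : ℝ => x₀ + t • (τ + θ • ∇ f x₀)) '' Icc (-δ) δ ∩
      frontier Ω).Nonempty := by
    by_contra hcon
    have hdisj : (fun θ : ℝ => x₀ + t • (τ + θ • ∇ f x₀)) '' Icc (-δ) δ ∩ frontier Ω = ∅ :=
      not_nonempty_iff_eq_empty.1 hcon
    have hne : ((fun θ : ℝ => x₀ + t • (τ + θ • ∇ f x₀)) '' Icc (-δ) δ ∩ Ω).Nonempty :=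
      ⟨_, ⟨δ, right_mem_Icc.2 (by linarith), rfl⟩, hmem⟩
    have hsub := IsPreconnected.subset_left_of_subset_union hΩ isClosed_closure.isOpen_compl
      (disjoint_compl_right.mono_left subset_closure) (by
        intro z hz
        by_cases hzc : z ∈ closure Ω
        · left
          by_contra hzΩ
          have : z ∈ frontier Ω := by
            rw [hΩ.frontier_eq]
            exact ⟨hzc, hzΩ⟩
          exact ((eq_empty_iff_forall_notMem.1 hdisj) z ⟨hz, this⟩).elim
        · exact Or.inr hzc)
      hne hpre
    exact hnot (hsub ⟨-δ, left_mem_Icc.2 (by linarith), rfl⟩)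
  exact ⟨t, ht, θ, hθ, hz⟩

/-- Taylor expansion of `-f` between two of its zeros. It expresses an upper bound for the curvature
of the boundary and is used for `Ω'`. -/
lemma exists_le_of_frontier (hf : IsDefiningFunction Ω f ε) (hconv : Convex ℝ Ω)
    (hbdd : Bornology.IsBounded Ω) :
    ∃ K : ℝ, 0 ≤ K ∧ ∀ p ∈ frontier Ω, ∀ q ∈ frontier Ω, ⟪∇ f p, q - p⟫ ≤ K * ‖q - p‖ ^ 2 := by
  have hcomp : IsCompact (closure Ω) :=
    Metric.isCompact_of_isClosed_isBounded isClosed_closure hbdd.closure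
  obtain ⟨F, hF, hF'⟩ := hcomp.exists_norm_le
    (hf.contDiff_fderiv.fderiv_right (m := 0) (by norm_cast)).continuous.continuousOn 0
  refine ⟨F / 2, by positivity, fun p hp q hq => ?_⟩
  have hg : ∀ x, fderiv ℝ (fun x => -f x) x = -fderiv ℝ f x := fun x => fderiv_fun_neg
  have hgg : fderiv ℝ (fderiv ℝ fun x => -f x) = fun x => -fderiv ℝ (fderiv ℝ f) x := by
    have : fderiv ℝ (fun x => -f x) = fun x => -fderiv ℝ f x := funext hg
    rw [this]
    exact funext fun x => fderiv_fun_neg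
  have := le_add_of_fderiv_fderiv_le (k := fun x => -f x) (x₀ := p) (x := q)
    (c := F * ‖q - p‖ ^ 2) (fun z _ => hf.contDiff.neg.contDiffAt.of_le (by norm_cast)) (by
      intro z hz
      have hzc := hconv.closure.segment_subset (frontier_subset_closure hp)
        (frontier_subset_closure hq) hz
      rw [hgg]
      have h1 := (fderiv ℝ (fderiv ℝ f) z).le_opNorm₂ (q - p) (q - p)
      rw [Real.norm_eq_abs, mul_assoc, ← sq] at h1
      have h2 := neg_abs_le (fderiv ℝ (fderiv ℝ f) z (q - p) (q - p))
      have h3 := mul_le_mul_of_nonneg_right (hF' z hzc) (sq_nonneg ‖q - p‖)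
      simp only [neg_apply]
      linarith)
  rw [hg, hf.eq_zero p hp, hf.eq_zero q hq] at this
  rw [inner_gradient_eq]
  simp only [neg_apply] at this
  linarith

end IsDefiningFunction

variable {ι : Type*} [Fintype ι]

namespace IsSolutionJet

variable {e : OrthonormalBasis ι ℝ E} {Ω Ω' : Set E}

/-- The double tangential derivative of the boundary condition: the second fundamental form of
the boundary makes the oblique derivative of tangential second derivatives negative. -/
lemma inner_third_le {u P W T S c} (J : IsSolutionJet e Ω Ω' u P W T S c)
    {f f' : E → ℝ} {ε K k : ℝ} (hf : IsDefiningFunction Ω f ε)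
    (hΩ : IsOpen Ω) (hconv : Convex ℝ Ω)
    (hK : ∀ p ∈ frontier Ω', ∀ q ∈ frontier Ω', ⟪∇ f' p, q - p⟫ ≤ K * ‖q - p‖ ^ 2) {x₀ τ : E}
    (hx₀ : x₀ ∈ frontier Ω) (hN : ∇ f x₀ ≠ 0) (hτ : ⟪∇ f x₀, τ⟫ = 0) (hk : 0 ≤ k)
    (hWk : W x₀ (∇ f' (P x₀)) = k • ∇ f x₀) :
    k * ε * ‖τ‖ ^ 2 + 1 / 2 * ⟪∇ f' (P x₀), T x₀ τ τ⟫ ≤ K * ‖W x₀ τ‖ ^ 2 := by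
  have hx₀c := frontier_subset_closure hx₀
  have hsec : ∀ m : ℕ, ∃ t ∈ Ioo (0 : ℝ) (1 / (m + 1)), ∃ θ ∈ Icc (-(1 / (m + 1)) : ℝ) (1 / (m + 1)),
      x₀ + t • (τ + θ • ∇ f x₀) ∈ frontier Ω := fun m =>
    hf.exists_secant hΩ hx₀ hN hτ (by positivity)
  choose t ht θ hθ hmem using hsec
  have hlim0 := tendsto_one_div_add_atTop_nhds_zero_nat (𝕜 := ℝ)
  have htlim : Tendsto t atTop (𝓝 0) :=
    squeeze_zero (fun m => (ht m).1.le) (fun m => (ht m).2.le) hlim0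
  have hθlim : Tendsto θ atTop (𝓝 0) :=
    squeeze_zero_norm (fun m => abs_le.2 (hθ m)) hlim0
  set y : ℕ → E := fun m => τ + θ m • ∇ f x₀ with hy
  have hylim : Tendsto y atTop (𝓝 τ) := by
    simpa using (hθlim.smul_const (∇ f x₀)).const_add τ
  have htylim : Tendsto (fun m => x₀ + t m • y m) atTop (𝓝[closure Ω] x₀) := by
    refine tendsto_nhdsWithin_iff.2 ⟨?_, Eventually.of_forall fun m =>
      frontier_subset_closure (hmem m)⟩
    simpa using (htlim.smul hylim).const_add x₀
  set b := ∇ f' (P x₀) with hb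
  have htay := hconv.closure.isLittleO_taylor_two hx₀c J.hasFDerivWithinAt_P
    (J.hasFDerivWithinAt_W x₀ hx₀c)
  have hrem : Tendsto (fun m => ((t m) ^ 2)⁻¹ • (P (x₀ + t m • y m) - P x₀ - W x₀ (t m • y m)
      - (1 / 2 : ℝ) • T x₀ (t m • y m) (t m • y m))) atTop (𝓝 0) := by
    have h1 := htay.comp_tendsto htylim
    have h2 : (fun m => ‖t m • y m‖ ^ 2) =O[atTop] fun m => (t m) ^ 2 := by
      have h3 : (fun m => ‖y m‖ ^ 2) =O[atTop] fun _ => (1 : ℝ) :=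
        (hylim.norm.pow 2).isBigO_one ℝ
      have h4 := (Asymptotics.isBigO_refl (fun m => (t m) ^ 2) atTop).mul h3
      refine (h4.congr (fun m => ?_) (fun m => mul_one _))
      rw [norm_smul, mul_pow, Real.norm_eq_abs, sq_abs]
    simp only [Function.comp_def, add_sub_cancel_left] at h1
    have h5 := h1.trans_isBigO h2
    exact h5.tendsto_inv_smul_nhds_zero
  have hW : Tendsto (fun m => (t m)⁻¹ • (P (x₀ + t m • y m) - P x₀)) atTop (𝓝 (W x₀ τ)) := by
    refine (J.hasFDerivWithinAt_P x₀ hx₀c).lim (by simpa using htlim.smul hylim)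
      (Eventually.of_forall fun m => frontier_subset_closure (hmem m)) ?_
    · refine hylim.congr fun m => ?_
      rw [smul_smul, inv_mul_cancel₀ (ht m).1.ne', one_smul]
  -- This is `hK` for the two points `P x₀` and `P (x₀ + t y)` of `∂Ω'`, divided by `t²`. The first
  -- order term survives with a sign: `⟪b, W y⟫ = k ⟪∇ f x₀, y⟫ ≥ k ε t ‖y‖²` by the support
  -- inequality of `Ω`.
  have hineq : ∀ m, k * ε * ‖y m‖ ^ 2 + 1 / 2 * ⟪b, T x₀ (y m) (y m)⟫
      + ⟪b, ((t m) ^ 2)⁻¹ • (P (x₀ + t m • y m) - P x₀ - W x₀ (t m • y m)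
        - (1 / 2 : ℝ) • T x₀ (t m • y m) (t m • y m))⟫
      ≤ K * ‖(t m)⁻¹ • (P (x₀ + t m • y m) - P x₀)‖ ^ 2 := by
    intro m
    have ht0 := (ht m).1
    have h1 := hK _ (J.mapsTo_frontier x₀ hx₀) _ (J.mapsTo_frontier _ (hmem m))
    have h2 := hf.support_inner hx₀ (frontier_subset_closure (hmem m))
    have h3 : ⟪b, W x₀ (y m)⟫ = k * ⟪∇ f x₀, y m⟫ := by
      rw [← (J.isSymmNonneg x₀ hx₀c).symm, hWk, inner_smul_left]
      simp
    rw [add_sub_cancel_left, norm_smul, inner_smul_right, Real.norm_eq_abs, abs_of_pos ht0,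
      mul_pow] at h2
    have h4 : k * ε * ‖y m‖ ^ 2 ≤ (t m)⁻¹ * ⟪b, W x₀ (y m)⟫ := by
      rw [h3, inv_mul_eq_div, le_div_iff₀ ht0]
      have h6 : t m * (ε * t m * ‖y m‖ ^ 2) ≤ t m * ⟪∇ f x₀, y m⟫ := by linarith
      have h7 := mul_le_mul_of_nonneg_left (le_of_mul_le_mul_left h6 ht0) hk
      linarith
    have h5 : ‖(t m)⁻¹ • (P (x₀ + t m • y m) - P x₀)‖ ^ 2
        = ((t m) ^ 2)⁻¹ * ‖P (x₀ + t m • y m) - P x₀‖ ^ 2 := by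
      rw [norm_smul, mul_pow, norm_inv, Real.norm_eq_abs, abs_of_pos ht0, inv_pow]
    rw [h5]
    have h8 := mul_le_mul_of_nonneg_left h1 (by positivity : (0 : ℝ) ≤ ((t m) ^ 2)⁻¹)
    simp only [map_smul, smul_apply, inner_smul_right, inner_sub_right] at h8 ⊢
    have e1 : ((t m) ^ 2)⁻¹ * (t m * ⟪b, W x₀ (y m)⟫) = (t m)⁻¹ * ⟪b, W x₀ (y m)⟫ := by
      field_simp
    have e2 : ((t m) ^ 2)⁻¹ * (1 / 2 * (t m * (t m * ⟪b, T x₀ (y m) (y m)⟫)))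
        = 1 / 2 * ⟪b, T x₀ (y m) (y m)⟫ := by
      field_simp
    rw [mul_sub, mul_sub, e1, e2]
    linarith
  have hl : Tendsto (fun m => k * ε * ‖y m‖ ^ 2 + 1 / 2 * ⟪b, T x₀ (y m) (y m)⟫
      + ⟪b, ((t m) ^ 2)⁻¹ • (P (x₀ + t m • y m) - P x₀ - W x₀ (t m • y m)
        - (1 / 2 : ℝ) • T x₀ (t m • y m) (t m • y m))⟫) atTop
      (𝓝 (k * ε * ‖τ‖ ^ 2 + 1 / 2 * ⟪b, T x₀ τ τ⟫ + ⟪b, (0 : E)⟫)) := by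
    have hTy : Tendsto (fun m => T x₀ (y m) (y m)) atTop (𝓝 (T x₀ τ τ)) :=
      have hc : Continuous fun y => T x₀ y y := by fun_prop
      (hc.tendsto τ).comp hylim
    exact ((tendsto_const_nhds.mul (hylim.norm.pow 2)).add
      (tendsto_const_nhds.mul (tendsto_const_nhds.inner hTy))).add
      (tendsto_const_nhds.inner hrem)
  have hr : Tendsto (fun m => K * ‖(t m)⁻¹ • (P (x₀ + t m • y m) - P x₀)‖ ^ 2) atTop
      (𝓝 (K * ‖W x₀ τ‖ ^ 2)) := tendsto_const_nhds.mul (hW.norm.pow 2)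
  have := le_of_tendsto_of_tendsto' hl hr hineq
  simpa using this

end IsSolutionJet

end ThirdDerivative

/-! ### First derivatives at contact, and the adapted metric -/

section Metric

variable {E : Type*} [NormedAddCommGroup E] [InnerProductSpace ℝ E]

/-- At a zero of a nonnegative curve of quadratic forms, the second derivative dominates the square
of the first derivative. -/
lemma second_deriv_ge_of_nonneg {M M₁ : ℝ → E →L[ℝ] E} {M₂ : E →L[ℝ] E} {C : ℝ} (hC : 0 < C)
    {ξ : E} (hM : ∀ᶠ t in 𝓝 (0 : ℝ), HasDerivAt M (M₁ t) t) (hM₁ : HasDerivAt M₁ M₂ 0)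
    (hnn : ∀ᶠ t in 𝓝 (0 : ℝ), ∀ η, 0 ≤ ⟪M t η, η⟫) (h0 : ⟪M 0 ξ, ξ⟫ = 0)
    (hsymm : ∀ a b, ⟪M₁ 0 a, b⟫ = ⟪a, M₁ 0 b⟫) (hle : ∀ η, ⟪M 0 η, η⟫ ≤ C * ‖η‖ ^ 2) :
    ⟪M₁ 0 ξ, ξ⟫ = 0 ∧ 2 / C * ‖M₁ 0 ξ‖ ^ 2 ≤ ⟪M₂ ξ, ξ⟫ := by
  have hline : ∀ (η : E) (t : ℝ), HasDerivAt (fun t : ℝ => ξ + t • η) η t :=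
    fun η t => hasDerivAt_line ξ η t
  -- The vector moves along with the parameter: `⟪M t (ξ + t η), ξ + t η⟫` is minimal at `t = 0` for
  -- every `η`, which leaves `η` free to be optimised.
  have hd : ∀ η : E, ∀ᶠ t in 𝓝 (0 : ℝ),
      HasDerivAt (fun t : ℝ => ⟪M t (ξ + t • η), ξ + t • η⟫)
        (⟪M t (ξ + t • η), η⟫ + ⟪M₁ t (ξ + t • η) + M t η, ξ + t • η⟫) t := by
    intro η
    filter_upwards [hM] with t ht
    exact (ht.clm_apply (hline η t)).inner ℝ (hline η t)
  have hmin : ∀ η : E, IsLocalMin (fun t : ℝ => ⟪M t (ξ + t • η), ξ + t • η⟫) 0 := by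
    intro η
    filter_upwards [hnn] with t ht
    simp only [zero_smul, add_zero, h0]
    exact ht _
  have hd2 : ∀ η : E, HasDerivAt
      (fun t : ℝ => ⟪M t (ξ + t • η), η⟫ + ⟪M₁ t (ξ + t • η) + M t η, ξ + t • η⟫)
      (⟪M₂ ξ, ξ⟫ + 4 * ⟪M₁ 0 ξ, η⟫ + 2 * ⟪M 0 η, η⟫) 0 := by
    intro η
    have e0 := hM.self_of_nhds
    have e1 := (e0.clm_apply (hline η 0)).inner ℝ (hasDerivAt_const (0 : ℝ) η)
    have e2 := (hM₁.clm_apply (hline η 0)).add (e0.clm_apply (hasDerivAt_const (0 : ℝ) η))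
    refine (e1.add (e2.inner ℝ (hline η 0))).congr_deriv ?_
    have hs : ⟪M₁ 0 η, ξ⟫ = ⟪M₁ 0 ξ, η⟫ := by rw [hsymm, real_inner_comm]
    simp only [Pi.add_apply, zero_smul, add_zero, map_zero, inner_zero_right, zero_add,
      inner_add_left, hs]
    ring
  constructor
  · have := (hmin 0).hasDerivAt_eq_zero (hd 0).self_of_nhds
    simpa using this
  · have h1 := nonneg_of_hasDerivAt_of_isLocalMin (hd (-(1 / C) • M₁ 0 ξ))
      (hd2 (-(1 / C) • M₁ 0 ξ)) (hmin _)
    have h2 := hle (-(1 / C) • M₁ 0 ξ)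
    rw [norm_smul, mul_pow, Real.norm_eq_abs, sq_abs] at h2
    rw [inner_smul_right, real_inner_self_eq_norm_sq] at h1
    have h3 : C * ((-(1 / C)) ^ 2 * ‖M₁ 0 ξ‖ ^ 2) = 1 / C * ‖M₁ 0 ξ‖ ^ 2 := by
      field_simp
    rw [h3] at h2
    have h4 : 2 / C * ‖M₁ 0 ξ‖ ^ 2 = 2 * (1 / C * ‖M₁ 0 ξ‖ ^ 2) := by ring
    linarith

/-- Applied to `⟪∇ f x, ∇ f' p⟫`, it keeps the metric definite at all pairs `(x, p)` and changes
nothing where obliqueness holds. -/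
lemma exists_contDiff_eq_self_of_ge {δ : ℝ} (hδ : 0 < δ) :
    ∃ Ψ : ℝ → ℝ, ContDiff ℝ ∞ Ψ ∧ (∀ s, δ / 2 ≤ Ψ s) ∧ ∀ s, δ ≤ s → Ψ s = s := by
  refine ⟨fun s => Real.smoothTransition (2 * s / δ - 1) * s
    + (1 - Real.smoothTransition (2 * s / δ - 1)) * δ, ?_, fun s => ?_, fun s hs => ?_⟩
  · have h1 : ContDiff ℝ ∞ fun s : ℝ => Real.smoothTransition (2 * s / δ - 1) :=
      Real.smoothTransition.contDiff.comp (by fun_prop)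
    fun_prop
  · have h0 := Real.smoothTransition.nonneg (2 * s / δ - 1)
    have h1 := Real.smoothTransition.le_one (2 * s / δ - 1)
    rcases le_total s (δ / 2) with h | h
    · have : 2 * s / δ - 1 ≤ 0 := by
        rw [sub_nonpos, div_le_one hδ]
        linarith
      simp only [Real.smoothTransition.zero_of_nonpos this]
      linarith
    · nlinarith [mul_nonneg h0 (sub_nonneg.2 h), mul_nonneg (sub_nonneg.2 h1) hδ.le]
  · have : 1 ≤ 2 * s / δ - 1 := by
      rw [le_sub_iff_add_le, le_div_iff₀ hδ]
      linarith
    simp only [Real.smoothTransition.one_of_one_le this]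
    ring

/-- The operator of the form `ξ ↦ |ρ ξ - ⟪N, ξ⟫ b|² + ⟪N, ξ⟫²`. -/
noncomputable def obliqueForm (ρ : ℝ) (N b : E) : E →L[ℝ] E :=
  ρ ^ 2 • ContinuousLinearMap.id ℝ E
    - ρ • ((innerSL ℝ N).smulRight b + (innerSL ℝ b).smulRight N)
    + (‖b‖ ^ 2 + 1) • (innerSL ℝ N).smulRight N

lemma obliqueForm_apply (ρ : ℝ) (N b ξ : E) : obliqueForm ρ N b ξ =
    ρ ^ 2 • ξ - ρ • (⟪N, ξ⟫ • b + ⟪b, ξ⟫ • N) + (‖b‖ ^ 2 + 1) • ⟪N, ξ⟫ • N := by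
  simp [obliqueForm]

lemma obliqueForm_symm (ρ : ℝ) (N b x y : E) :
    ⟪obliqueForm ρ N b x, y⟫ = ⟪x, obliqueForm ρ N b y⟫ := by
  simp only [obliqueForm_apply, inner_add_left, inner_add_right, inner_sub_left, inner_sub_right,
    inner_smul_left, inner_smul_right, conj_trivial, real_inner_comm]
  ring

lemma obliqueForm_inner_self (ρ : ℝ) (N b ξ : E) :
    ⟪obliqueForm ρ N b ξ, ξ⟫ = ‖ρ • ξ - ⟪N, ξ⟫ • b‖ ^ 2 + ⟪N, ξ⟫ ^ 2 := by
  rw [← real_inner_self_eq_norm_sq, obliqueForm_apply, ← real_inner_self_eq_norm_sq b]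
  simp only [inner_add_left, inner_sub_left, inner_sub_right,
    inner_smul_left, inner_smul_right, conj_trivial, real_inner_comm]
  ring

lemma obliqueForm_coercive {ρ B : ℝ} {N b : E} (hρ : 0 ≤ ρ) (hb : ‖b‖ ≤ B) (ξ : E) :
    ρ ^ 2 / (2 * (1 + B ^ 2)) * ‖ξ‖ ^ 2 ≤ ⟪obliqueForm ρ N b ξ, ξ⟫ := by
  rw [obliqueForm_inner_self]
  have hB : 0 ≤ B := (norm_nonneg b).trans hb
  have h1 : ρ * ‖ξ‖ ≤ ‖ρ • ξ - ⟪N, ξ⟫ • b‖ + |⟪N, ξ⟫| * B := by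
    have h2 : ρ * ‖ξ‖ = ‖(ρ • ξ - ⟪N, ξ⟫ • b) + ⟪N, ξ⟫ • b‖ := by
      rw [sub_add_cancel, norm_smul, Real.norm_eq_abs, abs_of_nonneg hρ]
    rw [h2]
    refine (norm_add_le _ _).trans ?_
    rw [norm_smul, Real.norm_eq_abs]
    gcongr
  rw [div_mul_eq_mul_div, div_le_iff₀ (by positivity)]
  have h3 : ρ ^ 2 * ‖ξ‖ ^ 2 ≤ (‖ρ • ξ - ⟪N, ξ⟫ • b‖ + |⟪N, ξ⟫| * B) ^ 2 := by
    rw [← mul_pow]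
    gcongr
  rw [← sq_abs ⟪N, ξ⟫]
  set a := ‖ρ • ξ - ⟪N, ξ⟫ • b‖
  set c := |⟪N, ξ⟫|
  nlinarith [sq_nonneg (a - c * B), sq_nonneg (a * B), sq_nonneg c]

/-- For `ρ = ⟪N, b⟫` the vector `ρ b - ⟪N, b⟫ b` is zero, so `b` is seen only by the summand `⟪N,
·⟫²`, which ignores `τ`. -/
lemma obliqueForm_orthogonal {N b τ : E} (h : ⟪N, τ⟫ = 0) :
    ⟪obliqueForm ⟪N, b⟫ N b b, τ⟫ = 0 := by
  simp only [obliqueForm_apply, inner_add_left, inner_sub_left, inner_smul_left, conj_trivial, h]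
  ring

variable [FiniteDimensional ℝ E]

/-- A smooth field of scalar products over `closure Ω × closure Ω'` for which, at boundary points
satisfying the obliqueness bound `δ`, the normal of `Ω'` is orthogonal to the tangent space of
`∂Ω`. -/
structure IsAdaptedMetric (Ω Ω' : Set E) (f f' : E → ℝ) (δ γ Q : ℝ) (q : E × E → E →L[ℝ] E) :
    Prop where
  contDiff : ContDiff ℝ ∞ q
  symm : ∀ z a b, ⟪q z a, b⟫ = ⟪a, q z b⟫
  pos : 0 < γ
  coercive : ∀ x ∈ closure Ω, ∀ p ∈ closure Ω', ∀ ξ, γ * ‖ξ‖ ^ 2 ≤ ⟪q (x, p) ξ, ξ⟫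
  orthogonal : ∀ x p, δ ≤ ⟪∇ f x, ∇ f' p⟫ → ∀ τ, ⟪∇ f x, τ⟫ = 0 → ⟪q (x, p) (∇ f' p), τ⟫ = 0
  one_le : 1 ≤ Q
  bound : ∀ x ∈ closure Ω, ∀ p ∈ closure Ω', ‖q (x, p)‖ ≤ Q
  bound' : ∀ x ∈ closure Ω, ∀ p ∈ closure Ω', ‖fderiv ℝ q (x, p)‖ ≤ Q
  bound'' : ∀ x ∈ closure Ω, ∀ p ∈ closure Ω', ‖fderiv ℝ (fderiv ℝ q) (x, p)‖ ≤ Q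

lemma exists_isAdaptedMetric {Ω Ω' : Set E} {f f' : E → ℝ} {ε ε' δ : ℝ}
    (hf : IsDefiningFunction Ω f ε) (hf' : IsDefiningFunction Ω' f' ε')
    (hbdd : Bornology.IsBounded Ω) (hbdd' : Bornology.IsBounded Ω') (hδ : 0 < δ) :
    ∃ γ Q q, IsAdaptedMetric Ω Ω' f f' δ γ Q q := by
  obtain ⟨Ψ, hΨ, hΨδ, hΨs⟩ := exists_contDiff_eq_self_of_ge hδ
  have hcomp : IsCompact (closure Ω) :=
    Metric.isCompact_of_isClosed_isBounded isClosed_closure hbdd.closure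
  have hcomp' : IsCompact (closure Ω') :=
    Metric.isCompact_of_isClosed_isBounded isClosed_closure hbdd'.closure
  obtain ⟨B, hB, hB'⟩ := hcomp'.exists_norm_le hf'.contDiff_gradient.continuous.continuousOn 0
  set q : E × E → E →L[ℝ] E := fun z =>
    obliqueForm (Ψ ⟪∇ f z.1, ∇ f' z.2⟫) (∇ f z.1) (∇ f' z.2) with hq
  have hN : ContDiff ℝ ∞ fun z : E × E => ∇ f z.1 := hf.contDiff_gradient.comp contDiff_fst
  have hb : ContDiff ℝ ∞ fun z : E × E => ∇ f' z.2 := hf'.contDiff_gradient.comp contDiff_snd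
  have hρ : ContDiff ℝ ∞ fun z : E × E => Ψ ⟪∇ f z.1, ∇ f' z.2⟫ := hΨ.comp (hN.inner ℝ hb)
  have hNs : ContDiff ℝ ∞ fun z : E × E => innerSL ℝ (∇ f z.1) :=
    (innerSL ℝ (E := E)).contDiff.comp hN
  have hbs : ContDiff ℝ ∞ fun z : E × E => innerSL ℝ (∇ f' z.2) :=
    (innerSL ℝ (E := E)).contDiff.comp hb
  have hqc : ContDiff ℝ ∞ q := by
    simp only [hq, obliqueForm]
    exact (((hρ.pow 2).smul contDiff_const).sub
      (hρ.smul ((hNs.smulRight hb).add (hbs.smulRight hN)))).add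
      (((hb.norm_sq ℝ).add contDiff_const).smul (hNs.smulRight hN))
  have hqc' : ContDiff ℝ ∞ (fderiv ℝ q) := hqc.fderiv_right (by norm_cast)
  have hprod := hcomp.prod hcomp'
  obtain ⟨Q₁, h1, hQ₁⟩ := hprod.exists_norm_le hqc.continuous.continuousOn 1
  obtain ⟨Q₂, h2, hQ₂⟩ := hprod.exists_norm_le hqc'.continuous.continuousOn Q₁
  obtain ⟨Q₃, h3, hQ₃⟩ := hprod.exists_norm_le
    (hqc'.fderiv_right (m := 0) (by norm_cast)).continuous.continuousOn Q₂
  refine ⟨(δ / 2) ^ 2 / (2 * (1 + B ^ 2)), Q₃, q, hqc, fun z => obliqueForm_symm _ _ _,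
    by positivity, ?_, ?_, by linarith,
    fun x hx p hp => (hQ₁ (x, p) ⟨hx, hp⟩).trans (by linarith),
    fun x hx p hp => (hQ₂ (x, p) ⟨hx, hp⟩).trans (by linarith),
    fun x hx p hp => (hQ₃ (x, p) ⟨hx, hp⟩)⟩
  · intro x hx p hp ξ
    have h := hΨδ ⟪∇ f x, ∇ f' p⟫
    refine le_trans ?_ (obliqueForm_coercive (by linarith) (hB' p hp) ξ)
    gcongr
  · intro x p hxp τ hτ
    simp only [hq]
    rw [hΨs _ hxp]
    exact obliqueForm_orthogonal hτ

end Metric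

/-! ### Excluding interior contact points -/

section InteriorContact

variable {E : Type*} [NormedAddCommGroup E] [InnerProductSpace ℝ E]

lemma symm_of_hasDerivAt {M : ℝ → E →L[ℝ] E} {M₁ : E →L[ℝ] E} (h : HasDerivAt M M₁ 0)
    (hsymm : ∀ᶠ t in 𝓝 (0 : ℝ), ∀ a b, ⟪M t a, b⟫ = ⟪a, M t b⟫) (a b : E) :
    ⟪M₁ a, b⟫ = ⟪a, M₁ b⟫ := by
  have h1 := (h.clm_apply (hasDerivAt_const (0 : ℝ) a)).inner ℝ (hasDerivAt_const (0 : ℝ) b)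
  have h2 := (hasDerivAt_const (0 : ℝ) a).inner ℝ (h.clm_apply (hasDerivAt_const (0 : ℝ) b))
  have h3 := h1.unique (h2.congr_of_eventuallyEq (hsymm.mono fun t ht => ht a b))
  simpa using h3

variable [FiniteDimensional ℝ E] {ι : Type*} [Fintype ι]

namespace IsSolutionJet

variable {e : OrthonormalBasis ι ℝ E} {Ω Ω' : Set E} {u : E → ℝ} {P : E → E}
  {W : E → E →L[ℝ] E} {T : E → E →L[ℝ] E →L[ℝ] E} {S : E → E →L[ℝ] E →L[ℝ] E →L[ℝ] E}
  {c R C : ℝ} {x : E} {q : E × E → E →L[ℝ] E}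

lemma hasDerivAt_graph (J : IsSolutionJet e Ω Ω' u P W T S c) (hΩ : IsOpen Ω) {v : E} {t : ℝ}
    (hx : x + t • v ∈ Ω) : HasDerivAt (fun t : ℝ => (x + t • v, P (x + t • v)))
      (v, W (x + t • v) v) t :=
  (hasDerivAt_line x v t).prodMk (J.hasDerivAt_P hΩ hx)

lemma hasDerivAt_metric (J : IsSolutionJet e Ω Ω' u P W T S c) (hΩ : IsOpen Ω)
    (hq : ContDiff ℝ ∞ q) {v : E} {t : ℝ} (hx : x + t • v ∈ Ω) :
    HasDerivAt (fun t : ℝ => q (x + t • v, P (x + t • v)))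
      (fderiv ℝ q (x + t • v, P (x + t • v)) (v, W (x + t • v) v)) t :=
  ((hq.differentiable (by simp)) (x + t • v, P (x + t • v))).hasFDerivAt.comp_hasDerivAt t
    (J.hasDerivAt_graph hΩ hx)

lemma hasDerivAt_metric_deriv (J : IsSolutionJet e Ω Ω' u P W T S c) (hΩ : IsOpen Ω)
    (hq : ContDiff ℝ ∞ q) {v : E} {t : ℝ} (hx : x + t • v ∈ Ω) :
    HasDerivAt (fun t : ℝ => fderiv ℝ q (x + t • v, P (x + t • v)) (v, W (x + t • v) v))
      (fderiv ℝ (fderiv ℝ q) (x + t • v, P (x + t • v)) (v, W (x + t • v) v) (v, W (x + t • v) v)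
        + fderiv ℝ q (x + t • v, P (x + t • v)) (0, T (x + t • v) v v)) t := by
  have hq' : ContDiff ℝ ∞ (fderiv ℝ q) := hq.fderiv_right (by norm_cast)
  have h1 : HasDerivAt (fun t : ℝ => fderiv ℝ q (x + t • v, P (x + t • v)))
      (fderiv ℝ (fderiv ℝ q) (x + t • v, P (x + t • v)) (v, W (x + t • v) v)) t :=
    ((hq'.differentiable (by simp)) (x + t • v, P (x + t • v))).hasFDerivAt.comp_hasDerivAt t
      (J.hasDerivAt_graph hΩ hx)
  have h2 : HasDerivAt (fun t : ℝ => (v, W (x + t • v) v)) (0, T (x + t • v) v v) t := by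
    have := (J.hasDerivAt_W hΩ hx).clm_apply (hasDerivAt_const t v)
    exact (hasDerivAt_const t v).prodMk (this.congr_deriv (by simp))
  exact h1.clm_apply h2

lemma hasDerivAt_exp_inner (a v : E) (A t : ℝ) :
    HasDerivAt (fun t : ℝ => Real.exp (A * ⟪a, x + t • v⟫))
      (A * ⟪a, v⟫ * Real.exp (A * ⟪a, x + t • v⟫)) t := by
  have h1 := ((hasDerivAt_const t a).inner ℝ (hasDerivAt_line x v t)).const_mul A
  refine h1.exp.congr_deriv ?_
  rw [inner_zero_left, add_zero]
  ring

/-- The derivative in direction `v` of `D²u - l (exp (A ⟪a, x⟫) - s) q(x, Du)`. -/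
noncomputable def contactDeriv (P : E → E) (W : E → E →L[ℝ] E) (T : E → E →L[ℝ] E →L[ℝ] E)
    (q : E × E → E →L[ℝ] E) (a : E) (A l s : ℝ) (x v : E) : E →L[ℝ] E :=
  T x v - ((l * (A * ⟪a, v⟫ * Real.exp (A * ⟪a, x⟫))) • q (x, P x)
    + (l * (Real.exp (A * ⟪a, x⟫) - s)) • fderiv ℝ q (x, P x) (v, W x v))

lemma contactDeriv_smul (a : E) (A l s : ℝ) (x v : E) (r : ℝ) :
    contactDeriv P W T q a A l s x (r • v) = r • contactDeriv P W T q a A l s x v := by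
  have h : (r • v, r • W x v) = r • (v, W x v) := rfl
  simp only [contactDeriv, map_smul, inner_smul_right, h, smul_sub, smul_add, smul_smul]
  ring_nf

/-- First and second order conditions at an interior contact point. -/
lemma contact_derivatives {f f' : E → ℝ} {δ γ Q : ℝ} (J : IsSolutionJet e Ω Ω' u P W T S c)
    (hE : EllipticBounds e (closure Ω') R) (hC : 0 < C) (hcC : c ≤ C) (hΩ : IsOpen Ω)
    (hq : IsAdaptedMetric Ω Ω' f f' δ γ Q q) (hx : x ∈ Ω) {a ξ : E} {A l s : ℝ}
    (hm : 0 ≤ l * (Real.exp (A * ⟪a, x⟫) - s))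
    (hM : ∀ y ∈ Ω, ∀ η, l * (Real.exp (A * ⟪a, y⟫) - s) * ⟪q (y, P y) η, η⟫ ≤ ⟪W y η, η⟫)
    (heq : l * (Real.exp (A * ⟪a, x⟫) - s) * ⟪q (x, P x) ξ, ξ⟫ = ⟪W x ξ, ξ⟫) (v : E) :
    ⟪contactDeriv P W T q a A l s x v ξ, ξ⟫ = 0 ∧
    2 / C * ‖contactDeriv P W T q a A l s x v ξ‖ ^ 2 ≤ ⟪S x v v ξ, ξ⟫
      - (l * (A * ⟪a, v⟫ * (A * ⟪a, v⟫ * Real.exp (A * ⟪a, x⟫))) * ⟪q (x, P x) ξ, ξ⟫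
        + 2 * (l * (A * ⟪a, v⟫ * Real.exp (A * ⟪a, x⟫))
          * ⟪fderiv ℝ q (x, P x) (v, W x v) ξ, ξ⟫)
        + l * (Real.exp (A * ⟪a, x⟫) - s)
          * (⟪fderiv ℝ (fderiv ℝ q) (x, P x) (v, W x v) (v, W x v) ξ, ξ⟫
            + ⟪fderiv ℝ q (x, P x) (0, T x v v) ξ, ξ⟫)) := by
  have hxc := subset_closure hx
  have hPc := J.mapsTo_closure hxc
  set M : ℝ → E →L[ℝ] E := fun t => W (x + t • v)
    - (l * (Real.exp (A * ⟪a, x + t • v⟫) - s)) • q (x + t • v, P (x + t • v)) with hMdef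
  set M₁ : ℝ → E →L[ℝ] E := fun t => contactDeriv P W T q a A l s (x + t • v) v with hM₁def
  have hd : ∀ t : ℝ, x + t • v ∈ Ω → HasDerivAt M (M₁ t) t := by
    intro t ht
    have h1 := J.hasDerivAt_W hΩ ht
    have h2 := J.hasDerivAt_metric hΩ hq.contDiff ht
    have h3 : HasDerivAt (fun t : ℝ => l * (Real.exp (A * ⟪a, x + t • v⟫) - s))
        (l * (A * ⟪a, v⟫ * Real.exp (A * ⟪a, x + t • v⟫))) t :=
      ((hasDerivAt_exp_inner a v A t).sub_const s).const_mul l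
    refine (h1.sub (h3.smul h2)).congr_deriv ?_
    simp only [hM₁def, contactDeriv]
    abel
  have hx0 : x + (0 : ℝ) • v ∈ Ω := by simpa using hx
  have hd2 := by
    have h1 := (J.hasDerivAt_T hx0).clm_apply (hasDerivAt_const (0 : ℝ) v)
    have h2 := J.hasDerivAt_metric hΩ hq.contDiff hx0
    have h3 : HasDerivAt (fun t : ℝ => l * (Real.exp (A * ⟪a, x + t • v⟫) - s))
        (l * (A * ⟪a, v⟫ * Real.exp (A * ⟪a, x + (0 : ℝ) • v⟫))) 0 :=
      ((hasDerivAt_exp_inner a v A 0).sub_const s).const_mul l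
    have h4 : HasDerivAt (fun t : ℝ => l * (A * ⟪a, v⟫ * Real.exp (A * ⟪a, x + t • v⟫)))
        (l * (A * ⟪a, v⟫ * (A * ⟪a, v⟫ * Real.exp (A * ⟪a, x + (0 : ℝ) • v⟫)))) 0 :=
      ((hasDerivAt_exp_inner a v A 0).const_mul (A * ⟪a, v⟫)).const_mul l
    have h5 := J.hasDerivAt_metric_deriv hΩ hq.contDiff hx0
    exact h1.sub ((h4.smul h2).add (h3.smul h5))
  have hev := line_mem hΩ hx v
  have hsymm : ∀ᶠ t in 𝓝 (0 : ℝ), ∀ a b, ⟪M t a, b⟫ = ⟪a, M t b⟫ := by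
    filter_upwards [hev] with t ht a b
    simp only [hMdef, sub_apply, smul_apply, inner_sub_left, inner_sub_right, inner_smul_left,
      inner_smul_right, conj_trivial, hq.symm, (J.isSymmNonneg _ (subset_closure ht)).symm]
  have hnn : ∀ᶠ t in 𝓝 (0 : ℝ), ∀ η, 0 ≤ ⟪M t η, η⟫ := by
    filter_upwards [hev] with t ht η
    have := hM _ ht η
    simp only [hMdef, sub_apply, smul_apply, inner_sub_left, inner_smul_left, conj_trivial]
    linarith
  have h0 : ⟪M 0 ξ, ξ⟫ = 0 := by
    simp only [hMdef, sub_apply, smul_apply, inner_sub_left, inner_smul_left, conj_trivial,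
      zero_smul, add_zero]
    linarith
  have hle : ∀ η, ⟪M 0 η, η⟫ ≤ C * ‖η‖ ^ 2 := by
    intro η
    have h1 := real_inner_le_norm (W x η) η
    have h2 := (J.norm_W_le hE hxc η).trans (mul_le_mul_of_nonneg_right hcC (norm_nonneg η))
    have h3 : 0 ≤ ⟪q (x, P x) η, η⟫ :=
      (mul_nonneg hq.pos.le (sq_nonneg ‖η‖)).trans (hq.coercive x hxc _ hPc η)
    have h4 := mul_nonneg hm h3
    have h5 := mul_le_mul_of_nonneg_right h2 (norm_nonneg η)
    simp only [hMdef, sub_apply, smul_apply, inner_sub_left, inner_smul_left, conj_trivial,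
      zero_smul, add_zero]
    nlinarith
  have hkey := second_deriv_ge_of_nonneg hC (M := M) (M₁ := M₁) (hev.mono hd) hd2 hnn h0
    (symm_of_hasDerivAt (hd 0 hx0) hsymm) hle
  simp only [hM₁def, zero_smul, add_zero] at hkey
  refine ⟨hkey.1, hkey.2.trans_eq ?_⟩
  simp only [sub_apply, add_apply, smul_apply, inner_sub_left, inner_add_left, inner_smul_left,
    conj_trivial, map_zero, add_zero]
  ring

lemma norm_graph_le (J : IsSolutionJet e Ω Ω' u P W T S c)
    (hE : EllipticBounds e (closure Ω') R) (hC : 1 ≤ C) (hcC : c ≤ C) (hx : x ∈ closure Ω)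
    (v : E) : ‖(v, W x v)‖ ≤ C * ‖v‖ := by
  rw [Prod.norm_mk]
  refine max_le (by nlinarith [norm_nonneg v]) ?_
  exact (J.norm_W_le hE hx v).trans (mul_le_mul_of_nonneg_right hcC (norm_nonneg v))

lemma norm_metric_deriv_le {f f' : E → ℝ} {δ γ Q : ℝ} (J : IsSolutionJet e Ω Ω' u P W T S c)
    (hE : EllipticBounds e (closure Ω') R) (hC : 1 ≤ C) (hcC : c ≤ C)
    (hq : IsAdaptedMetric Ω Ω' f f' δ γ Q q) (hx : x ∈ closure Ω) (v : E) :
    ‖fderiv ℝ q (x, P x) (v, W x v)‖ ≤ Q * C * ‖v‖ := by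
  have h1 := (fderiv ℝ q (x, P x)).le_of_opNorm_le (hq.bound' x hx _ (J.mapsTo_closure hx))
    (v, W x v)
  have h2 := J.norm_graph_le hE hC hcC hx v
  have hQ := one_pos.trans_le hq.one_le
  calc _ ≤ Q * ‖(v, W x v)‖ := h1
    _ ≤ Q * (C * ‖v‖) := by gcongr
    _ = _ := by ring

/-- By symmetry of `D³u`, the sum `Y` satisfies `‖Y‖² = lorentzTrace e (P x) (T x Y)`, and the
equation differentiated along `Y` bounds this linearly in `‖Y‖`. The bound is needed when `q(x, Du)`
is differentiated twice. -/
lemma norm_trace_third_le (J : IsSolutionJet e Ω Ω' u P W T S c)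
    (hE : EllipticBounds e (closure Ω') R) (hΩ : IsOpen Ω) (hc : 0 ≤ c) (hcC : c ≤ C)
    (hx : x ∈ Ω) :
    ‖∑ i, T x (lorentzFrame e (P x) i) (lorentzFrame e (P x) i)‖ ≤ R * C ^ 2 := by
  set Y := ∑ i, T x (lorentzFrame e (P x) i) (lorentzFrame e (P x) i) with hY
  have hxc := subset_closure hx
  have hC : 0 ≤ C := hc.trans hcC
  have hR := hE.pos
  have h1 : ‖Y‖ ^ 2 = lorentzTrace e (P x) (T x Y) := by
    rw [← real_inner_self_eq_norm_sq, lorentzTrace_apply]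
    conv_lhs => rw [hY]
    rw [sum_inner]
    refine Finset.sum_congr rfl fun i _ => ?_
    rw [J.T_comm x hxc, J.T_comm x hxc Y, J.T_symm x hxc, ← hY, J.T_comm x hxc]
  have h2 := J.equation_deriv hE hΩ hx Y
  have h3 := (abs_le.1 (hE.abs_le' (subset_closure (J.mapsTo x hx)) (W x Y) (W x))).1
  have hW : ‖W x‖ ≤ C :=
    (ContinuousLinearMap.opNorm_le_bound _ hc (J.norm_W_le hE hxc)).trans hcC
  have h4 : ‖W x Y‖ ≤ C * ‖Y‖ := (W x).le_of_opNorm_le hW Y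
  have h5 : R * ‖W x Y‖ * ‖W x‖ ≤ R * (C * ‖Y‖) * C := by gcongr
  rcases (norm_nonneg Y).eq_or_lt with h0 | h0
  · rw [← h0]
    positivity
  · have h6 : ‖Y‖ * ‖Y‖ ≤ R * C ^ 2 * ‖Y‖ := by nlinarith
    exact le_of_mul_le_mul_right h6 h0

lemma norm_third_le (J : IsSolutionJet e Ω Ω' u P W T S c) (hx : x ∈ closure Ω) (ξ : E) :
    ‖T x ξ‖ ≤ ∑ j, ‖T x (e j) ξ‖ := by
  refine ContinuousLinearMap.opNorm_le_bound _ (Finset.sum_nonneg fun j _ => norm_nonneg _)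
    fun y => ?_
  conv_lhs => rw [← e.sum_repr' y]
  rw [map_sum, Finset.sum_mul]
  refine (norm_sum_le _ _).trans (Finset.sum_le_sum fun j _ => ?_)
  rw [map_smul, norm_smul, J.T_comm x hx, mul_comm]
  refine mul_le_mul_of_nonneg_left ?_ (norm_nonneg _)
  have := norm_inner_le_norm (𝕜 := ℝ) (e j) y
  rwa [e.orthonormal.1 j, one_mul] at this

/-- Symmetry of `D⁴u` swaps the contracted indices with `ξ, ξ`, which connects second derivatives of
`⟪W ξ, ξ⟫` with the equation differentiated twice along `ξ`. -/
lemma trace_fourth (J : IsSolutionJet e Ω Ω' u P W T S c) (hx : x ∈ Ω) (ξ : E) :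
    ∑ i, ⟪S x (lorentzFrame e (P x) i) (lorentzFrame e (P x) i) ξ, ξ⟫
      = lorentzTrace e (P x) (S x ξ ξ) := by
  rw [lorentzTrace_apply]
  exact Finset.sum_congr rfl fun i _ => J.S_swap x hx _ _

lemma sum_contactDeriv_le (hlt : ‖P x‖ < 1) (a ξ : E) (A l s : ℝ) :
    ∑ j, ‖contactDeriv P W T q a A l s x (e j) ξ‖ ^ 2
      ≤ ∑ i, ‖contactDeriv P W T q a A l s x (lorentzFrame e (P x) i) ξ‖ ^ 2 := by
  refine sum_basis_le_sum_frame e hlt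
    (q := fun v => ‖contactDeriv P W T q a A l s x v ξ‖ ^ 2) (fun v => sq_nonneg _) fun r v => ?_
  rw [contactDeriv_smul, smul_apply, norm_smul, mul_pow, Real.norm_eq_abs, sq_abs]

lemma one_le_sum_inner_frame {p : E} (hlt : ‖p‖ < 1) {a : E} (ha : ‖a‖ = 1) :
    1 ≤ ∑ i, ⟪a, lorentzFrame e p i⟫ ^ 2 := by
  have h := sum_basis_le_sum_frame e hlt (q := fun v => ⟪a, v⟫ ^ 2) (fun v => sq_nonneg _)
    fun r v => by rw [inner_smul_right]; ring
  refine le_trans (le_of_eq ?_) h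
  have h1 := e.sum_sq_norm_inner_left a
  simp only [Real.norm_eq_abs, sq_abs] at h1
  rw [h1, ha, one_pow]

/-- The fourth order term at an interior contact point. -/
lemma trace_fourth_le {f f' : E → ℝ} {δ γ Q : ℝ} (J : IsSolutionJet e Ω Ω' u P W T S c)
    (hE : EllipticBounds e (closure Ω') R) (hC : 1 ≤ C) (hc : 0 ≤ c) (hcC : c ≤ C)
    (hΩ : IsOpen Ω) (hq : IsAdaptedMetric Ω Ω' f f' δ γ Q q) (hx : x ∈ Ω) {a ξ : E} {A l s : ℝ}
    (ha : ‖a‖ = 1) (hξ : ‖ξ‖ = 1) (hA : 0 ≤ A) (hl : 0 ≤ l) (hs : 0 ≤ s)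
    (hm : 0 ≤ l * (Real.exp (A * ⟪a, x⟫) - s))
    (hWξ : W x ξ = (l * (Real.exp (A * ⟪a, x⟫) - s)) • q (x, P x) ξ)
    (h1 : ∀ v, ⟪contactDeriv P W T q a A l s x v ξ, ξ⟫ = 0) :
    lorentzTrace e (P x) (S x ξ ξ) ≤
      2 / C * ∑ j, ‖contactDeriv P W T q a A l s x (e j) ξ‖ ^ 2
      + l * Real.exp (A * ⟪a, x⟫) * (R * C ^ 2 * Q + R * C * Q * (A + C)
        + Fintype.card ι * (C ^ 2 * R ^ 2 * Q / 2 + 2 * R * C * Q * (A + C))) := by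
  have hxc := subset_closure hx
  have hPc := J.mapsTo_closure hxc
  have hR := hE.pos
  have hQ : 0 < Q := one_pos.trans_le hq.one_le
  have hC0 : 0 < C := one_pos.trans_le hC
  set m := l * (Real.exp (A * ⟪a, x⟫) - s) with hmdef
  set Λ := l * Real.exp (A * ⟪a, x⟫) with hΛ
  have hmΛ : m ≤ Λ := by
    have := mul_nonneg hl hs
    rw [hmdef, hΛ, mul_sub]
    linarith
  have hΛ0 : 0 ≤ Λ := hm.trans hmΛ
  have hG : ‖q (x, P x) ξ‖ ≤ Q := by
    have := (q (x, P x)).le_of_opNorm_le (hq.bound x hxc _ hPc) ξ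
    rwa [hξ, mul_one] at this
  have hWn : ‖W x‖ ≤ C :=
    (ContinuousLinearMap.opNorm_le_bound _ hc (J.norm_W_le hE hxc)).trans hcC
  have hw1 : ‖W x ξ‖ ≤ Λ * Q := by
    rw [hWξ, norm_smul, Real.norm_eq_abs, abs_of_nonneg hm]
    gcongr
  have hw2 : ‖W x ξ‖ ≤ C := by
    have := (W x).le_of_opNorm_le hWn ξ
    rwa [hξ, mul_one] at this
  -- One factor is bounded by `C`, the other by `Λ Q`, since `W ξ = m q ξ`. All errors must be
  -- linear in `Λ` to be beaten by `Λ A²`.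
  have hw3 : ‖W x ξ‖ ^ 2 ≤ C * (Λ * Q) := by
    rw [sq]
    exact mul_le_mul hw2 hw1 (norm_nonneg _) hC0.le
  have hcorr : ∀ v, ‖(l * (A * ⟪a, v⟫ * Real.exp (A * ⟪a, x⟫))) • q (x, P x) ξ
      + m • fderiv ℝ q (x, P x) (v, W x v) ξ‖ ≤ Λ * Q * (A + C) * ‖v‖ := by
    intro v
    have hav : |⟪a, v⟫| ≤ ‖v‖ := by
      have := abs_real_inner_le_norm a v
      rwa [ha, one_mul] at this
    have e1 : |l * (A * ⟪a, v⟫ * Real.exp (A * ⟪a, x⟫))| ≤ Λ * A * ‖v‖ := by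
      have : l * (A * ⟪a, v⟫ * Real.exp (A * ⟪a, x⟫)) = Λ * A * ⟪a, v⟫ := by rw [hΛ]; ring
      rw [this, abs_mul, abs_of_nonneg (mul_nonneg hΛ0 hA)]
      gcongr
    have e2 : ‖fderiv ℝ q (x, P x) (v, W x v) ξ‖ ≤ Q * C * ‖v‖ := by
      have := (fderiv ℝ q (x, P x) (v, W x v)).le_of_opNorm_le
        (J.norm_metric_deriv_le hE hC hcC hq hxc v) ξ
      rwa [hξ, mul_one] at this
    refine (norm_add_le _ _).trans ?_
    rw [norm_smul, norm_smul, Real.norm_eq_abs, Real.norm_eq_abs, abs_of_nonneg hm]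
    calc _ ≤ Λ * A * ‖v‖ * Q + Λ * (Q * C * ‖v‖) := by gcongr
      _ = _ := by ring
  have hTv : ∀ v, T x v ξ = contactDeriv P W T q a A l s x v ξ
      + ((l * (A * ⟪a, v⟫ * Real.exp (A * ⟪a, x⟫))) • q (x, P x) ξ
        + m • fderiv ℝ q (x, P x) (v, W x v) ξ) := by
    intro v
    simp only [contactDeriv, sub_apply, add_apply, smul_apply, hmdef]
    abel
  -- Pairing `T ξ ξ` with itself gives `⟪T (T ξ ξ) ξ, ξ⟫`, in which the first order contact
  -- condition removes all but the terms of order `Λ`.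
  have hTξξ : ‖T x ξ ξ‖ ≤ Λ * Q * (A + C) := by
    have h2 : ⟪T x ξ ξ, T x ξ ξ⟫ ≤ Λ * Q * (A + C) * ‖T x ξ ξ‖ := by
      have h3 : ⟪T x ξ ξ, T x ξ ξ⟫ = ⟪T x (T x ξ ξ) ξ, ξ⟫ := by
        rw [J.T_symm x hxc, J.T_comm x hxc]
      rw [h3]
      conv_lhs => rw [hTv]
      rw [inner_add_left, h1, zero_add]
      refine (real_inner_le_norm _ _).trans ?_
      rw [hξ, mul_one]
      exact hcorr _
    rw [real_inner_self_eq_norm_sq] at h2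
    rcases (norm_nonneg (T x ξ ξ)).eq_or_lt with h0 | h0
    · rw [← h0]
      positivity
    · exact le_of_mul_le_mul_right (by linarith) h0
  have hTξ : ‖T x ξ‖ ≤ ∑ j, (‖contactDeriv P W T q a A l s x (e j) ξ‖ + Λ * Q * (A + C)) := by
    refine (J.norm_third_le hxc ξ).trans (Finset.sum_le_sum fun j _ => ?_)
    rw [hTv]
    refine (norm_add_le _ _).trans (add_le_add le_rfl ?_)
    have := hcorr (e j)
    rwa [e.orthonormal.1 j, mul_one] at this
  -- The factor `T x ξ` is not of order `Λ`. Young's inequality is weighted so that its square has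
  -- exactly the coefficient `2 / C` gained at contact; the other square, `‖W ξ‖²`, is of order `Λ`.
  have hmix : 2 * (R * ‖W x ξ‖ * ‖T x ξ‖) ≤
      2 / C * ∑ j, ‖contactDeriv P W T q a A l s x (e j) ξ‖ ^ 2
      + Λ * (Fintype.card ι * (C ^ 2 * R ^ 2 * Q / 2 + 2 * R * C * Q * (A + C))) := by
    have hj : ∀ X : ℝ, 2 * (R * ‖W x ξ‖ * (X + Λ * Q * (A + C))) ≤ 2 / C * X ^ 2
        + Λ * (C ^ 2 * R ^ 2 * Q / 2 + 2 * R * C * Q * (A + C)) := by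
      intro X
      have e1 : 2 * (R * ‖W x ξ‖ * X) ≤ 2 / C * X ^ 2 + C / 2 * (R ^ 2 * ‖W x ξ‖ ^ 2) := by
        have h0 : 0 ≤ (2 * X - C * R * ‖W x ξ‖) ^ 2 / (2 * C) := by positivity
        have h2 : (2 * X - C * R * ‖W x ξ‖) ^ 2 / (2 * C)
            = 2 / C * X ^ 2 + C / 2 * (R ^ 2 * ‖W x ξ‖ ^ 2) - 2 * (R * ‖W x ξ‖ * X) := by
          field_simp
          ring
        linarith
      have e2 : C / 2 * (R ^ 2 * ‖W x ξ‖ ^ 2) ≤ C / 2 * (R ^ 2 * (C * (Λ * Q))) := by gcongr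
      have e3 : R * ‖W x ξ‖ * (Λ * Q * (A + C)) ≤ R * C * (Λ * Q * (A + C)) := by gcongr
      linarith
    calc 2 * (R * ‖W x ξ‖ * ‖T x ξ‖) ≤ 2 * (R * ‖W x ξ‖ *
          ∑ j, (‖contactDeriv P W T q a A l s x (e j) ξ‖ + Λ * Q * (A + C))) := by gcongr
      _ = ∑ j, 2 * (R * ‖W x ξ‖ *
          (‖contactDeriv P W T q a A l s x (e j) ξ‖ + Λ * Q * (A + C))) := by
        rw [Finset.mul_sum, Finset.mul_sum]
      _ ≤ ∑ j, (2 / C * ‖contactDeriv P W T q a A l s x (e j) ξ‖ ^ 2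
          + Λ * (C ^ 2 * R ^ 2 * Q / 2 + 2 * R * C * Q * (A + C))) :=
        Finset.sum_le_sum fun j _ => hj _
      _ = _ := by
        rw [Finset.sum_add_distrib, ← Finset.mul_sum]
        simp
        ring
  have heq := J.equation_deriv_deriv hE hΩ hx ξ
  have b1 := (abs_le.1 (hE.abs_le'' hPc (W x ξ) (W x ξ) (W x))).1
  have b2 := (abs_le.1 (hE.abs_le' hPc (T x ξ ξ) (W x))).1
  have b3 := (abs_le.1 (hE.abs_le' hPc (W x ξ) (T x ξ))).1
  have c1 : R * ‖W x ξ‖ * ‖W x ξ‖ * ‖W x‖ ≤ R * (C * (Λ * Q)) * C := by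
    have : R * ‖W x ξ‖ * ‖W x ξ‖ * ‖W x‖ = R * ‖W x ξ‖ ^ 2 * ‖W x‖ := by ring
    rw [this]
    gcongr
  have c2 : R * ‖T x ξ ξ‖ * ‖W x‖ ≤ R * (Λ * Q * (A + C)) * C := by gcongr
  linarith

/-- There is no interior contact point if `A` is large. -/
lemma not_interior_contact {f f' : E → ℝ} {δ γ Q : ℝ} (J : IsSolutionJet e Ω Ω' u P W T S c)
    (hE : EllipticBounds e (closure Ω') R) (hC : 1 ≤ C) (hc : 0 ≤ c) (hcC : c ≤ C)
    (hΩ : IsOpen Ω) (hq : IsAdaptedMetric Ω Ω' f f' δ γ Q q) (hx : x ∈ Ω) {a ξ : E} {A l s : ℝ}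
    (ha : ‖a‖ = 1) (hξ : ‖ξ‖ = 1) (hA : 0 ≤ A) (hl : 0 < l) (hs : 0 ≤ s)
    (hM : ∀ y ∈ Ω, ∀ η, l * (Real.exp (A * ⟪a, y⟫) - s) * ⟪q (y, P y) η, η⟫ ≤ ⟪W y η, η⟫)
    (heq : l * (Real.exp (A * ⟪a, x⟫) - s) * ⟪q (x, P x) ξ, ξ⟫ = ⟪W x ξ, ξ⟫)
    (hlarge : R * C ^ 2 * Q + R * C * Q * (A + C)
        + Fintype.card ι * (C ^ 2 * R ^ 2 * Q / 2 + 2 * R * C * Q * (A + C))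
        + (Fintype.card (Option ι) * (2 * A * Q * C * R ^ 2 + Q * C ^ 2 * R ^ 2) + Q * R * C ^ 2)
        < γ * A ^ 2) : False := by
  have hxc := subset_closure hx
  have hPc := J.mapsTo_closure hxc
  have hlt := hE.norm_lt _ hPc
  have hR := hE.pos
  have hQ : 0 < Q := one_pos.trans_le hq.one_le
  have hC0 : 0 < C := one_pos.trans_le hC
  have hγ : γ ≤ ⟪q (x, P x) ξ, ξ⟫ := by
    have := hq.coercive x hxc _ hPc ξ
    rwa [hξ, one_pow, mul_one] at this
  have hg0 : 0 < ⟪q (x, P x) ξ, ξ⟫ := hq.pos.trans_le hγ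
  have hm : 0 ≤ l * (Real.exp (A * ⟪a, x⟫) - s) := by
    have h0 := (J.isSymmNonneg x hxc).nonneg ξ
    rw [← heq] at h0
    exact nonneg_of_mul_nonneg_left h0 hg0
  have hWξ : W x ξ = (l * (Real.exp (A * ⟪a, x⟫) - s)) • q (x, P x) ξ := by
    have hpsd : IsSymmNonneg (W x - (l * (Real.exp (A * ⟪a, x⟫) - s)) • q (x, P x)) := by
      refine ⟨fun y z => ?_, fun y => ?_⟩
      · simp only [sub_apply, smul_apply, inner_sub_left, inner_sub_right, inner_smul_left,
          inner_smul_right, conj_trivial, hq.symm, (J.isSymmNonneg x hxc).symm]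
      · have := hM x hx y
        simp only [sub_apply, smul_apply, inner_sub_left, inner_smul_left, conj_trivial]
        linarith
    have h0 := hpsd.apply_eq_zero (x := ξ) (by
      simp only [sub_apply, smul_apply, inner_sub_left, inner_smul_left, conj_trivial]
      linarith)
    exact sub_eq_zero.1 h0
  have hcd := J.contact_derivatives hE hC0 hcC hΩ hq hx hm hM heq
  have hfour := J.trace_fourth_le hE hC hc hcC hΩ hq hx ha hξ hA hl.le hs hm hWξ
    fun v => (hcd v).1
  set m := l * (Real.exp (A * ⟪a, x⟫) - s) with hmdef
  set Λ := l * Real.exp (A * ⟪a, x⟫) with hΛ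
  have hmΛ : m ≤ Λ := by
    have := mul_nonneg hl.le hs
    rw [hmdef, hΛ, mul_sub]
    linarith
  have hΛ0 : 0 < Λ := mul_pos hl (Real.exp_pos _)
  set v := lorentzFrame e (P x) with hv
  have hvR : ∀ i, ‖v i‖ ≤ R := fun i => hE.frame _ hPc i
  have hper : ∀ i, 2 / C * ‖contactDeriv P W T q a A l s x (v i) ξ‖ ^ 2
      ≤ ⟪S x (v i) (v i) ξ, ξ⟫ - Λ * A ^ 2 * ⟪q (x, P x) ξ, ξ⟫ * ⟪a, v i⟫ ^ 2
        - m * ⟪fderiv ℝ q (x, P x) (0, T x (v i) (v i)) ξ, ξ⟫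
        + Λ * (2 * A * Q * C * R ^ 2 + Q * C ^ 2 * R ^ 2) := by
    intro i
    refine (hcd (v i)).2.trans ?_
    have hav : |⟪a, v i⟫| ≤ R := by
      have := abs_real_inner_le_norm a (v i)
      rw [ha, one_mul] at this
      exact this.trans (hvR i)
    have hop : ∀ (B : E →L[ℝ] E) (b : ℝ), ‖B‖ ≤ b → |⟪B ξ, ξ⟫| ≤ b := by
      intro B b hB
      have h2 := abs_real_inner_le_norm (B ξ) ξ
      have h3 := B.le_of_opNorm_le hB ξ
      rw [hξ, mul_one] at h2 h3
      exact h2.trans h3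
    have e1 : |⟪fderiv ℝ q (x, P x) (v i, W x (v i)) ξ, ξ⟫| ≤ Q * C * R := by
      refine hop _ _ ((J.norm_metric_deriv_le hE hC hcC hq hxc (v i)).trans ?_)
      have := hvR i
      gcongr
    have e2 : |⟪fderiv ℝ (fderiv ℝ q) (x, P x) (v i, W x (v i)) (v i, W x (v i)) ξ, ξ⟫|
        ≤ Q * (C * R) * (C * R) := by
      have hg := (J.norm_graph_le hE hC hcC hxc (v i)).trans
        (mul_le_mul_of_nonneg_left (hvR i) hC0.le)
      refine hop _ _ ?_
      refine ((fderiv ℝ (fderiv ℝ q) (x, P x) (v i, W x (v i))).le_of_opNorm_le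
        ((fderiv ℝ (fderiv ℝ q) (x, P x)).le_of_opNorm_le (hq.bound'' x hxc _ hPc) _) _).trans ?_
      gcongr
    have e3 : |⟪a, v i⟫ * ⟪fderiv ℝ q (x, P x) (v i, W x (v i)) ξ, ξ⟫| ≤ R * (Q * C * R) := by
      rw [abs_mul]
      gcongr
    have e4 := mul_le_mul_of_nonneg_left (neg_le_of_abs_le e3)
      (by positivity : 0 ≤ 2 * (Λ * A))
    have e5 := mul_le_mul_of_nonneg_left (neg_le_of_abs_le e2) hm
    have e6 : m * (Q * (C * R) * (C * R)) ≤ Λ * (Q * (C * R) * (C * R)) := by gcongr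
    have e7 : l * (A * ⟪a, v i⟫ * (A * ⟪a, v i⟫ * Real.exp (A * ⟪a, x⟫)))
        = Λ * A ^ 2 * ⟪a, v i⟫ ^ 2 := by rw [hΛ]; ring
    have e8 : l * (A * ⟪a, v i⟫ * Real.exp (A * ⟪a, x⟫)) = Λ * A * ⟪a, v i⟫ := by rw [hΛ]; ring
    rw [e7, e8]
    linarith
  have hsum := Finset.sum_le_sum fun i (_ : i ∈ Finset.univ) => hper i
  rw [← Finset.mul_sum, Finset.sum_add_distrib, Finset.sum_sub_distrib, Finset.sum_sub_distrib,
    ← Finset.mul_sum, ← Finset.mul_sum, J.trace_fourth hx, Finset.sum_const, Finset.card_univ,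
    nsmul_eq_mul] at hsum
  have hω : |∑ i, ⟪fderiv ℝ q (x, P x) (0, T x (v i) (v i)) ξ, ξ⟫| ≤ Q * (R * C ^ 2) := by
    have h2 : ∑ i, ⟪fderiv ℝ q (x, P x) (0, T x (v i) (v i)) ξ, ξ⟫
        = ⟪fderiv ℝ q (x, P x) (0, ∑ i, T x (v i) (v i)) ξ, ξ⟫ := by
      have h3 : ((0 : E), ∑ i, T x (v i) (v i)) = ∑ i, ((0 : E), T x (v i) (v i)) := by
        rw [Prod.ext_iff]
        simp [Prod.fst_sum, Prod.snd_sum]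
      rw [h3, map_sum, sum_apply, sum_inner]
    rw [h2]
    have h4 := (fderiv ℝ q (x, P x)).le_of_opNorm_le (hq.bound' x hxc _ hPc)
      (0, ∑ i, T x (v i) (v i))
    rw [Prod.norm_mk, norm_zero, max_eq_right (norm_nonneg _)] at h4
    have h5 := h4.trans (mul_le_mul_of_nonneg_left
      (J.norm_trace_third_le hE hΩ hc hcC hx) hQ.le)
    have h6 := (fderiv ℝ q (x, P x) (0, ∑ i, T x (v i) (v i))).le_of_opNorm_le h5 ξ
    have h7 := abs_real_inner_le_norm
      (fderiv ℝ q (x, P x) (0, ∑ i, T x (v i) (v i)) ξ) ξ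
    rw [hξ, mul_one] at h6 h7
    exact h7.trans h6
  have hω' := mul_le_mul_of_nonneg_left (neg_le_of_abs_le hω) hm
  have hω'' : m * (Q * (R * C ^ 2)) ≤ Λ * (Q * (R * C ^ 2)) := by gcongr
  -- The decisive term of order `A²`: the frame sees the unit vector `a` with total weight at least
  -- `1`.
  have hβ : Λ * A ^ 2 * γ ≤ Λ * A ^ 2 * ⟪q (x, P x) ξ, ξ⟫ * ∑ i, ⟪a, v i⟫ ^ 2 := by
    have h2 := one_le_sum_inner_frame (e := e) hlt ha
    calc Λ * A ^ 2 * γ ≤ Λ * A ^ 2 * ⟪q (x, P x) ξ, ξ⟫ * 1 := by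
          rw [mul_one]
          gcongr
      _ ≤ _ := by gcongr
  -- The squares gained along the frame dominate those spent along the basis, so they cancel; what
  -- remains contradicts `hlarge`.
  have hX := mul_le_mul_of_nonneg_left (sum_contactDeriv_le (W := W) (T := T) (q := q) (e := e)
    hlt a ξ A l s) (by positivity : 0 ≤ 2 / C)
  have hfin := mul_lt_mul_of_pos_left hlarge hΛ0
  linarith

end IsSolutionJet

end InteriorContact

/-! ### Excluding boundary contact points, and the uniform Hessian bounds -/

section BoundaryContact

variable {E : Type*} [NormedAddCommGroup E] [InnerProductSpace ℝ E] [FiniteDimensional ℝ E]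
variable {ι : Type*} [Fintype ι]

namespace IsSolutionJet

variable {e : OrthonormalBasis ι ℝ E} {Ω Ω' : Set E} {u : E → ℝ} {P : E → E}
  {W : E → E →L[ℝ] E} {T : E → E →L[ℝ] E →L[ℝ] E} {S : E → E →L[ℝ] E →L[ℝ] E →L[ℝ] E}
  {c R C : ℝ} {x : E} {q : E × E → E →L[ℝ] E}

/-- At a boundary contact point the inward derivative in an interior direction is nonnegative. -/
lemma contactDeriv_nonneg (J : IsSolutionJet e Ω Ω' u P W T S c) (hq : ContDiff ℝ ∞ q)
    (hx : x ∈ closure Ω) {a b ξ : E} {A l s : ℝ} (hb : b ∈ posTangentConeAt (closure Ω) x)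
    (hM : ∀ y ∈ closure Ω,
      l * (Real.exp (A * ⟪a, y⟫) - s) * ⟪q (y, P y) ξ, ξ⟫ ≤ ⟪W y ξ, ξ⟫)
    (heq : l * (Real.exp (A * ⟪a, x⟫) - s) * ⟪q (x, P x) ξ, ξ⟫ = ⟪W x ξ, ξ⟫) :
    0 ≤ ⟪contactDeriv P W T q a A l s x b ξ, ξ⟫ := by
  have hg : HasFDerivWithinAt (fun y => (y, P y)) ((ContinuousLinearMap.id ℝ E).prod (W x))
      (closure Ω) x := (hasFDerivWithinAt_id x _).prodMk (J.hasFDerivWithinAt_P x hx)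
  have hqd : HasFDerivWithinAt (fun y => q (y, P y)) _ (closure Ω) x :=
    ((hq.differentiable (by simp)) (x, P x)).hasFDerivAt.comp_hasFDerivWithinAt x hg
  have hm : HasFDerivAt (fun y => l * (Real.exp (A * ⟪a, y⟫) - s)) _ x :=
    ((((innerSL ℝ a).hasFDerivAt (x := x)).const_mul A).exp.sub_const s).const_mul l
  have hξ := hasFDerivWithinAt_const (𝕜 := ℝ) ξ x (closure Ω)
  have hMd := ((((J.hasFDerivWithinAt_W x hx).sub
    (hm.hasFDerivWithinAt.smul hqd)).clm_apply hξ).inner ℝ hξ)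
  have hmin : IsLocalMinOn (fun y => ⟪(W y
      - (l * (Real.exp (A * ⟪a, y⟫) - s)) • q (y, P y)) ξ, ξ⟫) (closure Ω) x := by
    filter_upwards [self_mem_nhdsWithin] with y hy
    have := hM y hy
    simp only [sub_apply, smul_apply, inner_sub_left, inner_smul_left, conj_trivial]
    linarith
  have := hmin.hasFDerivWithinAt_nonneg hMd hb
  refine this.trans_eq ?_
  simp [contactDeriv, inner_sub_left, inner_add_left, inner_smul_left]
  ring

/-- There is no boundary contact point if `l` is small. -/
lemma not_boundary_contact {f f' : E → ℝ} {ε δ γ Q K B Θ k : ℝ}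
    (J : IsSolutionJet e Ω Ω' u P W T S c)
    (hE : EllipticBounds e (closure Ω') R) (hC : 1 ≤ C) (hcC : c ≤ C)
    (hΩ : IsOpen Ω) (hconv : Convex ℝ Ω) (hf : IsDefiningFunction Ω f ε)
    (hq : IsAdaptedMetric Ω Ω' f f' δ γ Q q) (hδ : 0 < δ) (hK0 : 0 ≤ K)
    (hK : ∀ p ∈ frontier Ω', ∀ q ∈ frontier Ω', ⟪∇ f' p, q - p⟫ ≤ K * ‖q - p‖ ^ 2)
    (hB : ‖∇ f' (P x)‖ ≤ B)
    (hx : x ∈ frontier Ω) (hobl : δ ≤ ⟪∇ f x, ∇ f' (P x)⟫) (hk : δ ≤ k)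
    (hWk : W x (∇ f' (P x)) = k • ∇ f x) {a ξ : E} {A l s : ℝ}
    (ha : ‖a‖ = 1) (hξ : ‖ξ‖ = 1) (hA : 0 ≤ A) (hl : 0 < l) (hs : 0 ≤ s)
    (hΘ : Real.exp (A * ⟪a, x⟫) ≤ Θ)
    (hM : ∀ y ∈ closure Ω, ∀ η,
      l * (Real.exp (A * ⟪a, y⟫) - s) * ⟪q (y, P y) η, η⟫ ≤ ⟪W y η, η⟫)
    (heq : l * (Real.exp (A * ⟪a, x⟫) - s) * ⟪q (x, P x) ξ, ξ⟫ = ⟪W x ξ, ξ⟫)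
    (hsmall₁ : l * Θ * (Q * B ^ 2) < δ ^ 2)
    (hsmall₂ : l * Θ * (1 / 2 * (Q * (A + C) * B) + K * C * Q) < δ * ε) : False := by
  have hxc := frontier_subset_closure hx
  have hPc := J.mapsTo_closure hxc
  have hQ : 0 < Q := one_pos.trans_le hq.one_le
  have hC0 : 0 < C := one_pos.trans_le hC
  have hB0 : 0 ≤ B := (norm_nonneg _).trans hB
  have hγ : γ ≤ ⟪q (x, P x) ξ, ξ⟫ := by
    have := hq.coercive x hxc _ hPc ξ
    rwa [hξ, one_pow, mul_one] at this
  have hg0 : 0 < ⟪q (x, P x) ξ, ξ⟫ := hq.pos.trans_le hγ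
  have hm : 0 ≤ l * (Real.exp (A * ⟪a, x⟫) - s) := by
    have h0 := (J.isSymmNonneg x hxc).nonneg ξ
    rw [← heq] at h0
    exact nonneg_of_mul_nonneg_left h0 hg0
  have hpsd : IsSymmNonneg (W x - (l * (Real.exp (A * ⟪a, x⟫) - s)) • q (x, P x)) := by
    refine ⟨fun y z => ?_, fun y => ?_⟩
    · simp only [sub_apply, smul_apply, inner_sub_left, inner_sub_right, inner_smul_left,
        inner_smul_right, conj_trivial, hq.symm, (J.isSymmNonneg x hxc).symm]
    · have := hM x hxc y
      simp only [sub_apply, smul_apply, inner_sub_left, inner_smul_left, conj_trivial]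
      linarith
  have hMξ := hpsd.apply_eq_zero (x := ξ) (by
    simp only [sub_apply, smul_apply, inner_sub_left, inner_smul_left, conj_trivial]
    linarith)
  set m := l * (Real.exp (A * ⟪a, x⟫) - s) with hmdef
  set Λ := l * Θ with hΛ
  have hexpΛ : l * Real.exp (A * ⟪a, x⟫) ≤ Λ := by rw [hΛ]; gcongr
  have hmΛ : m ≤ Λ := by
    have := mul_nonneg hl.le hs
    rw [hmdef, mul_sub]
    linarith
  have hΛ0 : 0 ≤ Λ := hm.trans hmΛ
  set b := ∇ f' (P x) with hb
  set N := ∇ f x with hN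
  have hGop : ∀ v, ‖q (x, P x) v‖ ≤ Q * ‖v‖ := fun v =>
    (q (x, P x)).le_of_opNorm_le (hq.bound x hxc _ hPc) v
  -- Here `⟪W b, b⟫ = k ⟪N, b⟫ ≥ δ²`, while smallness of `l` keeps the subtracted part below `δ²`.
  have hMbb : 0 < ⟪(W x - m • q (x, P x)) b, b⟫ := by
    have h1 : ⟪q (x, P x) b, b⟫ ≤ Q * B ^ 2 := by
      refine (real_inner_le_norm _ _).trans ?_
      calc ‖q (x, P x) b‖ * ‖b‖ ≤ (Q * B) * B := by
            gcongr
            exact (hGop b).trans (by gcongr)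
        _ = _ := by ring
    have h2 : m * ⟪q (x, P x) b, b⟫ ≤ Λ * (Q * B ^ 2) :=
      (mul_le_mul_of_nonneg_left h1 hm).trans (by gcongr)
    have h3 : δ ^ 2 ≤ k * ⟪N, b⟫ := by
      rw [sq]
      exact mul_le_mul hk hobl hδ.le (hδ.le.trans hk)
    simp only [sub_apply, smul_apply, inner_sub_left, inner_smul_left, conj_trivial, hWk]
    linarith
  have hNb : 0 < ⟪N, b⟫ := hδ.trans_le hobl
  -- Let `M = W - m q` and write `ξ` as a tangential vector plus `r b`. Both `W b = k N` and `q b`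
  -- are orthogonal to the tangential part, so `M ξ = 0` forces `r ⟪M b, b⟫ = 0`, hence `r = 0`.
  have htan : ⟪N, ξ⟫ = 0 := by
    set r := ⟪N, ξ⟫ / ⟪N, b⟫ with hr
    have hτ : ⟪N, ξ - r • b⟫ = 0 := by
      rw [inner_sub_right, inner_smul_right, hr, div_mul_cancel₀ _ hNb.ne', sub_self]
    have h1 : ⟪(W x - m • q (x, P x)) b, ξ - r • b⟫ = 0 := by
      have h0 : ⟪q (x, P x) b, ξ - r • b⟫ = 0 := hq.orthogonal x (P x) hobl _ hτ
      simp only [sub_apply, smul_apply, inner_sub_left, inner_smul_left, conj_trivial, hWk, hτ,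
        mul_zero]
      rw [h0]
      ring
    have h2 : ⟪(W x - m • q (x, P x)) b, ξ⟫ = 0 := by
      rw [hpsd.symm, hMξ, inner_zero_right]
    rw [inner_sub_right, h2, inner_smul_right, zero_sub, neg_eq_zero] at h1
    rcases mul_eq_zero.1 h1 with h3 | h3
    · rw [hr, div_eq_zero_iff] at h3
      exact h3.resolve_right hNb.ne'
    · exact absurd h3 hMbb.ne'
  have hN0 : N ≠ 0 := by
    intro h0
    rw [h0, inner_zero_left] at hNb
    exact lt_irrefl _ hNb
  -- Two estimates of `⟪T b ξ, ξ⟫` collide: the geometry puts half of it below `-k ε` up to an error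
  -- of order `Λ`, whereas contact with the barrier along the inward direction `b` puts it above
  -- `-O(Λ)`.
  have hthird := J.inner_third_le hf hΩ hconv hK hx hN0 htan (hδ.le.trans hk) hWk
  have hderiv := J.contactDeriv_nonneg hq.contDiff hxc (hf.mem_posTangentConeAt hx hNb)
    (fun y hy => hM y hy ξ) heq
  have hTb : ⟪b, T x ξ ξ⟫ = ⟪T x b ξ, ξ⟫ := by
    rw [real_inner_comm, J.T_symm x hxc, J.T_comm x hxc]
  have hWξ : ‖W x ξ‖ ^ 2 ≤ C * (Λ * Q) := by
    have h1 := (J.isSymmNonneg x hxc).norm_sq_le (R := C) (fun z =>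
      (J.norm_W_le hE hxc z).trans (mul_le_mul_of_nonneg_right hcC (norm_nonneg z))) ξ
    rw [← heq] at h1
    have h2 : ⟪q (x, P x) ξ, ξ⟫ ≤ Q := by
      have h3 := real_inner_le_norm (q (x, P x) ξ) ξ
      have h4 := hGop ξ
      rw [hξ, mul_one] at h3 h4
      exact h3.trans h4
    refine h1.trans (mul_le_mul_of_nonneg_left ?_ hC0.le)
    exact mul_le_mul hmΛ h2 hg0.le hΛ0
  have hcorr : -(Λ * (Q * (A + C) * B)) ≤ l * (A * ⟪a, b⟫ * Real.exp (A * ⟪a, x⟫))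
      * ⟪q (x, P x) ξ, ξ⟫ + m * ⟪fderiv ℝ q (x, P x) (b, W x b) ξ, ξ⟫ := by
    have hav : |⟪a, b⟫| ≤ B := by
      have := abs_real_inner_le_norm a b
      rw [ha, one_mul] at this
      exact this.trans hB
    have h1 : |⟪q (x, P x) ξ, ξ⟫| ≤ Q := by
      have h3 := abs_real_inner_le_norm (q (x, P x) ξ) ξ
      have h4 := hGop ξ
      rw [hξ, mul_one] at h3 h4
      exact h3.trans h4
    have h2 : |⟪fderiv ℝ q (x, P x) (b, W x b) ξ, ξ⟫| ≤ Q * C * B := by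
      have h3 := abs_real_inner_le_norm (fderiv ℝ q (x, P x) (b, W x b) ξ) ξ
      have h4 := (fderiv ℝ q (x, P x) (b, W x b)).le_of_opNorm_le
        (J.norm_metric_deriv_le hE hC hcC hq hxc b) ξ
      rw [hξ, mul_one] at h3 h4
      exact (h3.trans h4).trans (by gcongr)
    have e0 : |⟪a, b⟫ * ⟪q (x, P x) ξ, ξ⟫| ≤ B * Q := by
      rw [abs_mul]
      gcongr
    have e1 := mul_le_mul_of_nonneg_left (neg_le_of_abs_le e0)
      (mul_nonneg (mul_nonneg hl.le (Real.exp_pos (A * ⟪a, x⟫)).le) hA)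
    have e2 := mul_le_mul_of_nonneg_left (neg_le_of_abs_le h2) hm
    have e3 : m * (Q * C * B) ≤ Λ * (Q * C * B) := by gcongr
    have e4 : l * Real.exp (A * ⟪a, x⟫) * A * (B * Q) ≤ Λ * A * (B * Q) := by gcongr
    linarith
  simp only [contactDeriv, sub_apply, add_apply, smul_apply, inner_sub_left, inner_add_left,
    inner_smul_left, conj_trivial] at hderiv
  rw [hTb, hξ] at hthird
  have hKW := mul_le_mul_of_nonneg_left hWξ hK0
  have hkε : δ * ε ≤ k * ε := mul_le_mul_of_nonneg_right hk hf.pos.le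
  linarith

/-- Two sided bounds for the Hessian up to the boundary, uniform over all solutions. -/
theorem exists_hessian_bounds [Nontrivial E] (e : OrthonormalBasis ι ℝ E) {Ω Ω' : Set E}
    {f f' : E → ℝ} {ε ε' : ℝ} (hΩ : IsOpen Ω) (hconv : Convex ℝ Ω)
    (hbdd : Bornology.IsBounded Ω) (hne : Ω.Nonempty) (hΩ' : IsOpen Ω') (hconv' : Convex ℝ Ω')
    (hbdd' : Bornology.IsBounded Ω') (hne' : Ω'.Nonempty) (hball : closure Ω' ⊆ Metric.ball 0 1)
    (hf : IsDefiningFunction Ω f ε) (hf' : IsDefiningFunction Ω' f' ε') :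
    ∃ D : ℝ, 0 < D ∧ ∀ {u P W T S c}, IsSolutionJet e Ω Ω' u P W T S c → ∀ x ∈ closure Ω, ∀ ξ,
      1 / D * ‖ξ‖ ^ 2 ≤ ⟪W x ξ, ξ⟫ ∧ ⟪W x ξ, ξ⟫ ≤ D * ‖ξ‖ ^ 2 := by
  have hcomp : IsCompact (closure Ω) :=
    Metric.isCompact_of_isClosed_isBounded isClosed_closure hbdd.closure
  have hcomp' : IsCompact (closure Ω') :=
    Metric.isCompact_of_isClosed_isBounded isClosed_closure hbdd'.closure
  obtain ⟨R, hE⟩ := exists_ellipticBounds e hcomp' hball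
  obtain ⟨C, hC, hcC⟩ := exists_bounds_const hE hΩ hconv hbdd hne hΩ' hne'
  obtain ⟨δ, hδ, hobl⟩ := exists_oblique hE hf hf' hΩ hbdd hne hC
  obtain ⟨γ, Q, q, hq⟩ := exists_isAdaptedMetric hf hf' hbdd hbdd' hδ
  obtain ⟨K, hK0, hK⟩ := hf'.exists_le_of_frontier hconv' hbdd'
  obtain ⟨B, hB0, hB⟩ := hcomp'.exists_norm_le hf'.contDiff_gradient.continuous.continuousOn 0
  obtain ⟨D, hD0, hD⟩ := hcomp.exists_norm_le (f := fun x : E => x) continuousOn_id 0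
  obtain ⟨a, ha⟩ := exists_norm_eq E zero_le_one
  have hR := hE.pos
  have hQ : 0 < Q := one_pos.trans_le hq.one_le
  have hC0 : 0 < C := one_pos.trans_le hC
  have hγ := hq.pos
  have hε := hf.pos
  obtain ⟨A, hA, hlarge⟩ : ∃ A : ℝ, 0 ≤ A ∧ R * C ^ 2 * Q + R * C * Q * (A + C)
        + Fintype.card ι * (C ^ 2 * R ^ 2 * Q / 2 + 2 * R * C * Q * (A + C))
        + (Fintype.card (Option ι) * (2 * A * Q * C * R ^ 2 + Q * C ^ 2 * R ^ 2) + Q * R * C ^ 2)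
        < γ * A ^ 2 := by
    -- The left side is `X + Y A`, affine in `A`; the choice below makes `γ A = X + Y + γ` and `A ≥
    -- 1`.
    obtain ⟨X, hX⟩ : ∃ X : ℝ, X = R * C ^ 2 * Q + R * C * Q * C
        + Fintype.card ι * (C ^ 2 * R ^ 2 * Q / 2 + 2 * R * C * Q * C)
        + (Fintype.card (Option ι) * (Q * C ^ 2 * R ^ 2) + Q * R * C ^ 2) := ⟨_, rfl⟩
    obtain ⟨Y, hY⟩ : ∃ Y : ℝ, Y = R * C * Q + Fintype.card ι * (2 * R * C * Q)
        + Fintype.card (Option ι) * (2 * Q * C * R ^ 2) := ⟨_, rfl⟩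
    have hX0 : 0 ≤ X := by rw [hX]; positivity
    have hY0 : 0 ≤ Y := by rw [hY]; positivity
    refine ⟨(X + Y) / γ + 1, by positivity, ?_⟩
    set A := (X + Y) / γ + 1 with hA
    have h1 : 1 ≤ A := by
      rw [hA]
      have : 0 ≤ (X + Y) / γ := by positivity
      linarith
    have h2 : γ * A = X + Y + γ := by
      rw [hA]
      field_simp
    have h3 : γ * A ^ 2 = X * A + Y * A + γ * A := by
      linear_combination A * h2
    have h4 : X ≤ X * A := le_mul_of_one_le_right hX0 h1
    have h5 : 0 < γ * A := by positivity
    rw [h3]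
    calc _ = X + Y * A := by rw [hX, hY]; ring
      _ < _ := by linarith
  set Θ := Real.exp (A * D) with hΘ
  have hΘ0 : 0 < Θ := Real.exp_pos _
  have hinner : ∀ x ∈ closure Ω, |A * ⟪a, x⟫| ≤ A * D := by
    intro x hx
    rw [abs_mul, abs_of_nonneg hA]
    have := abs_real_inner_le_norm a x
    rw [ha, one_mul] at this
    exact mul_le_mul_of_nonneg_left (this.trans (hD x hx)) hA
  set X := 1 / 2 * (Q * (A + C) * B) + K * C * Q with hX
  have hX0 : 0 ≤ X := by positivity
  -- `l` comes after `A`, because `Θ` bounds `exp (A ⟪a, x⟫)`. Neither depends on the solution.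
  obtain ⟨l, hl, hl1, hl2⟩ : ∃ l : ℝ, 0 < l ∧ l * Θ * (Q * B ^ 2) < δ ^ 2 ∧
      l * Θ * X < δ * ε := by
    refine ⟨min (δ ^ 2 / (Θ * (Q * B ^ 2) + 1)) (δ * ε / (Θ * X + 1)), ?_, ?_, ?_⟩
    · positivity
    · have h1 : min (δ ^ 2 / (Θ * (Q * B ^ 2) + 1)) (δ * ε / (Θ * X + 1)) * (Θ * (Q * B ^ 2))
          ≤ δ ^ 2 / (Θ * (Q * B ^ 2) + 1) * (Θ * (Q * B ^ 2)) := by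
        gcongr
        exact min_le_left _ _
      rw [mul_assoc]
      refine h1.trans_lt ?_
      rw [div_mul_eq_mul_div, div_lt_iff₀ (by positivity)]
      nlinarith [sq_pos_of_pos hδ]
    · have h1 : min (δ ^ 2 / (Θ * (Q * B ^ 2) + 1)) (δ * ε / (Θ * X + 1)) * (Θ * X)
          ≤ δ * ε / (Θ * X + 1) * (Θ * X) := by
        gcongr
        exact min_le_right _ _
      rw [mul_assoc]
      refine h1.trans_lt ?_
      rw [div_mul_eq_mul_div, div_lt_iff₀ (by positivity)]
      nlinarith [mul_pos hδ hε]
  set L := l * Real.exp (-(A * D)) * γ with hL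
  have hL0 : 0 < L := by positivity
  refine ⟨max C (1 / L), lt_max_of_lt_left hC0, fun {u P W T S c} J x hx ξ => ?_⟩
  obtain ⟨hc1, hc2⟩ := hcC J
  have hc0 : 0 ≤ c := le_trans (by positivity) hc1
  constructor
  swap
  · have h1 := real_inner_le_norm (W x ξ) ξ
    have h2 := (J.norm_W_le hE hx ξ).trans (mul_le_mul_of_nonneg_right
      (hc2.trans (le_max_left C (1 / L))) (norm_nonneg ξ))
    have h3 := mul_le_mul_of_nonneg_right h2 (norm_nonneg ξ)
    calc _ ≤ _ := h1.trans h3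
      _ = _ := by ring
  have hqpos : ∀ x ∈ closure Ω, ∀ ξ : E, ‖ξ‖ = 1 → γ ≤ ⟪q (x, P x) ξ, ξ⟫ := by
    intro x hx ξ hξ
    have := hq.coercive x hx _ (J.mapsTo_closure hx) ξ
    rwa [hξ, one_pow, mul_one] at this
  -- The maximum `s` of `F` is the least constant for which the comparison holds on all unit
  -- vectors, and a maximum point is a contact point.
  set F : E × E → ℝ := fun z => Real.exp (A * ⟪a, z.1⟫)
    - ⟪W z.1 z.2, z.2⟫ / (l * ⟪q (z.1, P z.1) z.2, z.2⟫) with hF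
  have hFc : ContinuousOn F (closure Ω ×ˢ Metric.sphere (0 : E) 1) := by
    have hW : ContinuousOn (fun z : E × E => W z.1) (closure Ω ×ˢ Metric.sphere (0 : E) 1) :=
      J.continuousOn_W.comp continuousOn_fst fun z hz => hz.1
    have hP : ContinuousOn (fun z : E × E => P z.1) (closure Ω ×ˢ Metric.sphere (0 : E) 1) :=
      J.continuousOn_P.comp continuousOn_fst fun z hz => hz.1
    have hqP : ContinuousOn (fun z : E × E => q (z.1, P z.1))
        (closure Ω ×ˢ Metric.sphere (0 : E) 1) :=
      hq.contDiff.continuous.comp_continuousOn (continuousOn_fst.prodMk hP)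
    refine ContinuousOn.sub (by fun_prop) (ContinuousOn.div ?_ ?_ fun z hz => ?_)
    · exact (hW.clm_apply continuousOn_snd).inner continuousOn_snd
    · exact continuousOn_const.mul ((hqP.clm_apply continuousOn_snd).inner continuousOn_snd)
    · have := hqpos z.1 hz.1 z.2 (by simpa using hz.2)
      have : 0 < ⟪q (z.1, P z.1) z.2, z.2⟫ := hγ.trans_le this
      positivity
  obtain ⟨⟨x₀, ξ₀⟩, ⟨hx₀, hξ₀⟩, hmax⟩ := (hcomp.prod (isCompact_sphere (0 : E) 1)).exists_isMaxOn
    ⟨(x, a), hx, by simpa using ha⟩ hFc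
  set s := F (x₀, ξ₀) with hs
  have hξ₀ : ‖ξ₀‖ = 1 := by simpa using hξ₀
  have hunit : ∀ y ∈ closure Ω, ∀ η : E, ‖η‖ = 1 →
      l * (Real.exp (A * ⟪a, y⟫) - s) * ⟪q (y, P y) η, η⟫ ≤ ⟪W y η, η⟫ := by
    intro y hy η hη
    have h1 : F (y, η) ≤ s := hmax ⟨hy, by simpa using hη⟩
    have h2 : 0 < l * ⟪q (y, P y) η, η⟫ := mul_pos hl (hγ.trans_le (hqpos y hy η hη))
    have h3 : Real.exp (A * ⟪a, y⟫) - s ≤ ⟪W y η, η⟫ / (l * ⟪q (y, P y) η, η⟫) := by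
      simp only [hF] at h1
      linarith
    rw [le_div_iff₀ h2] at h3
    linarith
  have hscale : ∀ y ∈ closure Ω, ∀ η : E,
      l * (Real.exp (A * ⟪a, y⟫) - s) * ⟪q (y, P y) η, η⟫ ≤ ⟪W y η, η⟫ := by
    intro y hy η
    rcases eq_or_ne η 0 with rfl | hη
    · simp
    · have hn : ‖η‖ ≠ 0 := norm_ne_zero_iff.2 hη
      have h1 := hunit y hy (‖η‖⁻¹ • η) (by rw [norm_smul, norm_inv, norm_norm, inv_mul_cancel₀ hn])
      simp only [map_smul, inner_smul_left, inner_smul_right, conj_trivial] at h1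
      have h2 := mul_le_mul_of_nonneg_left h1 (sq_nonneg ‖η‖)
      have e1 : ∀ z : ℝ, ‖η‖ ^ 2 * (‖η‖⁻¹ * (‖η‖⁻¹ * z)) = z := fun z => by field_simp
      have e2 : ∀ w z : ℝ, ‖η‖ ^ 2 * (w * (‖η‖⁻¹ * (‖η‖⁻¹ * z))) = w * z := fun w z => by
        field_simp
      rwa [e1, e2] at h2
  have heq : l * (Real.exp (A * ⟪a, x₀⟫) - s) * ⟪q (x₀, P x₀) ξ₀, ξ₀⟫ = ⟪W x₀ ξ₀, ξ₀⟫ := by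
    have h2 : 0 < ⟪q (x₀, P x₀) ξ₀, ξ₀⟫ := hγ.trans_le (hqpos x₀ hx₀ ξ₀ hξ₀)
    have h3 : Real.exp (A * ⟪a, x₀⟫) - s = ⟪W x₀ ξ₀, ξ₀⟫ / (l * ⟪q (x₀, P x₀) ξ₀, ξ₀⟫) := by
      simp only [hs, hF]
      ring
    rw [h3]
    field_simp
  -- `s` depends on the solution, but once it is not positive it can be dropped, which leaves only
  -- uniform constants.
  have hs0 : s ≤ 0 := by
    by_contra! hspos
    rcases (closure_eq_self_union_frontier Ω ▸ hx₀ : x₀ ∈ Ω ∪ frontier Ω) with hin | hfr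
    · exact J.not_interior_contact hE hC hc0 hc2 hΩ hq hin ha hξ₀ hA hl hspos.le
        (fun y hy => hscale y (subset_closure hy)) heq hlarge
    · obtain ⟨ho, k, hk, hWk⟩ := hobl J hc1 hc2 x₀ hfr
      exact J.not_boundary_contact hE hC hc2 hΩ hconv hf hq hδ hK0 hK
        (hB _ (J.mapsTo_closure hx₀)) hfr ho hk hWk ha hξ₀ hA hl hspos.le
        (Real.exp_le_exp.2 ((le_abs_self _).trans (hinner x₀ hx₀))) hscale heq hl1 hl2
  have h1 := hscale x hx ξ
  have h2 := hq.coercive x hx _ (J.mapsTo_closure hx) ξ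
  have h3 : Real.exp (-(A * D)) ≤ Real.exp (A * ⟪a, x⟫) - s := by
    have := Real.exp_le_exp.2 (neg_le_of_abs_le (hinner x hx))
    linarith
  have h4 : 1 / max C (1 / L) ≤ L := by
    rw [one_div_le (lt_max_of_lt_left hC0) hL0]
    exact le_max_right _ _
  calc 1 / max C (1 / L) * ‖ξ‖ ^ 2 ≤ L * ‖ξ‖ ^ 2 := by gcongr
    _ = l * Real.exp (-(A * D)) * (γ * ‖ξ‖ ^ 2) := by rw [hL]; ring
    _ ≤ l * (Real.exp (A * ⟪a, x⟫) - s) * ⟪q (x, P x) ξ, ξ⟫ := by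
      have h5 : 0 ≤ Real.exp (A * ⟪a, x⟫) - s := (Real.exp_pos _).le.trans h3
      gcongr
    _ ≤ _ := h1

end IsSolutionJet

end BoundaryContact

/-! ### Convexity and derivatives up to the boundary -/

section ConvexFirstOrder

variable {E : Type*} [NormedAddCommGroup E] [NormedSpace ℝ E]

lemma ConvexOn.add_fderiv_le {Ω : Set E} {u : E → ℝ} {L : E →L[ℝ] ℝ} {x y : E}
    (hu : ConvexOn ℝ Ω u) (hx : x ∈ Ω) (hy : y ∈ Ω) (hL : HasFDerivAt u L x) :
    u x + L (y - x) ≤ u y := by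
  have h1 : ConvexOn ℝ (Icc 0 1) fun t : ℝ => u (x + t • (y - x)) := by
    refine ⟨convex_Icc _ _, fun s hs t ht a b ha hb hab => ?_⟩
    have hmem : ∀ t ∈ Icc (0 : ℝ) 1, x + t • (y - x) ∈ Ω := fun t ht =>
      hu.1.add_smul_sub_mem hx hy ht
    have := hu.2 (hmem s hs) (hmem t ht) ha hb hab
    obtain rfl : b = 1 - a := by linarith
    have heq : x + (a • s + (1 - a) • t) • (y - x)
        = a • (x + s • (y - x)) + (1 - a) • (x + t • (y - x)) := by
      simp only [smul_eq_mul]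
      module
    exact (congrArg u heq).trans_le this
  have h2 : HasDerivAt (fun t : ℝ => u (x + t • (y - x))) (L (y - x)) 0 := by
    have hL' : HasFDerivAt u L (x + (0 : ℝ) • (y - x)) := by simpa using hL
    exact hL'.comp_hasDerivAt 0 (hasDerivAt_line x (y - x) 0)
  have := h1.le_slope_of_hasDerivAt (by simp) (by simp) zero_lt_one h2
  simp only [slope_def_field, zero_smul, one_smul, add_zero, sub_zero, div_one,
    add_sub_cancel] at this
  linarith

end ConvexFirstOrder

section Derivatives

variable {E : Type*} [NormedAddCommGroup E] [NormedSpace ℝ E]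
variable {F : Type*} [NormedAddCommGroup F] [NormedSpace ℝ F]

lemma Convex.uniqueDiffOn_closure {Ω : Set E} (hΩ : IsOpen Ω) (hconv : Convex ℝ Ω)
    (hne : Ω.Nonempty) : UniqueDiffOn ℝ (closure Ω) :=
  uniqueDiffOn_convex hconv.closure (hne.mono (interior_maximal subset_closure hΩ))

lemma UniqueDiffOn.fderivWithin_eq_of_eqOn {s : Set E} (hs : UniqueDiffOn ℝ s) {g h : E → F}
    {g' h' : E →L[ℝ] F} {x : E} (hx : x ∈ s) (hg : HasFDerivWithinAt g g' s x)
    (hh : HasFDerivWithinAt h h' s x) (heq : EqOn g h s) : g' = h' :=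
  (hs x hx).eq hg (hh.congr heq (heq hx))

lemma ContDiffOn.fderivWithin_fderivWithin_comm {Ω : Set E} (hΩ : IsOpen Ω) (hconv : Convex ℝ Ω)
    (hne : Ω.Nonempty) {f : E → F} (hf : ContDiffOn ℝ ∞ f (closure Ω)) {x : E}
    (hx : x ∈ closure Ω) (v w : E) :
    fderivWithin ℝ (fderivWithin ℝ f (closure Ω)) (closure Ω) x v w
      = fderivWithin ℝ (fderivWithin ℝ f (closure Ω)) (closure Ω) x w v :=
  (hf x hx).isSymmSndFDerivWithinAt
    (by rw [minSmoothness_of_isRCLikeNormedField]; exact WithTop.coe_le_coe.2 le_top)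
    (Convex.uniqueDiffOn_closure hΩ hconv hne)
    (closure_mono (interior_maximal subset_closure hΩ) hx) hx v w

lemma ContDiffOn.hasFDerivWithinAt_fderivWithin {s : Set E} {f : E → F} {x : E}
    (hf : ContDiffOn ℝ ∞ f s) (hx : x ∈ s) : HasFDerivWithinAt f (fderivWithin ℝ f s x) s x :=
  (hf.differentiableOn (by simp) x hx).hasFDerivWithinAt

end Derivatives

section Gradient

variable {E : Type*} [NormedAddCommGroup E] [InnerProductSpace ℝ E] [FiniteDimensional ℝ E]
variable {ι : Type*} [Fintype ι]

/-- The gradient of `u` relative to `s`. -/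
noncomputable def gradWithin (e : OrthonormalBasis ι ℝ E) (s : Set E) (u : E → ℝ) (x : E) : E :=
  ∑ i, fderivWithin ℝ u s x (e i) • e i

variable {e : OrthonormalBasis ι ℝ E} {s Ω : Set E} {u : E → ℝ} {x : E}

lemma inner_gradWithin (v : E) : ⟪gradWithin e s u x, v⟫ = fderivWithin ℝ u s x v := by
  conv_rhs => rw [← e.sum_repr' v]
  simp [gradWithin, sum_inner, inner_smul_left, mul_comm]

lemma innerSL_gradWithin : innerSL ℝ (gradWithin e s u x) = fderivWithin ℝ u s x := by
  ext v
  rw [innerSL_apply_apply, inner_gradWithin]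

lemma contDiffOn_gradWithin (hs : UniqueDiffOn ℝ s) (hu : ContDiffOn ℝ ∞ u s) :
    ContDiffOn ℝ ∞ (gradWithin e s u) s := by
  unfold gradWithin
  exact ContDiffOn.sum fun i _ =>
    ((hu.fderivWithin hs (by simp)).clm_apply contDiffOn_const).smul contDiffOn_const

lemma inner_fderivWithin_gradWithin (hs : UniqueDiffOn ℝ s) (hu : ContDiffOn ℝ ∞ u s)
    (hx : x ∈ s) (v w : E) :
    ⟪fderivWithin ℝ (gradWithin e s u) s x v, w⟫
      = fderivWithin ℝ (fderivWithin ℝ u s) s x v w := by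
  have h1 := ((contDiffOn_gradWithin (e := e) hs hu).hasFDerivWithinAt_fderivWithin hx).inner ℝ
    (hasFDerivWithinAt_const w x s)
  have h2 := ((hu.fderivWithin hs (m := ∞) (by simp)).hasFDerivWithinAt_fderivWithin hx).clm_apply
    (hasFDerivWithinAt_const w x s)
  have := DFunLike.congr_fun
    (hs.fderivWithin_eq_of_eqOn hx h1 h2 fun y _ => inner_gradWithin w) v
  simpa using this

lemma gradient_eq_gradWithin (hs : s ∈ 𝓝 x) : ∇ u x = gradWithin e s u x := by
  refine ext_inner_right ℝ fun v => ?_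
  rw [inner_gradWithin, fderivWithin_of_mem_nhds hs, gradient,
    InnerProductSpace.toDual_symm_apply]

lemma hasFDerivAt_innerSL_gradWithin (hΩ : IsOpen Ω) (hu : ContDiffOn ℝ ∞ u (closure Ω))
    (hx : x ∈ Ω) : HasFDerivAt u (innerSL ℝ (gradWithin e (closure Ω) u x)) x := by
  rw [innerSL_gradWithin]
  exact (hu.hasFDerivWithinAt_fderivWithin (subset_closure hx)).hasFDerivAt
    (IsSolutionJet.closure_mem_nhds hΩ hx)

lemma ConvexOn.add_inner_gradWithin_le (hΩ : IsOpen Ω) (hne : Ω.Nonempty)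
    (hu : ContDiffOn ℝ ∞ u (closure Ω)) (hc : ConvexOn ℝ Ω u) {y : E} (hx : x ∈ closure Ω)
    (hy : y ∈ closure Ω) : u x + ⟪gradWithin e (closure Ω) u x, y - x⟫ ≤ u y := by
  have hs := Convex.uniqueDiffOn_closure hΩ hc.1 hne
  have hP := (contDiffOn_gradWithin (e := e) hs hu).continuousOn
  have h1 : ∀ z ∈ Ω, u z + ⟪gradWithin e (closure Ω) u z, y - z⟫ ≤ u y := by
    intro z hz
    refine le_on_closure (f := fun y => u z + ⟪gradWithin e (closure Ω) u z, y - z⟫) (g := u)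
      (fun w hw => ?_) (by fun_prop) hu.continuousOn hy
    exact hc.add_fderiv_le hz hw (hasFDerivAt_innerSL_gradWithin hΩ hu hz)
  exact le_on_closure (f := fun z => u z + ⟪gradWithin e (closure Ω) u z, y - z⟫)
    (g := fun _ => u y) h1
    (hu.continuousOn.add (hP.inner (continuousOn_const.sub continuousOn_id))) continuousOn_const hx

/-- Equal gradients give one supporting hyperplane touching at both `x` and `y`, which would make
`u` affine on the segment between them. -/
lemma StrictConvexOn.gradWithin_ne (hΩ : IsOpen Ω) (hu : ContDiffOn ℝ ∞ u (closure Ω))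
    (hc : StrictConvexOn ℝ Ω u) {y : E} (hx : x ∈ closure Ω) (hxΩ : x ∉ Ω) (hy : y ∈ Ω) :
    gradWithin e (closure Ω) u x ≠ gradWithin e (closure Ω) u y := by
  intro heq
  have hle : ∀ {z w : E}, z ∈ closure Ω → w ∈ closure Ω →
      u z + ⟪gradWithin e (closure Ω) u z, w - z⟫ ≤ u w := fun hz hw =>
    hc.convexOn.add_inner_gradWithin_le hΩ ⟨y, hy⟩ hu hz hw
  have hyc := subset_closure hy
  -- Strict convexity is known only in the open set `Ω`, so it is used between the midpoint `m` and
  -- `y`.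
  set m := (1 / 2 : ℝ) • x + (1 / 2 : ℝ) • y with hm
  have hmΩ : m ∈ Ω := by
    rw [← hΩ.interior_eq] at hy ⊢
    exact hc.1.combo_closure_interior_mem_interior hx hy (by norm_num) (by norm_num) (by norm_num)
  have hmy : m ≠ y := by
    intro h
    have : x - y = (2 : ℝ) • (m - y) := by
      rw [hm]
      module
    rw [h, sub_self, smul_zero, sub_eq_zero] at this
    exact hxΩ (this ▸ hy)
  have hlt := hc.2 hmΩ hy hmy (by norm_num : (0 : ℝ) < 1 / 2) (by norm_num : (0 : ℝ) < 1 / 2)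
    (by norm_num)
  have hm' : (1 / 2 : ℝ) • m + (1 / 2 : ℝ) • y ∈ closure Ω :=
    hc.1.closure (subset_closure hmΩ) hyc (by norm_num) (by norm_num) (by norm_num)
  have h1 := hle hx hyc
  have h2 := hle (subset_closure hmΩ) hx
  have h3 := hle (subset_closure hmΩ) hyc
  have h4 := hle hyc hm'
  have e2 : x - m = (1 / 2 : ℝ) • (x - y) := by rw [hm]; module
  have e3 : y - m = -((1 / 2 : ℝ) • (x - y)) := by rw [hm]; module
  have e4 : (1 / 2 : ℝ) • m + (1 / 2 : ℝ) • y - y = (1 / 4 : ℝ) • (x - y) := by rw [hm]; module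
  rw [heq, ← neg_sub x y, inner_neg_right] at h1
  rw [e2] at h2
  rw [e3, inner_neg_right] at h3
  rw [e4, inner_smul_right] at h4
  simp only [smul_eq_mul] at hlt
  linarith

/-- Along a line through `x`, the function `u` minus its tangent has a minimum at `x`. -/
lemma ConvexOn.inner_fderivWithin_gradWithin_nonneg (hΩ : IsOpen Ω) (hne : Ω.Nonempty)
    (hu : ContDiffOn ℝ ∞ u (closure Ω)) (hc : ConvexOn ℝ Ω u) (hx : x ∈ Ω) (v : E) :
    0 ≤ ⟪fderivWithin ℝ (gradWithin e (closure Ω) u) (closure Ω) x v, v⟫ := by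
  have hs := Convex.uniqueDiffOn_closure hΩ hc.1 hne
  set P := gradWithin e (closure Ω) u with hPdef
  have hline := IsSolutionJet.line_mem hΩ hx v
  have hx0 : x + (0 : ℝ) • v ∈ Ω := hline.self_of_nhds
  have hP : HasFDerivAt P (fderivWithin ℝ P (closure Ω) (x + (0 : ℝ) • v)) (x + (0 : ℝ) • v) :=
    ((contDiffOn_gradWithin hs hu).hasFDerivWithinAt_fderivWithin
      (subset_closure hx0)).hasFDerivAt (IsSolutionJet.closure_mem_nhds hΩ hx0)
  have h1 : ∀ᶠ t : ℝ in 𝓝 0, HasDerivAt (fun t : ℝ => u (x + t • v) - t * ⟪P x, v⟫)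
      (⟪P (x + t • v), v⟫ - ⟪P x, v⟫) t := by
    filter_upwards [hline] with t ht
    have := ((hasFDerivAt_innerSL_gradWithin (e := e) hΩ hu ht).comp_hasDerivAt t
      (hasDerivAt_line x v t)).sub ((hasDerivAt_id t).mul_const ⟪P x, v⟫)
    refine this.congr_deriv ?_
    simp [hPdef]
  have h2 : HasDerivAt (fun t : ℝ => ⟪P (x + t • v), v⟫ - ⟪P x, v⟫)
      ⟪fderivWithin ℝ P (closure Ω) x v, v⟫ 0 := by
    have := ((hP.comp_hasDerivAt 0 (hasDerivAt_line x v 0)).inner ℝ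
      (hasDerivAt_const (0 : ℝ) v)).sub_const ⟪P x, v⟫
    refine this.congr_deriv ?_
    simp
  refine nonneg_of_hasDerivAt_of_isLocalMin h1 h2 ?_
  filter_upwards [hline] with t ht
  have := hc.add_inner_gradWithin_le (e := e) hΩ hne hu (subset_closure hx) (subset_closure ht)
  rw [add_sub_cancel_left, inner_smul_right] at this
  simp only [zero_smul, add_zero, zero_mul, sub_zero]
  linarith

end Gradient

/-! ### From the geometric equation to a solution jet -/

section MeanCurvature

variable {n : ℕ} {Ω Ω' : Set (EuclideanSpace ℝ (Fin n))} {u : EuclideanSpace ℝ (Fin n) → ℝ} {c : ℝ}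

/-- The factor `lorentzFactor` has derivative `lorentzFactor p ^ 3 • innerSL ℝ p`; the product rule
produces the trace and the extra term `⟪W P, P⟫`. -/
lemma lorentzMeanCurvature_eq {P : EuclideanSpace ℝ (Fin n) → EuclideanSpace ℝ (Fin n)}
    {W : EuclideanSpace ℝ (Fin n) →L[ℝ] EuclideanSpace ℝ (Fin n)} {x : EuclideanSpace ℝ (Fin n)}
    (hP : ∇ u =ᶠ[𝓝 x] P) (hW : HasFDerivAt P W x) (hlt : ‖P x‖ < 1) :
    lorentzMeanCurvature u x = lorentzTrace (EuclideanSpace.basisFun (Fin n) ℝ) (P x) W := by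
  have h1 : HasFDerivAt (fun y => (Real.sqrt (1 - ‖∇ u y‖ ^ 2))⁻¹ • ∇ u y)
      (lorentzFactor (P x) • W
        + ((lorentzFactor (P x) ^ 3 • innerSL ℝ (P x)).comp W).smulRight (P x)) x := by
    refine (((hasFDerivAt_lorentzFactor hlt).comp x hW).smul hW).congr_of_eventuallyEq ?_
    filter_upwards [hP] with y hy
    simp [lorentzFactor, hy]
  have h2 : ∑ i, ⟪P x, W (EuclideanSpace.single i 1)⟫ * P x i = ⟪P x, W (P x)⟫ := by
    have hsum : ∑ i, P x i • EuclideanSpace.single i (1 : ℝ) = P x := by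
      simpa using (EuclideanSpace.basisFun (Fin n) ℝ).sum_repr (P x)
    have : ⟪P x, W (∑ i, P x i • EuclideanSpace.single i (1 : ℝ))⟫
        = ∑ i, ⟪P x, W (EuclideanSpace.single i 1)⟫ * P x i := by
      simp only [map_sum, inner_sum, map_smul, inner_smul_right, mul_comm]
    rw [← this, hsum]
  rw [lorentzMeanCurvature, euclideanDiv, h1.fderiv]
  simp [lorentzTrace, quadForm_apply, Finset.sum_add_distrib, Finset.mul_sum,
    EuclideanSpace.inner_single_right, real_inner_comm (P x)]
  rw [← h2]
  simp [Finset.mul_sum, mul_assoc]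

/-- The derivatives of `u` up to the boundary form a solution jet. -/
theorem IsStrictlyConvexCMCSolution.isSolutionJet (h : IsStrictlyConvexCMCSolution Ω Ω' u c)
    (hΩ : IsOpen Ω) (hne : Ω.Nonempty) (hΩ' : IsOpen Ω') {e}
    (he : e = EuclideanSpace.basisFun (Fin n) ℝ) {P W T S} (hP : P = gradWithin e (closure Ω) u)
    (hW : W = fderivWithin ℝ P (closure Ω)) (hT : T = fderivWithin ℝ W (closure Ω))
    (hS : S = fderivWithin ℝ T (closure Ω)) : IsSolutionJet e Ω Ω' u P W T S c := by
  have hu := h.smooth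
  have hcv := h.strictConvex.1
  have hs := Convex.uniqueDiffOn_closure hΩ hcv hne
  have hPs : ContDiffOn ℝ ∞ P (closure Ω) := hP ▸ contDiffOn_gradWithin hs hu
  have hWs : ContDiffOn ℝ ∞ W (closure Ω) := hW ▸ hPs.fderivWithin hs (by simp)
  have hTs : ContDiffOn ℝ ∞ T (closure Ω) := hT ▸ hWs.fderivWithin hs (by simp)
  have hPd : ∀ x ∈ closure Ω, HasFDerivWithinAt P (W x) (closure Ω) x := fun x hx =>
    hW ▸ hPs.hasFDerivWithinAt_fderivWithin hx
  have hWd : ∀ x ∈ closure Ω, HasFDerivWithinAt W (T x) (closure Ω) x := fun x hx =>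
    hT ▸ hWs.hasFDerivWithinAt_fderivWithin hx
  have hTd : ∀ x ∈ closure Ω, HasFDerivWithinAt T (S x) (closure Ω) x := fun x hx =>
    hS ▸ hTs.hasFDerivWithinAt_fderivWithin hx
  have hgrad : ∀ x ∈ Ω, ∇ u x = P x := fun x hx =>
    hP ▸ gradient_eq_gradWithin (IsSolutionJet.closure_mem_nhds hΩ hx)
  have W_symm : ∀ x ∈ closure Ω, ∀ a b, ⟪W x a, b⟫ = ⟪W x b, a⟫ := by
    intro x hx a b
    rw [hW, hP, inner_fderivWithin_gradWithin hs hu hx, inner_fderivWithin_gradWithin hs hu hx]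
    exact hu.fderivWithin_fderivWithin_comm hΩ hcv hne hx a b
  have T_comm : ∀ x ∈ closure Ω, ∀ a b, T x a b = T x b a := by
    intro x hx a b
    rw [hT, hW]
    exact hPs.fderivWithin_fderivWithin_comm hΩ hcv hne hx a b
  have T_symm : ∀ x ∈ closure Ω, ∀ a b c, ⟪T x a b, c⟫ = ⟪T x a c, b⟫ := by
    intro x hx a b c
    have key : ∀ b c, HasFDerivWithinAt (fun y => ⟪W y b, c⟫) _ (closure Ω) x := fun b c =>
      ((hWd x hx).clm_apply (hasFDerivWithinAt_const b x _)).inner ℝ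
        (hasFDerivWithinAt_const c x _)
    have := DFunLike.congr_fun (hs.fderivWithin_eq_of_eqOn hx (key b c) (key c b)
      fun y hy => W_symm y hy b c) a
    simpa using this
  have S_comm : ∀ x ∈ closure Ω, ∀ a b, S x a b = S x b a := by
    intro x hx a b
    rw [hS, hT]
    exact hWs.fderivWithin_fderivWithin_comm hΩ hcv hne hx a b
  have S_comm' : ∀ x ∈ closure Ω, ∀ a b c, S x a b c = S x a c b := by
    intro x hx a b c
    have key : ∀ b c, HasFDerivWithinAt (fun y => T y b c) _ (closure Ω) x := fun b c =>
      ((hTd x hx).clm_apply (hasFDerivWithinAt_const b x _)).clm_apply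
        (hasFDerivWithinAt_const c x _)
    have := DFunLike.congr_fun (hs.fderivWithin_eq_of_eqOn hx (key b c) (key c b)
      fun y hy => T_comm y hy b c) a
    simpa using this
  have S_symm : ∀ x ∈ closure Ω, ∀ a b c d, ⟪S x a b c, d⟫ = ⟪S x a b d, c⟫ := by
    intro x hx a b c d
    have key : ∀ c d, HasFDerivWithinAt (fun y => ⟪T y b c, d⟫) _ (closure Ω) x := fun c d =>
      (((hTd x hx).clm_apply (hasFDerivWithinAt_const b x _)).clm_apply
        (hasFDerivWithinAt_const c x _)).inner ℝ (hasFDerivWithinAt_const d x _)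
    have := DFunLike.congr_fun (hs.fderivWithin_eq_of_eqOn hx (key c d) (key d c)
      fun y hy => T_symm y hy b c d) a
    simpa using this
  have mapsTo : ∀ x ∈ Ω, P x ∈ Ω' := by
    intro x hx
    rw [← hgrad x hx, ← h.gradient_image]
    exact mem_image_of_mem _ hx
  have surj : ∀ p ∈ Ω', ∃ x ∈ Ω, P x = p := by
    intro p hp
    rw [← h.gradient_image] at hp
    obtain ⟨x, hx, rfl⟩ := hp
    exact ⟨x, hx, (hgrad x hx).symm⟩
  refine ⟨fun x hx => ?_, hPd, hWd, fun x hx => (hTd x (subset_closure hx)).hasFDerivAt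
    (IsSolutionJet.closure_mem_nhds hΩ hx), fun x hx => ⟨fun a b => ?_, fun a => ?_⟩, T_comm,
    T_symm, fun x hx a b => ?_, mapsTo, surj, fun x hx => ?_, fun x hx => ?_⟩
  · rw [hP]
    exact hasFDerivAt_innerSL_gradWithin hΩ hu hx
  · rw [W_symm x hx, real_inner_comm]
  · refine le_on_closure (s := Ω) (f := fun _ => 0) (g := fun x => ⟪W x a, a⟫) (fun y hy => ?_)
      continuousOn_const
      ((hWs.continuousOn.clm_apply continuousOn_const).inner continuousOn_const) hx
    rw [hW, hP]
    exact h.strictConvex.convexOn.inner_fderivWithin_gradWithin_nonneg hΩ hne hu hy a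
  · have hx := subset_closure hx
    rw [S_comm' x hx a a b, S_comm x hx a b, S_symm x hx, S_comm' x hx b a b]
  -- By continuity `P x` lies in `closure Ω'`. It is not in `Ω'`: every value there is already taken
  -- inside `Ω`, and strict convexity forbids taking it again at a boundary point.
  · have hxc := frontier_subset_closure hx
    rw [hΩ.frontier_eq] at hx
    refine hΩ'.frontier_eq ▸ ⟨?_, fun hmem => ?_⟩
    · exact closure_mono (image_subset_iff.2 mapsTo)
        (hPs.continuousOn.image_closure (mem_image_of_mem P hxc))
    · obtain ⟨y, hy, hyx⟩ := surj _ hmem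
      rw [hP] at hyx
      exact h.strictConvex.gradWithin_ne hΩ hu hxc hx.2 hy hyx.symm
  · rw [← h.equation x hx, he]
    refine (lorentzMeanCurvature_eq ?_ ?_ ?_).symm
    · filter_upwards [hΩ.mem_nhds hx] with y hy using hgrad y hy
    · exact (hPd x (subset_closure hx)).hasFDerivAt (IsSolutionJet.closure_mem_nhds hΩ hx)
    · rw [← hgrad x hx]
      exact h.spacelike x hx

end MeanCurvature

/-! ### Translation to matrix inequalities -/

section HessianMatrix

variable {n : ℕ} {Ω : Set (EuclideanSpace ℝ (Fin n))} {u : EuclideanSpace ℝ (Fin n) → ℝ}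
  {x : EuclideanSpace ℝ (Fin n)}

lemma dotProduct_eq_inner (v w : Fin n → ℝ) :
    v ⬝ᵥ w = ⟪WithLp.toLp 2 v, WithLp.toLp 2 w⟫ := by
  simp [PiLp.inner_apply, dotProduct, mul_comm]

lemma dotProduct_hessianMatrix_mulVec {W : EuclideanSpace ℝ (Fin n) →L[ℝ] EuclideanSpace ℝ (Fin n)}
    (hW : ∀ i j, hessianMatrix Ω u x i j
      = ⟪W (EuclideanSpace.single i 1), EuclideanSpace.single j 1⟫) (v : Fin n → ℝ) :
    v ⬝ᵥ (hessianMatrix Ω u x).mulVec v = ⟪W (WithLp.toLp 2 v), WithLp.toLp 2 v⟫ := by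
  have hv : (WithLp.toLp 2 v : EuclideanSpace ℝ (Fin n))
      = ∑ i, v i • EuclideanSpace.single i (1 : ℝ) := by
    have := (EuclideanSpace.basisFun (Fin n) ℝ).sum_repr (WithLp.toLp 2 v)
    simpa using this.symm
  rw [hv]
  simp only [map_sum, map_smul, sum_inner, inner_sum, inner_smul_left, inner_smul_right,
    dotProduct, Matrix.mulVec, hW, Finset.mul_sum]
  rw [Finset.sum_comm]
  refine Finset.sum_congr rfl fun i _ => Finset.sum_congr rfl fun j _ => ?_
  simp only [conj_trivial]
  ring

end HessianMatrix

theorem lemma4p8 (n : ℕ) (Ω Ω' : Set (EuclideanSpace ℝ (Fin n)))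
    (hΩ : IsSmoothUniformlyConvexDomain Ω) (hΩ' : IsSmoothUniformlyConvexDomain Ω')
    (hΩ'_ball : closure Ω' ⊆ Metric.ball 0 1) :
    ∃ C : ℝ, 0 < C ∧
      ∀ (u : EuclideanSpace ℝ (Fin n) → ℝ) (c : ℝ), IsStrictlyConvexCMCSolution Ω Ω' u c →
        ∀ x ∈ closure Ω,
          (1 / C) • (1 : Matrix (Fin n) (Fin n) ℝ) ≤ hessianMatrix Ω u x ∧
          hessianMatrix Ω u x ≤ C • (1 : Matrix (Fin n) (Fin n) ℝ) := by
  -- For `n = 0` there is only one matrix; for `n > 0` the space is nontrivial, as the lower bound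
  -- for `c` requires.
  rcases n.eq_zero_or_pos with rfl | hn
  · exact ⟨1, one_pos, fun u c _ x _ =>
      ⟨(Subsingleton.elim _ _).le, (Subsingleton.elim _ _).le⟩⟩
  have : Nonempty (Fin n) := ⟨⟨0, hn⟩⟩
  obtain ⟨f, ε, hf⟩ := hΩ.exists_isDefiningFunction
  obtain ⟨f', ε', hf'⟩ := hΩ'.exists_isDefiningFunction
  obtain ⟨D, hD, hbound⟩ := IsSolutionJet.exists_hessian_bounds
    (EuclideanSpace.basisFun (Fin n) ℝ) hΩ.isOpen hΩ.convex hΩ.isBounded hΩ.nonempty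
    hΩ'.isOpen hΩ'.convex hΩ'.isBounded hΩ'.nonempty hΩ'_ball hf hf'
  refine ⟨D, hD, fun u c hu x hx => ?_⟩
  have hs := Convex.uniqueDiffOn_closure hΩ.isOpen hΩ.convex hΩ.nonempty
  have J := hu.isSolutionJet hΩ.isOpen hΩ.nonempty hΩ'.isOpen rfl rfl rfl rfl rfl
  have hb := hbound J x hx
  have hW := J.isSymmNonneg x hx
  set W := fderivWithin ℝ (gradWithin (EuclideanSpace.basisFun (Fin n) ℝ) (closure Ω) u)
    (closure Ω) x with hWdef
  have hH : ∀ i j, hessianMatrix Ω u x i j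
      = ⟪W (EuclideanSpace.single i 1), EuclideanSpace.single j 1⟫ := by
    intro i j
    rw [hessianMatrix, Matrix.of_apply, iteratedFDerivWithin_two_apply' u hs hx, hWdef,
      inner_fderivWithin_gradWithin hs hu.smooth hx]
  have hherm : (hessianMatrix Ω u x).IsHermitian := by
    ext i j
    rw [Matrix.conjTranspose_apply, hH, hH, hW.symm, real_inner_comm]
    simp
  have hone : ∀ a : ℝ, (a • (1 : Matrix (Fin n) (Fin n) ℝ)).IsHermitian := fun a => by
    simp [Matrix.IsHermitian]
  have hnorm : ∀ v : Fin n → ℝ, v ⬝ᵥ v = ‖(WithLp.toLp 2 v : EuclideanSpace ℝ (Fin n))‖ ^ 2 :=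
    fun v => by rw [dotProduct_eq_inner, real_inner_self_eq_norm_sq]
  constructor
  · refine Matrix.le_iff.2 (.of_dotProduct_mulVec_nonneg (hherm.sub (hone _)) fun v => ?_)
    have := (hb (WithLp.toLp 2 v)).1
    rw [star_trivial, Matrix.sub_mulVec, Matrix.smul_mulVec, Matrix.one_mulVec, dotProduct_sub,
      dotProduct_smul, hnorm, dotProduct_hessianMatrix_mulVec hH, smul_eq_mul]
    linarith
  · refine Matrix.le_iff.2 (.of_dotProduct_mulVec_nonneg ((hone _).sub hherm) fun v => ?_)
    have := (hb (WithLp.toLp 2 v)).2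
    rw [star_trivial, Matrix.sub_mulVec, Matrix.smul_mulVec, Matrix.one_mulVec, dotProduct_sub,
      dotProduct_smul, hnorm, dotProduct_hessianMatrix_mulVec hH, smul_eq_mul]
    linarith
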